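/- Let $G$ be a connected, simply connected (finite-dimensional, real) Lie group whose Lie algebra $\mathfrak g$ is two-step nilpotent, and let $\mathfrak c\subset\mathfrak g$ be the center of $\mathfrak g$ (the Lie algebra of the center $C$ of $G$). Assume $\dim(\mathfrak g/\mathfrak c)=\dim(G/C)=2$. Let $\Gamma\subset G$ be a lattice, i.e. a discrete subgroup such that $G/\Gamma$ carries a finite nonzero $G$-invariant Borel measure, and let $N=G/\Gamma$. For a homogeneous space $M=G'/\Gamma'$ of a Lie group $G'$ with Lie algebra $\mathfrak g'$ by a lattice $\Gamma'$, and $m_1,m_2\in M$, a connecting curve for the pair $m_1,m_2$ is a nonconstant curve $c(t)=\exp(tx)\cdot m_1$, $0\le t\le 1$, $x\in\mathfrak g'$, with $c(0)=m_1$ and $c(1)=m_2$. The pair $m_1,m_2$ is blockable if there is a finite set $B\subset M\setminus\{m_1,m_2\}$ such that $c([0,1])\cap B\neq\emptyset$ for every connecting curve $c$ of the pair. It is midpoint blockable if the set of all midpoints $c(1/2)$ of its connecting curves is finite. Let $H$ be the three-dimensional Heisenberg group of upper triangular unipotent real $3\times 3$ matrices. Then: (a) $\dim C=d+1$ for some integer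 $d\ge 0$, and there are a lattice $\Lambda\subset H$ and a Lie group isomorphism $G\cong H\times\mathbb R^d$ that induces an identification $N\cong M\times T^d$, where $M=H/\Lambda$ is a three-dimensional Heisenberg manifold and $T^d=\mathbb R^d/\mathbb Z^d$; under this identification, a pair of points $n_1=(m_1,t_1)$, $n_2=(m_2,t_2)$ of $N$ is blockable if and only if the pair $m_1,m_2$ is blockable in $M$. (b) A pair of points in $N$ is blockable if and only if it is midpoint blockable. (c) Every point in $N$ is blockable away from itself, i.e. the pair $n,n$ is blockable for every $n\in N$. (d) The set of blockable pairs is dense in $N\times N$ and is a countable union of closed submanifolds of $N\times N$ of positive codimension. -/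

import Mathlib

open scoped Manifold ContDiff

/-! ### Lattices, one-parameter subgroups, connecting curves, blocking -/

/-- A lattice in a topological group `G`: a discrete subgroup `Γ` such that `G ⧸ Γ` carries a
`G`-invariant Borel probability measure (equivalently, a nonzero finite invariant one). -/
structure IsLattice {G : Type*} [Group G] [TopologicalSpace G] (Γ : Subgroup G) : Prop where
  discrete : IsDiscrete (Γ : Set G)
  finite_covolume :
    letI : MeasurableSpace (G ⧸ Γ) := borel (G ⧸ Γ)
    ∃ μ : MeasureTheory.Measure (G ⧸ Γ), MeasureTheory.IsProbabilityMeasure μ ∧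
      ∀ g : G, μ.map (fun m => g • m) = μ

section Blocking

variable {G : Type*} [Group G] [TopologicalSpace G] {Γ : Subgroup G}

/-- The set of (nonconstant) connecting curves for the pair `m₁, m₂` of points of `G ⧸ Γ`: the
curves `c(t) = φ(t) • m₁`, where `φ` is a one-parameter subgroup of `G`, that is a continuous
homomorphism `ℝ → G` (for a Lie group these are exactly the maps `t ↦ exp (t x)` with `x` in the
Lie algebra), such that `c(0) = m₁`, `c(1) = m₂`.  The parameter interval is `[0, 1]`; the
constant curve (which connects a point with itself) is not a connecting curve. -/
def connectingCurves (m₁ m₂ : G ⧸ Γ) : Set (ℝ → G ⧸ Γ) :=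
  {c | (∃ φ : Multiplicative ℝ →ₜ* G, ∀ t : ℝ, c t = φ (Multiplicative.ofAdd t) • m₁) ∧
    c 0 = m₁ ∧ c 1 = m₂ ∧ ∃ t ∈ Set.Icc (0 : ℝ) 1, c t ≠ m₁}

/-- `B` is a blocking set for `m₁, m₂`: a finite subset of `(G ⧸ Γ) \ {m₁, m₂}` that meets every
connecting curve. -/
structure IsBlockingSet (m₁ m₂ : G ⧸ Γ) (B : Set (G ⧸ Γ)) : Prop where
  finite : B.Finite
  subset : B ⊆ {m₁, m₂}ᶜ
  meets : ∀ c ∈ connectingCurves m₁ m₂, ((c '' Set.Icc (0 : ℝ) 1) ∩ B).Nonempty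

/-- The pair `m₁, m₂` is (connection) blockable. -/
def Blockable (m₁ m₂ : G ⧸ Γ) : Prop :=
  ∃ B : Set (G ⧸ Γ), IsBlockingSet m₁ m₂ B

/-- The pair `m₁, m₂` is midpoint blockable: the set of midpoints of its connecting curves is
finite. -/
def MidpointBlockable (m₁ m₂ : G ⧸ Γ) : Prop :=
  {m : G ⧸ Γ | ∃ c ∈ connectingCurves m₁ m₂, m = c (1 / 2)}.Finite

end Blocking

/-! ### Closed submanifolds -/

/-- `S` is a closed (embedded, smooth) submanifold of codimension `k` of the manifold `M`: it is
a closed subset, and around each of its points there is a smooth chart of `M` in which `S` is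
given by a linear subspace of codimension `k`. -/
structure IsClosedSubmanifold {E H M : Type*} [NormedAddCommGroup E] [NormedSpace ℝ E]
    [TopologicalSpace H] (I : ModelWithCorners ℝ E H) [TopologicalSpace M] [ChartedSpace H M]
    (k : ℕ) (S : Set M) : Prop where
  isClosed : IsClosed S
  slice : ∀ p ∈ S, ∃ e ∈ IsManifold.maximalAtlas I ∞ M, p ∈ e.source ∧
    ∃ F : Submodule ℝ E, Module.finrank ℝ F + k = Module.finrank ℝ E ∧
      ∀ q ∈ e.source, q ∈ S ↔ I (e q) ∈ F

/-! ### The smooth structure on `G ⧸ Γ` and the Lie algebra of `G` -/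

section LieGroups

variable (E : Type*) [NormedAddCommGroup E] [NormedSpace ℝ E]
  {G : Type*} [TopologicalSpace G] [ChartedSpace E G] [Group G]

/-- The projection onto the quotient by a discrete subgroup is a local homeomorphism. -/
theorem isLocalHomeomorph_quotientMk [IsTopologicalGroup G] (Γ : Subgroup G)
    (hΓ : IsDiscrete (Γ : Set G)) : IsLocalHomeomorph (QuotientGroup.mk : G → G ⧸ Γ) :=
  (Γ.isQuotientCoveringMap hΓ).isCoveringMap.isLocalHomeomorph

/-- The smooth structure on `G ⧸ Γ`, for `Γ` discrete: the one whose charts are the charts of `G`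
composed with local inverses of the projection `G → G ⧸ Γ`. -/
@[reducible]
noncomputable def quotientChartedSpace [LieGroup 𝓘(ℝ, E) ∞ G] (Γ : Subgroup G)
    (hΓ : IsDiscrete (Γ : Set G)) : ChartedSpace E (G ⧸ Γ) :=
  haveI : IsTopologicalGroup G := topologicalGroup_of_lieGroup 𝓘(ℝ, E) ∞
  (isLocalHomeomorph_quotientMk Γ hΓ).chartedSpace QuotientGroup.mk_surjective

instance instLieGroupMinSmoothness [LieGroup 𝓘(ℝ, E) ∞ G] :
    LieGroup 𝓘(ℝ, E) (minSmoothness ℝ 3) G :=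
  LieGroup.of_le (n := ∞) (by
    rw [minSmoothness_of_isRCLikeNormedField]
    exact ENat.LEInfty.out)

end LieGroups

/-! ### The three-dimensional Heisenberg group -/

/-- The elements `h(x, y, z)` of the three-dimensional Heisenberg group. -/
@[ext]
structure Heisenberg where
  x : ℝ
  y : ℝ
  z : ℝ

namespace Heisenberg

/-- `h(x, y, z)` as an upper triangular unipotent matrix. -/
def toMatrix (h : Heisenberg) : Matrix (Fin 3) (Fin 3) ℝ :=
  !![1, h.x, h.z; 0, 1, h.y; 0, 0, 1]

instance : Mul Heisenberg := ⟨fun g h => ⟨g.x + h.x, g.y + h.y, g.z + h.z + g.x * h.y⟩⟩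
instance : One Heisenberg := ⟨⟨0, 0, 0⟩⟩
instance : Inv Heisenberg := ⟨fun g => ⟨-g.x, -g.y, -g.z + g.x * g.y⟩⟩

theorem mul_def (g h : Heisenberg) :
    g * h = ⟨g.x + h.x, g.y + h.y, g.z + h.z + g.x * h.y⟩ := rfl
theorem one_def : (1 : Heisenberg) = ⟨0, 0, 0⟩ := rfl
theorem inv_def (g : Heisenberg) : g⁻¹ = ⟨-g.x, -g.y, -g.z + g.x * g.y⟩ := rfl

/-- The multiplication is the matrix multiplication. -/
theorem toMatrix_mul (g h : Heisenberg) : (g * h).toMatrix = g.toMatrix * h.toMatrix := by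
  ext i j
  fin_cases i <;> fin_cases j <;>
    simp [toMatrix, mul_def, Matrix.mul_apply, Fin.sum_univ_three] <;> ring

instance : Group Heisenberg :=
  Group.ofLeftAxioms
    (fun a b c => by ext <;> simp only [mul_def] <;> ring)
    (fun a => by ext <;> simp [mul_def, one_def])
    (fun a => by ext <;> simp [mul_def, one_def, inv_def])

/-- The global coordinates `(x, y, z)`. -/
def coords : Heisenberg ≃ ℝ × ℝ × ℝ where
  toFun h := (h.x, h.y, h.z)
  invFun v := ⟨v.1, v.2.1, v.2.2⟩
  left_inv _ := rfl
  right_inv _ := rfl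

instance : TopologicalSpace Heisenberg := TopologicalSpace.induced coords inferInstance

/-- The coordinates as a homeomorphism onto `ℝ³`. -/
def coordsHomeomorph : Heisenberg ≃ₜ ℝ × ℝ × ℝ := coords.toHomeomorphOfIsInducing ⟨rfl⟩

/-- The smooth structure of the Heisenberg group, with `(x, y, z)` as a global chart. -/
noncomputable instance : ChartedSpace (ℝ × ℝ × ℝ) Heisenberg :=
  coordsHomeomorph.toOpenPartialHomeomorph.singletonChartedSpace rfl

end Heisenberg

/-! Structure of `G`. Two lifts `X`, `Y` of a basis of `𝔤/𝔠` have a central bracket `Z = [X, Y]`,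
which is nonzero because `𝔤` is not abelian. Completing `Z` to a basis of the center gives `𝔤 ≅ 𝔥 ⊕
ℝᵈ` (`LieAlgebra.exists_heisenberg_frame`). This is integrated by hand: from `d/dt Ad(exp tv) =
Ad(exp tv) ∘ ad v` follow the commutation relations between exponentials, so a product of
exponentials is a homomorphism `H × ℝᵈ → G` (`heisenbergExp`). It is a local diffeomorphism at the
identity, hence a covering, hence bijective since `G` is simply connected. Normal form of `Γ`. In
the coordinates `(x, y, s, w)`, `s = z - xy/2`, one-parameter subgroups are straight lines and the
commutator of two elements is their symplectic form `ω` in the `s` direction. Finite covolume forces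
every continuous homomorphism `G → ℝ` that is trivial on `Γ` to vanish. Two lattice elements with
minimal nonzero commutator, together with lifts of a basis of the projected central part, then
provide an automorphism that carries `Γ` to `{(a, b, c/k) : a, b, c ∈ ℤ} × ℤᵈ`
(`IsSymLattice.exists_normalForm`). This yields the splitting `G ⧸ Γ ≅ M × Tᵈ`. Blocking. The key
statement is that a pair is blockable exactly when the differences of its `x` and of its `y`
coordinates are rational (`IsAdapted.blockable_iff`). Connecting curves lift to curves from `g₁` to
`g₂γ`, `γ ∈ Γ`. If the differences are rational, the midpoints of these lifts fall into finitely
many classes modulo `Γ`, so the pair is midpoint blockable, and midpoint blockable pairs are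
blockable. Conversely, a finite blocking set meets a two-parameter family of curves; two
applications of the pigeonhole principle make first the meeting times and then the differences
rational (`IsAdapted.isRationalPair_of_blockable`). The remaining claims follow. Rationality sees
only `x` and `y`, hence only the Heisenberg factor; it holds for `(n, n)`; it is a dense condition;
and for each of the countably many values of the differences modulo `ℤ²` it cuts out a closed
submanifold of codimension two. -/

open scoped Topology

/-! ### One-parameter subgroups of a Lie group -/

section OneParameter

set_option linter.unusedSectionVars false

open Set VectorField

variable {E : Type*} [NormedAddCommGroup E] [NormedSpace ℝ E]
  {G : Type*} [TopologicalSpace G] [ChartedSpace E G] [Group G]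

/-- The linear map `ℝ → E` with value `v` at `1`. -/
abbrev velocityMap (v : E) : ℝ →L[ℝ] E := (1 : ℝ →L[ℝ] ℝ).smulRight v

/-- `γ` is the one-parameter subgroup of `G` whose velocity, in the preferred chart at `1`,
is `v`. -/
structure IsOneParameter (γ : ℝ → G) (v : E) : Prop where
  map_add : ∀ s t, γ (s + t) = γ s * γ t
  cont : Continuous γ
  deriv : HasDerivAt (fun t => extChartAt 𝓘(ℝ, E) (1 : G) (γ t)) v 0

theorem IsOneParameter.map_zero {γ : ℝ → G} {v : E} (h : IsOneParameter γ v) : γ 0 = 1 := by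
  have := h.map_add 0 0
  simpa using this

theorem IsOneParameter.scale {γ : ℝ → G} {v : E} (h : IsOneParameter γ v) (c : ℝ) :
    IsOneParameter (fun t => γ (c * t)) (c • v) where
  map_add s t := by rw [mul_add, h.map_add]
  cont := h.cont.comp (continuous_const.mul continuous_id)
  deriv := by
    have h1 : HasDerivAt (fun t : ℝ => c * t) c 0 := by
      simpa using (hasDerivAt_id (0 : ℝ)).const_mul c
    have h2 := h.deriv
    rw [show (0 : ℝ) = c * 0 by simp] at h2
    simpa [Function.comp_def] using! HasDerivAt.scomp (0 : ℝ) h2 h1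

theorem hasMFDerivAt_of_hasDerivAt_extChartAt {γ : ℝ → G} {x : G} {t : ℝ} (hx : γ t = x)
    (hc : ContinuousAt γ t) {v : E}
    (h : HasDerivAt (fun s => extChartAt 𝓘(ℝ, E) x (γ s)) v t) :
    HasMFDerivAt 𝓘(ℝ, ℝ) 𝓘(ℝ, E) γ t (velocityMap (E := E) v) := by
  subst hx
  have h1 : HasFDerivAt (fun s => extChartAt 𝓘(ℝ, E) (γ t) (γ s))
      (velocityMap (E := E) v) t := by
    have e : velocityMap (E := E) v = ContinuousLinearMap.toSpanSingleton ℝ v :=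
      ContinuousLinearMap.ext_ring (by simp)
    rw [e]
    exact h.hasFDerivAt
  exact ⟨hc, h1.hasFDerivWithinAt⟩

theorem hasDerivAt_extChartAt_of_hasMFDerivAt {γ : ℝ → G} {x : G} {t : ℝ} (hx : γ t = x) {v : E}
    (h : HasMFDerivAt 𝓘(ℝ, ℝ) 𝓘(ℝ, E) γ t (velocityMap (E := E) v)) :
    HasDerivAt (fun s => extChartAt 𝓘(ℝ, E) x (γ s)) v t := by
  subst hx
  have h2 : HasFDerivWithinAt (fun s => extChartAt 𝓘(ℝ, E) (γ t) (γ s))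
      (velocityMap (E := E) v) (Set.range 𝓘(ℝ, ℝ)) t := h.2
  have h3 := hasFDerivWithinAt_univ.1 (by simpa using h2)
  simpa using h3.hasDerivAt

theorem HasMFDerivWithinAt.congr_map {γ : ℝ → G} {s : Set ℝ} {t : ℝ} {L L' : ℝ →L[ℝ] E}
    (h : HasMFDerivWithinAt 𝓘(ℝ, ℝ) 𝓘(ℝ, E) γ s t L) (e : L = L') :
    HasMFDerivWithinAt 𝓘(ℝ, ℝ) 𝓘(ℝ, E) γ s t L' := e ▸ h

theorem HasMFDerivAt.congr_velocity {γ : ℝ → G} {t : ℝ} {v w : E}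
    (h : HasMFDerivAt 𝓘(ℝ, ℝ) 𝓘(ℝ, E) γ t (velocityMap (E := E) v)) (e : v = w) :
    HasMFDerivAt 𝓘(ℝ, ℝ) 𝓘(ℝ, E) γ t (velocityMap (E := E) w) := e ▸ h

variable [LieGroup 𝓘(ℝ, E) ∞ G]

theorem contMDiff_const_mul (g : G) : ContMDiff 𝓘(ℝ, E) 𝓘(ℝ, E) ∞ (fun x : G => g * x) :=
  contMDiff_mul_left

theorem mdifferentiableAt_const_mul (g x : G) :
    MDifferentiableAt 𝓘(ℝ, E) 𝓘(ℝ, E) (fun x : G => g * x) x :=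
  (contMDiff_const_mul g).contMDiffAt.mdifferentiableAt (by simp)

variable (E) in
/-- The derivative at `h` of the left translation by `g`, in the preferred charts. -/
noncomputable def leftDeriv (g h : G) : E →L[ℝ] E :=
  mfderiv 𝓘(ℝ, E) 𝓘(ℝ, E) (fun x : G => g * x) h

variable (G) in
/-- The left-invariant vector field with value `v` at `1`, as a map to the model space. -/
noncomputable def leftField (v : E) (g : G) : E := leftDeriv E g 1 v

theorem leftField_one (v : E) : leftField (E := E) G v 1 = v := by
  have this : (mfderiv 𝓘(ℝ, E) 𝓘(ℝ, E) (id : G → G) (1 : G) : E →L[ℝ] E) =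
    ContinuousLinearMap.id ℝ E := mfderiv_id
  have h : (fun x : G => 1 * x) = id := by ext; simp
  have h2 : (mfderiv 𝓘(ℝ, E) 𝓘(ℝ, E) (fun x : G => 1 * x) (1 : G) : E →L[ℝ] E) =
    ContinuousLinearMap.id ℝ E := by rw [← this, h]
  exact congrArg (fun L : E →L[ℝ] E => L v) h2

theorem leftDeriv_mul (g h k : G) :
    leftDeriv E (g * h) k = leftDeriv E g (h * k) ∘L leftDeriv E h k := by
  have D : (fun x => g * h * x) = (fun b => g * b) ∘ (fun x => h * x) := by
    ext x; simp [mul_assoc]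
  unfold leftDeriv
  rw [D]
  exact mfderiv_comp (I' := 𝓘(ℝ, E)) _ (mdifferentiableAt_const_mul g _)
    (mdifferentiableAt_const_mul h _)

theorem leftField_mul (v : E) (g h : G) :
    leftField (E := E) G v (g * h) = leftDeriv E g h (leftField (E := E) G v h) := by
  rw [leftField, leftDeriv_mul, mul_one]
  rfl

variable (G) in
/-- The left-invariant vector field with value `v` at `1`. -/
noncomputable def leftVectorField (v : E) (g : G) : TangentSpace 𝓘(ℝ, E) g :=
  mulInvariantVectorField (I := 𝓘(ℝ, E)) (G := G) v g

theorem HasMFDerivWithinAt.const_mul_left {γ : ℝ → G} {v : E} {s : Set ℝ} {t : ℝ}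
    (h : HasMFDerivWithinAt 𝓘(ℝ, ℝ) 𝓘(ℝ, E) γ s t
      (velocityMap (E := E) (leftField (E := E) G v (γ t)))) (g : G) :
    HasMFDerivWithinAt 𝓘(ℝ, ℝ) 𝓘(ℝ, E) (fun t => g * γ t) s t
      (velocityMap (E := E) (leftField (E := E) G v (g * γ t))) := by
  have h1 : HasMFDerivWithinAt 𝓘(ℝ, ℝ) 𝓘(ℝ, E) (fun t => g * γ t) s t
      (leftDeriv E g (γ t) ∘L velocityMap (leftField (E := E) G v (γ t))) :=
    (mdifferentiableAt_const_mul (E := E) g (γ t)).hasMFDerivAt.comp_hasMFDerivWithinAt t h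
  have e : (velocityMap (E := E) (leftField (E := E) G v (g * γ t)) : ℝ →L[ℝ] E) =
      leftDeriv E g (γ t) ∘L velocityMap (leftField (E := E) G v (γ t)) := by
    rw [leftField_mul]
    exact ContinuousLinearMap.ext_ring (by simp)
  exact h1.congr_map e.symm

theorem IsMIntegralCurveOn.const_mul {γ : ℝ → G} {v : E} {s : Set ℝ}
    (h : IsMIntegralCurveOn (I := 𝓘(ℝ, E)) γ (leftVectorField G v) s) (g : G) :
    IsMIntegralCurveOn (I := 𝓘(ℝ, E)) (fun t => g * γ t) (leftVectorField G v) s :=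
  fun t ht => HasMFDerivWithinAt.const_mul_left (h t ht) g

theorem contMDiff_one_leftField (v : E) :
    ContMDiff 𝓘(ℝ, E) 𝓘(ℝ, E).tangent 1
      (fun g : G => (⟨g, leftVectorField G v g⟩ : TangentBundle 𝓘(ℝ, E) G)) := by
  have h : (1 : ℕ∞ω) ≤ minSmoothness ℝ 2 := by
    rw [minSmoothness_of_isRCLikeNormedField]
    norm_num
  exact ContMDiff.of_le (contMDiff_mulInvariantVectorField (I := 𝓘(ℝ, E)) (G := G) v) h

/-- Left-invariant fields are complete: left translation carries one short integral curve at `1` to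
an integral curve of the same duration `ε` at every point, and a uniform time of existence suffices.
-/
theorem exists_isMIntegralCurve_leftField [CompleteSpace E] [T2Space G] (v : E) :
    ∃ γ : ℝ → G, γ 0 = 1 ∧ IsMIntegralCurve (I := 𝓘(ℝ, E)) γ (leftVectorField G v) := by
  have : IsManifold 𝓘(ℝ, E) 1 G := IsManifold.of_le (n := ∞) (by simp)
  have hv := contMDiff_one_leftField (G := G) v
  obtain ⟨γ, h0, hγ⟩ := exists_isMIntegralCurveAt_of_contMDiffAt_boundaryless (I := 𝓘(ℝ, E))
    (v := leftVectorField G v) (x₀ := (1 : G)) 0 hv.contMDiffAt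
  obtain ⟨ε, hε, hγ⟩ := isMIntegralCurveAt_iff'.1 hγ
  rw [Real.ball_eq_Ioo, zero_sub, zero_add] at hγ
  exact exists_isMIntegralCurve_of_isMIntegralCurveOn hv hε
    (fun x => ⟨fun t => x * γ t, by simp [h0], hγ.const_mul x⟩) 1

theorem IsMIntegralCurve.eq_of_leftField [T2Space G] {v : E}
    {γ γ' : ℝ → G} (h : IsMIntegralCurve (I := 𝓘(ℝ, E)) γ (leftVectorField G v))
    (h' : IsMIntegralCurve (I := 𝓘(ℝ, E)) γ' (leftVectorField G v)) (h0 : γ 0 = γ' 0) : γ = γ' := by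
  have : IsManifold 𝓘(ℝ, E) 1 G := IsManifold.of_le (n := ∞) (by simp)
  exact isMIntegralCurve_Ioo_eq_of_contMDiff_boundaryless (t₀ := 0)
    (contMDiff_one_leftField v) h h' h0

theorem exists_isOneParameter [CompleteSpace E] [T2Space G] (v : E) :
    ∃ γ : ℝ → G, IsOneParameter γ v := by
  obtain ⟨γ, h0, hγ⟩ := exists_isMIntegralCurve_leftField (E := E) (G := G) v
  refine ⟨γ, fun s t => ?_, ?_, ?_⟩
  -- Both `t ↦ γ (t + s)` and `t ↦ γ s * γ t` are integral curves that start at `γ s`, so they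
  -- agree.
  · have h1 := hγ.comp_add s
    have h2 : IsMIntegralCurve (I := 𝓘(ℝ, E)) (fun t => γ s * γ t) (leftVectorField G v) := by
      rw [isMIntegralCurve_iff_isMIntegralCurveOn] at hγ ⊢
      exact hγ.const_mul _
    have := IsMIntegralCurve.eq_of_leftField h1 h2 (by simp [h0])
    have := congrFun this t
    simpa [add_comm] using this
  · exact continuous_iff_continuousAt.2 fun t => (hγ t).continuousAt
  · exact hasDerivAt_extChartAt_of_hasMFDerivAt h0
      (HasMFDerivAt.congr_velocity (hγ 0) (v := leftField (E := E) G v (γ 0)) (by rw [h0, leftField_one]))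

/-- Only the velocity at `0` is part of the definition; the velocity at `t` comes from it by left
translation with `γ t`. Uniqueness of integral curves then makes the velocity determine the
subgroup, the principle behind all later identities between exponentials. -/
theorem IsOneParameter.isMIntegralCurve {γ : ℝ → G} {v : E} (h : IsOneParameter γ v) :
    IsMIntegralCurve (I := 𝓘(ℝ, E)) γ (leftVectorField G v) := by
  have h0 := (hasMFDerivAt_of_hasDerivAt_extChartAt h.map_zero h.cont.continuousAt h.deriv
    ).congr_velocity (w := leftField (E := E) G v (γ 0)) (by rw [h.map_zero, leftField_one])
  intro t
  have h2 := hasMFDerivWithinAt_univ.1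
    ((hasMFDerivWithinAt_univ.2 h0).const_mul_left (γ t))
  have e0 : (fun s => γ t * γ s) = fun s => γ (t + s) := by
    ext s; rw [h.map_add]
  rw [e0] at h2
  have h5 : HasMFDerivAt 𝓘(ℝ, ℝ) 𝓘(ℝ, ℝ) (fun s : ℝ => s - t) t (ContinuousLinearMap.id ℝ ℝ) :=
    ((hasFDerivAt_id t).sub_const t).hasMFDerivAt
  have h6 : HasMFDerivAt 𝓘(ℝ, ℝ) 𝓘(ℝ, E) (fun s => γ (t + s)) (t - t)
      (velocityMap (E := E) (leftField (E := E) G v (γ t * γ 0))) := by rwa [sub_self]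
  have h7 := HasMFDerivAt.comp (f := fun s => s - t) t h6 h5
  have e : (fun s => γ (t + s)) ∘ (fun s => s - t) = γ := by
    ext s
    simp
  rw [e] at h7
  exact HasMFDerivAt.congr_velocity h7 (by rw [h.map_zero, mul_one]; rfl)

theorem IsOneParameter.unique [CompleteSpace E] [T2Space G] {γ γ' : ℝ → G} {v : E}
    (h : IsOneParameter γ v) (h' : IsOneParameter γ' v) : γ = γ' :=
  IsMIntegralCurve.eq_of_leftField h.isMIntegralCurve h'.isMIntegralCurve
    (by rw [h.map_zero, h'.map_zero])

end OneParameter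

/-! ### The group law in the preferred chart at the identity -/

section Coordinates

set_option linter.unusedSectionVars false

open Set VectorField Filter

variable {E : Type*} [NormedAddCommGroup E] [NormedSpace ℝ E]
  {G : Type*} [TopologicalSpace G] [ChartedSpace E G] [Group G]

variable (E G) in
/-- The coordinates of the identity. -/
noncomputable def oneCoord : E := extChartAt 𝓘(ℝ, E) (1 : G) 1

variable (E G) in
/-- The multiplication in the preferred chart at the identity. -/
noncomputable def mulCoord (p : E × E) : E :=
  extChartAt 𝓘(ℝ, E) (1 : G)
    ((extChartAt 𝓘(ℝ, E) (1 : G)).symm p.1 * (extChartAt 𝓘(ℝ, E) (1 : G)).symm p.2)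

variable (E G) in
/-- The conjugation `(a, b) ↦ a b a⁻¹` in the preferred chart at the identity. -/
noncomputable def conjCoord (p : E × E) : E :=
  extChartAt 𝓘(ℝ, E) (1 : G)
    ((extChartAt 𝓘(ℝ, E) (1 : G)).symm p.1 * (extChartAt 𝓘(ℝ, E) (1 : G)).symm p.2 *
      ((extChartAt 𝓘(ℝ, E) (1 : G)).symm p.1)⁻¹)

variable (E) in
/-- The adjoint action of `g`, in the preferred chart at the identity. -/
noncomputable def adjoint (g : G) : E →L[ℝ] E :=
  fderiv ℝ (fun b => extChartAt 𝓘(ℝ, E) (1 : G)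
    (g * (extChartAt 𝓘(ℝ, E) (1 : G)).symm b * g⁻¹)) (oneCoord E G)

theorem symm_oneCoord : (extChartAt 𝓘(ℝ, E) (1 : G)).symm (oneCoord E G) = 1 :=
  extChartAt_to_inv (1 : G)

theorem extChartAt_one_target_mem_nhds :
    (extChartAt 𝓘(ℝ, E) (1 : G)).target ∈ 𝓝 (oneCoord E G) :=
  extChartAt_target_mem_nhds (1 : G)

theorem mulCoord_right {a : E} (ha : a ∈ (extChartAt 𝓘(ℝ, E) (1 : G)).target) :
    mulCoord E G (a, oneCoord E G) = a := by
  simp only [mulCoord, symm_oneCoord, mul_one]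
  exact (extChartAt 𝓘(ℝ, E) (1 : G)).right_inv ha

theorem mulCoord_left {a : E} (ha : a ∈ (extChartAt 𝓘(ℝ, E) (1 : G)).target) :
    mulCoord E G (oneCoord E G, a) = a := by
  simp only [mulCoord, symm_oneCoord, one_mul]
  exact (extChartAt 𝓘(ℝ, E) (1 : G)).right_inv ha

variable [LieGroup 𝓘(ℝ, E) ∞ G]

variable (E G) in
theorem contMDiffAt_extChartAt_one_symm :
    ContMDiffAt 𝓘(ℝ, E) 𝓘(ℝ, E) ∞ (extChartAt 𝓘(ℝ, E) (1 : G)).symm (oneCoord E G) := by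
  have : IsManifold 𝓘(ℝ, E) ∞ G := inferInstance
  exact (contMDiffOn_extChartAt_symm (1 : G)).contMDiffAt extChartAt_one_target_mem_nhds

theorem contDiffAt_extChartAt_one_comp {V : Type*} [NormedAddCommGroup V] [NormedSpace ℝ V]
    {f : V → G} {x : V} (hf : ContMDiffAt 𝓘(ℝ, V) 𝓘(ℝ, E) ∞ f x) (hx : f x = 1) :
    ContDiffAt ℝ ∞ (fun y => extChartAt 𝓘(ℝ, E) (1 : G) (f y)) x := by
  have : IsManifold 𝓘(ℝ, E) ∞ G := inferInstance
  rw [← contMDiffAt_iff_contDiffAt]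
  have h : ContMDiffAt 𝓘(ℝ, E) 𝓘(ℝ, E) ∞ (extChartAt 𝓘(ℝ, E) (1 : G)) (f x) := by
    rw [hx]; exact contMDiffAt_extChartAt
  exact h.comp x hf

theorem contMDiffAt_symm_comp {V : Type*} [NormedAddCommGroup V] [NormedSpace ℝ V]
    {f : V → E} {x : V} (hf : ContDiffAt ℝ ∞ f x) (hx : f x = oneCoord E G) :
    ContMDiffAt 𝓘(ℝ, V) 𝓘(ℝ, E) ∞ (fun y => (extChartAt 𝓘(ℝ, E) (1 : G)).symm (f y)) x := by
  have h := contMDiffAt_extChartAt_one_symm E G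
  rw [← hx] at h
  exact h.comp x hf.contMDiffAt

variable (E G) in
theorem contDiffAt_mulCoord : ContDiffAt ℝ ∞ (mulCoord E G) (oneCoord E G, oneCoord E G) :=
  contDiffAt_extChartAt_one_comp
    ((contMDiffAt_symm_comp contDiffAt_fst rfl).mul (contMDiffAt_symm_comp contDiffAt_snd rfl))
    (by simp only [symm_oneCoord, mul_one])

variable (E G) in
theorem contDiffAt_conjCoord : ContDiffAt ℝ ∞ (conjCoord E G) (oneCoord E G, oneCoord E G) :=
  contDiffAt_extChartAt_one_comp
    (((contMDiffAt_symm_comp contDiffAt_fst rfl).mul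
      (contMDiffAt_symm_comp contDiffAt_snd rfl)).mul
      (contMDiffAt_symm_comp contDiffAt_fst rfl).inv)
    (by simp only [symm_oneCoord, mul_one, inv_one])

theorem contDiffAt_conj (g : G) : ContDiffAt ℝ ∞ (fun b => extChartAt 𝓘(ℝ, E) (1 : G)
    (g * (extChartAt 𝓘(ℝ, E) (1 : G)).symm b * g⁻¹)) (oneCoord E G) :=
  contDiffAt_extChartAt_one_comp
    ((contMDiffAt_const.mul (contMDiffAt_symm_comp contDiffAt_id rfl)).mul contMDiffAt_const)
    (by simp only [symm_oneCoord, mul_one, mul_inv_cancel])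

theorem hasFDerivAt_conj (g : G) : HasFDerivAt (fun b => extChartAt 𝓘(ℝ, E) (1 : G)
    (g * (extChartAt 𝓘(ℝ, E) (1 : G)).symm b * g⁻¹)) (adjoint E g) (oneCoord E G) :=
  ((contDiffAt_conj g).differentiableAt (by simp)).hasFDerivAt

/-- On each of the two axes through the identity the multiplication is the identity map, and a
linear map on a product is the sum of its restrictions to the factors. -/
theorem fderiv_mulCoord_one (v w : E) :
    fderiv ℝ (mulCoord E G) (oneCoord E G, oneCoord E G) (v, w) = v + w := by
  set e := oneCoord E G
  have hd : HasFDerivAt (mulCoord E G) (fderiv ℝ (mulCoord E G) (e, e)) (e, e) :=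
    ((contDiffAt_mulCoord E G).differentiableAt (by simp)).hasFDerivAt
  have h1 : HasFDerivAt (fun a => mulCoord E G (a, e)) _ e :=
    HasFDerivAt.comp (g := mulCoord E G) e hd (hasFDerivAt_prodMk_left e e)
  have h2 : HasFDerivAt (fun a => mulCoord E G (e, a)) _ e :=
    HasFDerivAt.comp (g := mulCoord E G) e hd (hasFDerivAt_prodMk_right e e)
  have h1' := h1.congr_of_eventuallyEq (f₁ := id)
    (by filter_upwards [extChartAt_one_target_mem_nhds (G := G)] with a ha
        exact (mulCoord_right ha).symm)
  have h2' := h2.congr_of_eventuallyEq (f₁ := id)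
    (by filter_upwards [extChartAt_one_target_mem_nhds (G := G)] with a ha
        exact (mulCoord_left ha).symm)
  have e1 := congrArg (fun L : E →L[ℝ] E => L v) (h1'.unique (hasFDerivAt_id e))
  have e2 := congrArg (fun L : E →L[ℝ] E => L w) (h2'.unique (hasFDerivAt_id e))
  simp at e1 e2
  have : (v, w) = (v, (0 : E)) + ((0 : E), w) := by simp
  rw [this, map_add, e1, e2]

/-! ### Operations on one-parameter subgroups -/

theorem IsOneParameter.extChartAt_zero {γ : ℝ → G} {v : E} (h : IsOneParameter γ v) :
    extChartAt 𝓘(ℝ, E) (1 : G) (γ 0) = oneCoord E G := by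
  rw [h.map_zero]; rfl

theorem IsOneParameter.eventually_mem_source {γ : ℝ → G} {v : E} (h : IsOneParameter γ v) :
    ∀ᶠ t in 𝓝 0, γ t ∈ (extChartAt 𝓘(ℝ, E) (1 : G)).source := by
  have := h.cont.continuousAt (x := 0)
  refine this.eventually ?_
  rw [h.map_zero]
  exact extChartAt_source_mem_nhds (1 : G)

theorem IsOneParameter.conj {γ : ℝ → G} {v : E} (h : IsOneParameter γ v) (g : G) :
    IsOneParameter (fun t => g * γ t * g⁻¹) (adjoint E g v) where
  map_add s t := by simp [h.map_add, mul_assoc]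
  cont := by
    have : IsTopologicalGroup G := topologicalGroup_of_lieGroup 𝓘(ℝ, E) ∞
    exact (continuous_const.mul h.cont).mul continuous_const
  deriv := by
    have h1 := hasFDerivAt_conj (E := E) g
    rw [← h.extChartAt_zero] at h1
    refine (h1.comp_hasDerivAt (0 : ℝ) h.deriv).congr_of_eventuallyEq ?_
    filter_upwards [h.eventually_mem_source] with t ht
    simp only [Function.comp_apply]
    rw [(extChartAt 𝓘(ℝ, E) (1 : G)).left_inv ht]

theorem IsOneParameter.mul {γ γ' : ℝ → G} {v v' : E} (h : IsOneParameter γ v)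
    (h' : IsOneParameter γ' v') (hc : ∀ s t, Commute (γ s) (γ' t)) :
    IsOneParameter (fun t => γ t * γ' t) (v + v') where
  map_add s t := by
    rw [h.map_add, h'.map_add, mul_assoc, mul_assoc, ← mul_assoc (γ t), (hc t s).eq,
      mul_assoc]
  cont := by
    have : IsTopologicalGroup G := topologicalGroup_of_lieGroup 𝓘(ℝ, E) ∞
    exact h.cont.mul h'.cont
  deriv := by
    have h1 : HasFDerivAt (mulCoord E G) _ (oneCoord E G, oneCoord E G) :=
      ((contDiffAt_mulCoord E G).differentiableAt (by simp)).hasFDerivAt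
    have h2 := h.deriv.prodMk h'.deriv
    have h3 : (extChartAt 𝓘(ℝ, E) (1 : G) (γ 0), extChartAt 𝓘(ℝ, E) (1 : G) (γ' 0)) =
      (oneCoord E G, oneCoord E G) := by rw [h.extChartAt_zero, h'.extChartAt_zero]
    rw [← h3] at h1
    have h4 := h1.comp_hasDerivAt (0 : ℝ) h2
    rw [h3, fderiv_mulCoord_one] at h4
    refine h4.congr_of_eventuallyEq ?_
    filter_upwards [h.eventually_mem_source, h'.eventually_mem_source] with t ht ht'
    simp only [Function.comp_apply, mulCoord]
    rw [(extChartAt 𝓘(ℝ, E) (1 : G)).left_inv ht, (extChartAt 𝓘(ℝ, E) (1 : G)).left_inv ht']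

theorem eventually_differentiableAt_mulCoord :
    ∀ᶠ a in 𝓝 (oneCoord E G), DifferentiableAt ℝ (mulCoord E G) (a, oneCoord E G) := by
  have h : ∀ᶠ p in 𝓝 (oneCoord E G, oneCoord E G), ContDiffAt ℝ 1 (mulCoord E G) p :=
    ((contDiffAt_mulCoord E G).of_le (by simp)).eventually (by simp)
  have hc : ContinuousAt (fun a : E => (a, oneCoord E G)) (oneCoord E G) := by fun_prop
  exact (hc.eventually h).mono fun a ha => ha.differentiableAt (by simp)

theorem IsOneParameter.hasDerivAt_const_mul {γ : ℝ → G} {v : E} (h : IsOneParameter γ v) {a : E}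
    (ha : DifferentiableAt ℝ (mulCoord E G) (a, oneCoord E G)) :
    HasDerivAt (fun t => extChartAt 𝓘(ℝ, E) (1 : G)
      ((extChartAt 𝓘(ℝ, E) (1 : G)).symm a * γ t))
      (fderiv ℝ (mulCoord E G) (a, oneCoord E G) (0, v)) 0 := by
  have h1 := ha.hasFDerivAt
  have h2 := (hasDerivAt_const (0 : ℝ) a).prodMk h.deriv
  have h3 : (a, extChartAt 𝓘(ℝ, E) (1 : G) (γ 0)) = (a, oneCoord E G) := by
    rw [h.extChartAt_zero]
  rw [← h3] at h1
  have h4 := h1.comp_hasDerivAt (0 : ℝ) h2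
  rw [h3] at h4
  refine h4.congr_of_eventuallyEq ?_
  filter_upwards [h.eventually_mem_source] with t ht
  simp only [Function.comp_apply, mulCoord]
  rw [(extChartAt 𝓘(ℝ, E) (1 : G)).left_inv ht]

/-- In the chart a one-parameter subgroup solves an autonomous differential equation whose
right-hand side is as smooth as the multiplication. This is the input for the smoothness of `γ`. -/
theorem IsOneParameter.eventually_hasDerivAt {γ : ℝ → G} {v : E} (h : IsOneParameter γ v) :
    ∀ᶠ t in 𝓝 (0 : ℝ), HasDerivAt (fun t => extChartAt 𝓘(ℝ, E) (1 : G) (γ t))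
      (fderiv ℝ (mulCoord E G) (extChartAt 𝓘(ℝ, E) (1 : G) (γ t), oneCoord E G) (0, v)) t := by
  have hc : Tendsto (fun t => extChartAt 𝓘(ℝ, E) (1 : G) (γ t)) (𝓝 0) (𝓝 (oneCoord E G)) := by
    rw [← h.extChartAt_zero]
    exact h.deriv.continuousAt
  filter_upwards [h.eventually_mem_source,
    hc.eventually (eventually_differentiableAt_mulCoord (G := G))] with t ht hd
  have h1 := h.hasDerivAt_const_mul hd
  simp only [(extChartAt 𝓘(ℝ, E) (1 : G)).left_inv ht, ← h.map_add] at h1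
  have h2 : HasDerivAt (fun s : ℝ => s - t) 1 t := (hasDerivAt_id t).sub_const t
  rw [show (0 : ℝ) = t - t by simp] at h1
  have h3 := HasDerivAt.scomp (h := fun s => s - t) t h1 h2
  simpa [Function.comp_def] using! h3

theorem IsOneParameter.contDiffAt {γ : ℝ → G} {v : E} (h : IsOneParameter γ v) :
    ContDiffAt ℝ ∞ (fun t => extChartAt 𝓘(ℝ, E) (1 : G) (γ t)) 0 := by
  set f := fun t => extChartAt 𝓘(ℝ, E) (1 : G) (γ t) with hf
  set X : E → E := fun a => fderiv ℝ (mulCoord E G) (a, oneCoord E G) (0, v) with hX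
  have hc : Tendsto f (𝓝 0) (𝓝 (oneCoord E G)) := by
    rw [← h.extChartAt_zero]
    exact h.deriv.continuousAt
  have hXs : ContDiffAt ℝ ∞ X (oneCoord E G) := by
    have h1 : ContDiffAt ℝ ∞ (fderiv ℝ (mulCoord E G)) (oneCoord E G, oneCoord E G) :=
      (contDiffAt_mulCoord E G).fderiv_right (by simp)
    have h2 : ContDiffAt ℝ ∞ (fun a : E => (a, oneCoord E G)) (oneCoord E G) := by fun_prop
    exact (ContDiffAt.comp (f := fun a : E => (a, oneCoord E G)) (oneCoord E G) h1 h2).clm_apply contDiffAt_const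
  -- Bootstrapping: if `f` is `C^n` then so is `f' = X ∘ f`, hence `f` is `C^(n+1)`. The induction
  -- needs the claim on a neighbourhood, not only at `0`.
  have key : ∀ n : ℕ, ∀ᶠ t in 𝓝 (0 : ℝ), ContDiffAt ℝ n f t := by
    intro n
    induction n with
    | zero =>
      filter_upwards [eventually_eventually_nhds.2 h.eventually_hasDerivAt] with t ht
      simp only [Nat.cast_zero, contDiffAt_zero]
      refine ⟨_, ht, fun s hs => ?_⟩
      have hs : HasDerivAt f _ s := hs
      exact hs.continuousAt.continuousWithinAt
    | succ n ih =>
      have hXn : ∀ᶠ a in 𝓝 (oneCoord E G), ContDiffAt ℝ n X a :=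
        (hXs.of_le (by exact_mod_cast le_top)).eventually (by simp)
      filter_upwards [eventually_eventually_nhds.2 h.eventually_hasDerivAt, ih,
        hc.eventually hXn] with t h1 h2 h3
      rw [Nat.cast_add, Nat.cast_one, contDiffAt_succ_iff_hasFDerivAt]
      refine ⟨fun s => ContinuousLinearMap.toSpanSingleton ℝ (X (f s)), ⟨_, h1, fun s hs => ?_⟩, ?_⟩
      · have hs : HasDerivAt f _ s := hs
        exact hs.hasFDerivAt
      · exact (ContinuousLinearMap.toSpanSingletonCLE (𝕜 := ℝ) (E := E)).contDiff.contDiffAt.comp t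
          (h3.comp t h2)
  rw [contDiffAt_infty]
  exact fun n => (key n).self_of_nhds

theorem IsOneParameter.contMDiff {γ : ℝ → G} {v : E} (h : IsOneParameter γ v) :
    ContMDiff 𝓘(ℝ, ℝ) 𝓘(ℝ, E) ∞ γ := by
  have h0 : ContMDiffAt 𝓘(ℝ, ℝ) 𝓘(ℝ, E) ∞ γ 0 := by
    refine (contMDiffAt_symm_comp (G := G) h.contDiffAt h.extChartAt_zero).congr_of_eventuallyEq ?_
    filter_upwards [h.eventually_mem_source] with t ht
    rw [(extChartAt 𝓘(ℝ, E) (1 : G)).left_inv ht]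
  intro t
  have h1 : ContMDiffAt 𝓘(ℝ, ℝ) 𝓘(ℝ, ℝ) ∞ (fun s : ℝ => s - t) t :=
    (contDiff_id.sub contDiff_const).contMDiff.contMDiffAt
  have h0' : ContMDiffAt 𝓘(ℝ, ℝ) 𝓘(ℝ, E) ∞ γ (t - t) := by rwa [sub_self]
  have h2 : ContMDiffAt 𝓘(ℝ, ℝ) 𝓘(ℝ, E) ∞ (fun s => γ t * γ (s - t)) t :=
    contMDiffAt_const.mul (ContMDiffAt.comp (f := fun s => s - t) t h0' h1)
  convert h2 using 1
  ext s
  rw [← h.map_add]; simp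

end Coordinates

/-! ### The adjoint action and the Lie bracket -/

section Bracket

set_option linter.unusedSectionVars false

open Set VectorField Filter

variable {E : Type*} [NormedAddCommGroup E] [NormedSpace ℝ E]
  {G : Type*} [TopologicalSpace G] [ChartedSpace E G] [Group G] [LieGroup 𝓘(ℝ, E) ∞ G]

theorem IsOneParameter.velocity_unique {γ : ℝ → G} {v w : E} (h : IsOneParameter γ v)
    (h' : IsOneParameter γ w) : v = w :=
  h.deriv.unique h'.deriv

theorem adjoint_mul [CompleteSpace E] [T2Space G] (g h : G) (v : E) :
    adjoint E (g * h) v = adjoint E g (adjoint E h v) := by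
  obtain ⟨γ, hγ⟩ := exists_isOneParameter (G := G) v
  have h1 := hγ.conj (g * h)
  have h2 := (hγ.conj h).conj g
  refine h1.velocity_unique ?_
  convert h2 using 2
  simp [mul_assoc]

variable (E G) in
/-- The mixed second derivative of the multiplication at the identity. -/
noncomputable def mulHess (v w : E) : E :=
  fderiv ℝ (fderiv ℝ (mulCoord E G)) (oneCoord E G, oneCoord E G) (v, 0) (0, w)

variable (E G) in
theorem hasFDerivAt_fderiv_mulCoord :
    HasFDerivAt (fderiv ℝ (mulCoord E G))
      (fderiv ℝ (fderiv ℝ (mulCoord E G)) (oneCoord E G, oneCoord E G))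
      (oneCoord E G, oneCoord E G) := by
  have h1 : ContDiffAt ℝ ∞ (fderiv ℝ (mulCoord E G)) (oneCoord E G, oneCoord E G) :=
    (contDiffAt_mulCoord E G).fderiv_right (by simp)
  exact (h1.differentiableAt (by simp)).hasFDerivAt

theorem mulHess_swap (v w : E) :
    fderiv ℝ (fderiv ℝ (mulCoord E G)) (oneCoord E G, oneCoord E G) (0, v) (w, 0) =
      mulHess E G w v := by
  have h : IsSymmSndFDerivAt ℝ (mulCoord E G) (oneCoord E G, oneCoord E G) :=
    (contDiffAt_mulCoord E G).isSymmSndFDerivAt (by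
      rw [minSmoothness_of_isRCLikeNormedField]; exact ENat.LEInfty.out)
  exact h _ _

/-- Both sides are the velocity at `t = 0` of `g * γ t` in the chart, where `γ` has velocity `v`:
once through the derivative of the chart, once through the partial derivative of the multiplication.
-/
theorem mpullback_leftVectorField [CompleteSpace E] [T2Space G] (v : E) {a : E}
    (ha : a ∈ (extChartAt 𝓘(ℝ, E) (1 : G)).target)
    (hd : DifferentiableAt ℝ (mulCoord E G) (a, oneCoord E G)) :
    (mpullbackWithin 𝓘(ℝ, E) 𝓘(ℝ, E) (extChartAt 𝓘(ℝ, E) (1 : G)).symm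
      (leftVectorField G v) (range 𝓘(ℝ, E)) a : E) =
      fderiv ℝ (mulCoord E G) (a, oneCoord E G) (0, v) := by
  have : IsManifold 𝓘(ℝ, E) 1 G := IsManifold.of_le (n := ∞) (by simp)
  set g := (extChartAt 𝓘(ℝ, E) (1 : G)).symm a with hg
  obtain ⟨γ, hγ⟩ := exists_isOneParameter (G := G) v
  have h1 := ContinuousLinearMap.inverse_eq
    (mfderivWithin_extChartAt_symm_comp_mfderiv_extChartAt (I := 𝓘(ℝ, E)) ha)
    (mfderiv_extChartAt_comp_mfderivWithin_extChartAt_symm (I := 𝓘(ℝ, E)) ha)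
  set D : E →L[ℝ] E := mfderiv 𝓘(ℝ, E) 𝓘(ℝ, E) (extChartAt 𝓘(ℝ, E) (1 : G)) g with hD
  have h2 : (mpullbackWithin 𝓘(ℝ, E) 𝓘(ℝ, E) (extChartAt 𝓘(ℝ, E) (1 : G)).symm
      (leftVectorField G v) (range 𝓘(ℝ, E)) a : E) = D (leftField (E := E) G v g) := by
    rw [mpullbackWithin_apply, h1]
    rfl
  rw [h2]
  have hsrc : g ∈ (extChartAt 𝓘(ℝ, E) (1 : G)).source :=
    (extChartAt 𝓘(ℝ, E) (1 : G)).map_target ha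
  have h3 : HasMFDerivAt 𝓘(ℝ, E) 𝓘(ℝ, E) (extChartAt 𝓘(ℝ, E) (1 : G)) g D :=
    (mdifferentiableAt_extChartAt (by rwa [extChartAt_source] at hsrc)).hasMFDerivAt
  have h4 : HasMFDerivAt 𝓘(ℝ, ℝ) 𝓘(ℝ, E) (fun t => g * γ t) 0
      (velocityMap (E := E) (leftField (E := E) G v g)) := by
    refine (hasMFDerivWithinAt_univ.1
      ((hasMFDerivWithinAt_univ.2 (hγ.isMIntegralCurve 0)).const_mul_left g)).congr_velocity ?_
    rw [hγ.map_zero, mul_one]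
  have h3' : HasMFDerivAt 𝓘(ℝ, E) 𝓘(ℝ, E) (extChartAt 𝓘(ℝ, E) (1 : G)) (g * γ 0) D := by
    rwa [hγ.map_zero, mul_one]
  have h5 : HasFDerivAt (fun t => extChartAt 𝓘(ℝ, E) (1 : G) (g * γ t))
      (D ∘L velocityMap (E := E) (leftField (E := E) G v g)) 0 :=
    (HasMFDerivAt.comp (f := fun t => g * γ t) (0 : ℝ) h3' h4).hasFDerivAt
  have h6 := h5.hasDerivAt.unique (hγ.hasDerivAt_const_mul hd)
  rw [← h6]
  simp
  rfl

variable (G) in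
/-- The Lie bracket of the Lie algebra of `G`, as an operation on the model space. -/
noncomputable def groupBracket (v w : E) : E :=
  Bracket.bracket (L := GroupLieAlgebra 𝓘(ℝ, E) G) (M := GroupLieAlgebra 𝓘(ℝ, E) G) v w

variable (G) in
/-- The left-invariant vector field with value `v` at `1`, read in the preferred chart at `1`. -/
noncomputable def leftFieldCoord (v : E) : E → E :=
  mpullbackWithin 𝓘(ℝ, E) 𝓘(ℝ, E) (extChartAt 𝓘(ℝ, E) (1 : G)).symm
    (leftVectorField G v) (range 𝓘(ℝ, E))

theorem leftFieldCoord_eventuallyEq [CompleteSpace E] [T2Space G] (v : E) :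
    leftFieldCoord G v =ᶠ[𝓝 (oneCoord E G)]
      fun a => fderiv ℝ (mulCoord E G) (a, oneCoord E G) (0, v) := by
  filter_upwards [extChartAt_one_target_mem_nhds (G := G),
    eventually_differentiableAt_mulCoord (G := G)] with a h1 h2
  exact mpullback_leftVectorField v h1 h2

theorem bracket_eq_lieBracket (v w : E) :
    groupBracket (E := E) G v w =
      lieBracket ℝ (leftFieldCoord G v) (leftFieldCoord G w) (oneCoord E G) := by
  have : IsManifold 𝓘(ℝ, E) 1 G := IsManifold.of_le (n := ∞) (by simp)
  have h1 : (mfderiv 𝓘(ℝ, E) 𝓘(ℝ, E) (extChartAt 𝓘(ℝ, E) (1 : G)) 1 : E →L[ℝ] E) =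
    ContinuousLinearMap.id ℝ E := mfderiv_extChartAt_self
  have h2 : groupBracket (E := E) G v w =
      (mfderiv 𝓘(ℝ, E) 𝓘(ℝ, E) (extChartAt 𝓘(ℝ, E) (1 : G)) 1 : E →L[ℝ] E).inverse
      (lieBracketWithin (E := E) ℝ (leftFieldCoord (E := E) G v) (leftFieldCoord (E := E) G w)
        ((extChartAt 𝓘(ℝ, E) (1 : G)).symm ⁻¹' univ ∩ range 𝓘(ℝ, E)) (oneCoord E G)) := rfl
  have h3 : ((extChartAt 𝓘(ℝ, E) (1 : G)).symm ⁻¹' univ ∩ range 𝓘(ℝ, E)) = univ := by simp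
  have h4 : ∀ (L : E →L[ℝ] E), L = ContinuousLinearMap.id ℝ E → ∀ x, L.inverse x = x := by
    rintro L rfl x
    rw [ContinuousLinearMap.inverse_id, ContinuousLinearMap.id_apply]
  exact h2.trans ((h4 _ h1 _).trans (by rw [h3, lieBracketWithin_univ]))

/-- The bracket of the coordinate fields differentiates `a ↦ ∂₂m(a, e)`, so only the mixed second
derivative of the multiplication at the identity survives, antisymmetrized. -/
theorem bracket_eq [CompleteSpace E] [T2Space G] (v w : E) :
    groupBracket (E := E) G v w = mulHess E G v w - mulHess E G w v := by
  have hder : ∀ u : E, HasFDerivAt (fun a => fderiv ℝ (mulCoord E G) (a, oneCoord E G) (0, u))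
      ((ContinuousLinearMap.apply ℝ E ((0 : E), u)) ∘L
        (fderiv ℝ (fderiv ℝ (mulCoord E G)) (oneCoord E G, oneCoord E G) ∘L
          ContinuousLinearMap.inl ℝ E E)) (oneCoord E G) := fun u =>
    (ContinuousLinearMap.apply ℝ E ((0 : E), u)).hasFDerivAt.comp _
      (HasFDerivAt.comp (f := fun a => (a, oneCoord E G)) (oneCoord E G)
        (hasFDerivAt_fderiv_mulCoord E G)
        (hasFDerivAt_prodMk_left (oneCoord E G) (oneCoord E G)))
  rw [bracket_eq_lieBracket, (leftFieldCoord_eventuallyEq v).lieBracket_vectorField_eq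
    (leftFieldCoord_eventuallyEq w), lieBracket, (hder v).fderiv, (hder w).fderiv]
  simp [fderiv_mulCoord_one, mulHess]

theorem eventually_differentiableAt_conjCoord :
    ∀ᶠ a in 𝓝 (oneCoord E G), DifferentiableAt ℝ (conjCoord E G) (a, oneCoord E G) := by
  have h : ∀ᶠ p in 𝓝 (oneCoord E G, oneCoord E G), ContDiffAt ℝ 1 (conjCoord E G) p :=
    ((contDiffAt_conjCoord E G).of_le (by simp)).eventually (by simp)
  have hc : ContinuousAt (fun a : E => (a, oneCoord E G)) (oneCoord E G) := by fun_prop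
  exact (hc.eventually h).mono fun a ha => ha.differentiableAt (by simp)

theorem eventually_differentiableAt_mulCoord_right :
    ∀ᶠ a in 𝓝 (oneCoord E G), DifferentiableAt ℝ (mulCoord E G) (oneCoord E G, a) := by
  have h : ∀ᶠ p in 𝓝 (oneCoord E G, oneCoord E G), ContDiffAt ℝ 1 (mulCoord E G) p :=
    ((contDiffAt_mulCoord E G).of_le (by simp)).eventually (by simp)
  have hc : ContinuousAt (fun a : E => (oneCoord E G, a)) (oneCoord E G) := by fun_prop
  exact (hc.eventually h).mono fun a ha => ha.differentiableAt (by simp)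

theorem IsOneParameter.tendsto_extChartAt {γ : ℝ → G} {v : E} (h : IsOneParameter γ v) :
    Tendsto (fun t => extChartAt 𝓘(ℝ, E) (1 : G) (γ t)) (𝓝 0) (𝓝 (oneCoord E G)) := by
  rw [← h.extChartAt_zero]
  exact h.deriv.continuousAt

/-- Writes `Ad (γ t)` as a partial derivative of one smooth function of two variables, which gives
its differentiability in `t`. -/
theorem IsOneParameter.eventually_adjoint_eq {γ : ℝ → G} {v : E} (h : IsOneParameter γ v) (w : E) :
    ∀ᶠ t in 𝓝 (0 : ℝ), adjoint E (γ t) w = fderiv ℝ (conjCoord E G)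
      (extChartAt 𝓘(ℝ, E) (1 : G) (γ t), oneCoord E G) (0, w) := by
  filter_upwards [h.eventually_mem_source,
    h.tendsto_extChartAt.eventually eventually_differentiableAt_conjCoord] with t ht hd
  set a := extChartAt 𝓘(ℝ, E) (1 : G) (γ t) with ha
  have h1 := HasFDerivAt.comp (f := fun b => (a, b)) (oneCoord E G) hd.hasFDerivAt
    (hasFDerivAt_prodMk_right a (oneCoord E G))
  have h2 := hasFDerivAt_conj (E := E) (γ t)
  have e1 : (conjCoord E G ∘ fun b => (a, b)) = fun b => extChartAt 𝓘(ℝ, E) (1 : G)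
      (γ t * (extChartAt 𝓘(ℝ, E) (1 : G)).symm b * (γ t)⁻¹) := by
    ext b
    simp only [Function.comp_apply, conjCoord, ha, (extChartAt 𝓘(ℝ, E) (1 : G)).left_inv ht]
  rw [e1] at h1
  rw [h2.unique h1]
  simp

theorem IsOneParameter.adjoint_differentiableAt {γ : ℝ → G} {v : E} (h : IsOneParameter γ v)
    (w : E) : DifferentiableAt ℝ (fun t => adjoint E (γ t) w) 0 := by
  refine DifferentiableAt.congr_of_eventuallyEq ?_ (h.eventually_adjoint_eq w)
  have h1 : ContDiffAt ℝ ∞ (fderiv ℝ (conjCoord E G)) (oneCoord E G, oneCoord E G) :=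
    (contDiffAt_conjCoord E G).fderiv_right (by simp)
  have h2 : DifferentiableAt ℝ (fderiv ℝ (conjCoord E G))
      (extChartAt 𝓘(ℝ, E) (1 : G) (γ 0), oneCoord E G) := by
    rw [h.extChartAt_zero]
    exact h1.differentiableAt (by simp)
  have h3 : DifferentiableAt ℝ
      (fun t => (extChartAt 𝓘(ℝ, E) (1 : G) (γ t), oneCoord E G)) 0 :=
    h.deriv.differentiableAt.prodMk (differentiableAt_const _)
  exact (DifferentiableAt.comp (f := fun t => (extChartAt 𝓘(ℝ, E) (1 : G) (γ t), oneCoord E G))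
    (0 : ℝ) h2 h3).clm_apply (differentiableAt_const _)

/-- This is the identity `exp(s Ad(g) w) g = g exp(s w)` for `g = γ t`, differentiated in `s` at
`0`. It determines the derivative of `Ad` from the multiplication alone, without second derivatives
of the conjugation. -/
theorem IsOneParameter.eventually_fderiv_adjoint [CompleteSpace E] [T2Space G] {γ : ℝ → G} {v : E}
    (h : IsOneParameter γ v) (w : E) :
    ∀ᶠ t in 𝓝 (0 : ℝ), fderiv ℝ (mulCoord E G)
        (oneCoord E G, extChartAt 𝓘(ℝ, E) (1 : G) (γ t)) (adjoint E (γ t) w, 0) =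
      fderiv ℝ (mulCoord E G) (extChartAt 𝓘(ℝ, E) (1 : G) (γ t), oneCoord E G) (0, w) := by
  obtain ⟨δ, hδ⟩ := exists_isOneParameter (G := G) w
  filter_upwards [h.eventually_mem_source,
    h.tendsto_extChartAt.eventually eventually_differentiableAt_mulCoord_right,
    h.tendsto_extChartAt.eventually (eventually_differentiableAt_mulCoord (G := G))] with t ht h1 h2
  have h3 := hδ.hasDerivAt_const_mul h2
  simp only [(extChartAt 𝓘(ℝ, E) (1 : G)).left_inv ht] at h3
  have hconj := hδ.conj (γ t)
  have h4 := (hconj.deriv).prodMk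
    (hasDerivAt_const (0 : ℝ) (extChartAt 𝓘(ℝ, E) (1 : G) (γ t)))
  have h5 := h1.hasFDerivAt
  have h6 : (extChartAt 𝓘(ℝ, E) (1 : G) (γ t * δ 0 * (γ t)⁻¹),
      extChartAt 𝓘(ℝ, E) (1 : G) (γ t)) =
      (oneCoord E G, extChartAt 𝓘(ℝ, E) (1 : G) (γ t)) := by
    rw [hconj.extChartAt_zero]
  rw [← h6] at h5
  have h7 := h5.comp_hasDerivAt (0 : ℝ) h4
  rw [h6] at h7
  refine h7.unique (h3.congr_of_eventuallyEq ?_)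
  filter_upwards [hconj.eventually_mem_source] with s hs
  simp only [Function.comp_apply, mulCoord]
  rw [(extChartAt 𝓘(ℝ, E) (1 : G)).left_inv ht, (extChartAt 𝓘(ℝ, E) (1 : G)).left_inv hs]
  simp

/-- Implicit differentiation of `key` at `t = 0`, with `m` the multiplication and `F` the curve `Ad
(γ t) w`; the first partial derivative of `m` at `(e, e)` is the identity, so `F'` can be isolated.
-/
theorem deriv_eq_of_fderiv_apply_eq {m : E × E → E} {D : E × E →L[ℝ] E × E →L[ℝ] E} {e v w : E}
    (hm : HasFDerivAt (fderiv ℝ m) D (e, e)) (hm1 : ∀ x, fderiv ℝ m (e, e) (x, 0) = x)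
    {f F : ℝ → E} (hf : HasDerivAt f v 0) (hf0 : f 0 = e) (hF : DifferentiableAt ℝ F 0)
    (hF0 : F 0 = w)
    (key : ∀ᶠ t in 𝓝 (0 : ℝ), fderiv ℝ m (e, f t) (F t, 0) = fderiv ℝ m (f t, e) (0, w)) :
    deriv F 0 = D (v, 0) (0, w) - D (0, v) (w, 0) := by
  subst hf0 hF0
  have hL := (HasFDerivAt.comp_hasDerivAt (f := fun t => (f 0, f t)) (0 : ℝ) hm
    ((hasDerivAt_const (0 : ℝ) (f 0)).prodMk hf)).clm_apply
    (hF.hasDerivAt.prodMk (hasDerivAt_const (0 : ℝ) (0 : E)))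
  have hR := (HasFDerivAt.comp_hasDerivAt (f := fun t => (f t, f 0)) (0 : ℝ) hm
    (hf.prodMk (hasDerivAt_const (0 : ℝ) (f 0)))).clm_apply
    (hasDerivAt_const (0 : ℝ) ((0 : E), F 0))
  have hEq := hL.unique (hR.congr_of_eventuallyEq key)
  simp only [Function.comp_apply, hm1] at hEq
  rw [eq_sub_iff_add_eq, add_comm, hEq]
  simp

theorem IsOneParameter.adjoint_hasDerivAt_zero [CompleteSpace E] [T2Space G] {γ : ℝ → G} {v : E}
    (h : IsOneParameter γ v) (w : E) :
    HasDerivAt (fun t => adjoint E (γ t) w) (mulHess E G v w - mulHess E G w v) 0 := by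
  obtain ⟨δ, hδ⟩ := exists_isOneParameter (G := G) w
  have hF0 : adjoint E (γ 0) w = w := by
    refine (hδ.conj (γ 0)).velocity_unique ?_
    simpa [h.map_zero] using hδ
  have hd := h.adjoint_differentiableAt w
  have := deriv_eq_of_fderiv_apply_eq (hasFDerivAt_fderiv_mulCoord E G)
    (fun x => by rw [fderiv_mulCoord_one, add_zero]) h.deriv h.extChartAt_zero hd hF0
    (h.eventually_fderiv_adjoint w)
  rw [mulHess_swap] at this
  unfold mulHess at this ⊢
  rw [← this]
  exact hd.hasDerivAt

end Bracket

/-! ### The exponential map and commutation relations -/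

section Exponential

set_option linter.unusedSectionVars false

open Set Filter

variable {E : Type*} [NormedAddCommGroup E] [NormedSpace ℝ E]
  {G : Type*} [TopologicalSpace G] [ChartedSpace E G] [Group G] [LieGroup 𝓘(ℝ, E) ∞ G]
  [CompleteSpace E] [T2Space G]

theorem groupBracket_eq_hess (v w : E) :
    groupBracket (E := E) G v w = mulHess E G v w - mulHess E G w v := bracket_eq v w

/-- `Ad (γ s) = Ad (γ t) ∘ Ad (γ (s - t))` transports the derivative from `0` to `t`. -/
theorem IsOneParameter.adjoint_hasDerivAt {γ : ℝ → G} {v : E} (h : IsOneParameter γ v) (w : E)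
    (t : ℝ) : HasDerivAt (fun s => adjoint E (γ s) w)
      (adjoint E (γ t) (groupBracket (E := E) G v w)) t := by
  have h1 := h.adjoint_hasDerivAt_zero w
  rw [← groupBracket_eq_hess, show (0 : ℝ) = t - t by simp] at h1
  have h2 : HasDerivAt (fun s : ℝ => s - t) 1 t := (hasDerivAt_id t).sub_const t
  have h3 := HasDerivAt.scomp (h := fun s => s - t) t h1 h2
  have h4 := (adjoint E (γ t)).hasFDerivAt.comp_hasDerivAt t h3
  rw [one_smul] at h4
  refine h4.congr_of_eventuallyEq (Eventually.of_forall fun s => ?_)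
  simp only [Function.comp_apply]
  rw [← adjoint_mul, ← h.map_add, add_sub_cancel]

theorem IsOneParameter.adjoint_zero {γ : ℝ → G} {v : E} (h : IsOneParameter γ v) (w : E) :
    adjoint E (γ 0) w = w := by
  obtain ⟨δ, hδ⟩ := exists_isOneParameter (G := G) w
  refine (hδ.conj (γ 0)).velocity_unique ?_
  simpa [h.map_zero] using hδ

theorem IsOneParameter.adjoint_eq_self {γ : ℝ → G} {v w : E} (h : IsOneParameter γ v)
    (h0 : groupBracket (E := E) G v w = 0) (t : ℝ) : adjoint E (γ t) w = w := by
  have hd := h.adjoint_hasDerivAt w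
  rw [h0] at hd
  have h1 := is_const_of_deriv_eq_zero (fun t => (hd t).differentiableAt)
    (fun t => (hd t).deriv.trans (_root_.map_zero _)) t 0
  rwa [h.adjoint_zero w] at h1

/-- The series `exp(t ad v) w` stops after the linear term. Here it appears as the constancy of `Ad
(γ s) w - s z`. -/
theorem IsOneParameter.adjoint_eq_add {γ : ℝ → G} {v w z : E} (h : IsOneParameter γ v)
    (hz : groupBracket (E := E) G v w = z) (h0 : groupBracket (E := E) G v z = 0) (t : ℝ) :
    adjoint E (γ t) w = w + t • z := by
  have hd : ∀ t, HasDerivAt (fun s => adjoint E (γ s) w - s • z) 0 t := by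
    intro t
    have h1 := h.adjoint_hasDerivAt w t
    rw [hz, h.adjoint_eq_self h0] at h1
    have h2 := h1.sub ((hasDerivAt_id t).smul_const z)
    rw [one_smul, sub_self] at h2
    exact h2
  have := is_const_of_deriv_eq_zero (fun t => (hd t).differentiableAt) (fun t => (hd t).deriv) t 0
  simp only [h.adjoint_zero, zero_smul, sub_zero] at this
  exact sub_eq_iff_eq_add.1 this

variable (G) in
/-- The exponential map of `G`, on the model space. -/
noncomputable def lieExp (v : E) : G := (exists_isOneParameter (G := G) v).choose 1

theorem IsOneParameter.eq_lieExp {γ : ℝ → G} {v : E} (h : IsOneParameter γ v) (t : ℝ) :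
    γ t = lieExp G (t • v) := by
  have h1 := (exists_isOneParameter (G := G) (t • v)).choose_spec
  have h2 := congrFun ((h.scale t).unique h1) 1
  rw [mul_one] at h2
  exact h2

theorem isOneParameter_lieExp (v : E) : IsOneParameter (fun t : ℝ => lieExp G (t • v)) v := by
  obtain ⟨γ, hγ⟩ := exists_isOneParameter (G := G) v
  simpa only [← hγ.eq_lieExp] using hγ

theorem lieExp_zero : lieExp G (0 : E) = 1 := by
  simpa using (isOneParameter_lieExp (G := G) (0 : E)).map_zero

theorem lieExp_add_smul (s t : ℝ) (v : E) :
    lieExp G ((s + t) • v) = lieExp G (s • v) * lieExp G (t • v) :=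
  (isOneParameter_lieExp v).map_add s t

/-- Conjugating `t ↦ exp(tw)` by `exp v` gives the one-parameter subgroup with velocity `Ad(exp v) w
= w`, that is, the same subgroup. -/
theorem commute_lieExp {v w : E} (h : groupBracket (E := E) G v w = 0) :
    Commute (lieExp G v) (lieExp G w) := by
  have h1 := (isOneParameter_lieExp (G := G) w).conj (lieExp G v)
  have h2 := (isOneParameter_lieExp (G := G) v).adjoint_eq_self h 1
  simp only [one_smul] at h2
  rw [h2] at h1
  have h3 := h1.eq_lieExp 1
  simp only [one_smul] at h3
  exact mul_inv_eq_iff_eq_mul.1 h3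

theorem groupBracket_smul_left (c : ℝ) (v w : E) :
    groupBracket (E := E) G (c • v) w = c • groupBracket (E := E) G v w := by
  simp only [groupBracket_eq_hess, mulHess]
  have e1 : ((c • v, 0) : E × E) = c • (v, (0 : E)) := by simp
  have e2 : ((0, c • v) : E × E) = c • ((0 : E), v) := by simp
  rw [e1, e2, map_smul, map_smul, smul_sub]
  rfl

theorem groupBracket_swap (v w : E) :
    groupBracket (E := E) G v w = - groupBracket (E := E) G w v := by
  simp [groupBracket_eq_hess]

theorem groupBracket_smul_right (c : ℝ) (v w : E) :
    groupBracket (E := E) G v (c • w) = c • groupBracket (E := E) G v w := by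
  rw [groupBracket_swap, groupBracket_smul_left, groupBracket_swap, smul_neg, neg_neg]

theorem lieExp_add {v w : E} (h : groupBracket (E := E) G v w = 0) :
    lieExp G (v + w) = lieExp G v * lieExp G w := by
  have h1 := (isOneParameter_lieExp (G := G) v).mul (isOneParameter_lieExp (G := G) w)
    (fun s t => commute_lieExp (by
      rw [groupBracket_smul_left, groupBracket_smul_right, h, smul_zero, smul_zero]))
  have h2 := h1.eq_lieExp 1
  simpa using h2.symm

/-- `exp v exp w exp(-v) = exp(Ad(exp v) w) = exp(w + z) = exp w exp z`: the defining relation of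
the Heisenberg group. -/
theorem lieExp_mul_lieExp {v w z : E} (h : groupBracket (E := E) G v w = z)
    (hv : groupBracket (E := E) G v z = 0) (hw : groupBracket (E := E) G w z = 0) :
    lieExp G v * lieExp G w = lieExp G z * lieExp G w * lieExp G v := by
  have h1 := (isOneParameter_lieExp (G := G) w).conj (lieExp G v)
  have h2 := (isOneParameter_lieExp (G := G) v).adjoint_eq_add h hv 1
  simp only [one_smul] at h2
  rw [h2] at h1
  have h3 := h1.eq_lieExp 1
  simp only [one_smul] at h3
  rw [lieExp_add hw, (commute_lieExp hw).eq] at h3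
  exact mul_inv_eq_iff_eq_mul.1 h3

theorem contMDiff_lieExp_smul (v : E) :
    ContMDiff 𝓘(ℝ, ℝ) 𝓘(ℝ, E) ∞ (fun t : ℝ => lieExp G (t • v)) :=
  (isOneParameter_lieExp v).contMDiff

end Exponential

/-! ### The Heisenberg group as a Lie group -/

namespace Heisenberg

theorem contMDiff_coords : ContMDiff 𝓘(ℝ, ℝ × ℝ × ℝ) 𝓘(ℝ, ℝ × ℝ × ℝ) ∞ (coords : Heisenberg → _) := by
  have : IsManifold 𝓘(ℝ, ℝ × ℝ × ℝ) ∞ Heisenberg :=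
    coordsHomeomorph.toOpenPartialHomeomorph.isManifold_singleton rfl
  have h := contMDiffOn_chart (I := 𝓘(ℝ, ℝ × ℝ × ℝ)) (n := ∞) (x := (1 : Heisenberg))
  exact contMDiffOn_univ.1 h

theorem contMDiff_coords_symm :
    ContMDiff 𝓘(ℝ, ℝ × ℝ × ℝ) 𝓘(ℝ, ℝ × ℝ × ℝ) ∞ (coords.symm : _ → Heisenberg) := by
  have : IsManifold 𝓘(ℝ, ℝ × ℝ × ℝ) ∞ Heisenberg :=
    coordsHomeomorph.toOpenPartialHomeomorph.isManifold_singleton rfl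
  have h := contMDiffOn_chart_symm (I := 𝓘(ℝ, ℝ × ℝ × ℝ)) (n := ∞) (x := (1 : Heisenberg))
  exact contMDiffOn_univ.1 h

theorem contMDiff_x : ContMDiff 𝓘(ℝ, ℝ × ℝ × ℝ) 𝓘(ℝ, ℝ) ∞ Heisenberg.x :=
  contDiff_fst.contMDiff.comp contMDiff_coords

theorem contMDiff_y : ContMDiff 𝓘(ℝ, ℝ × ℝ × ℝ) 𝓘(ℝ, ℝ) ∞ Heisenberg.y :=
  (contDiff_fst.comp contDiff_snd).contMDiff.comp contMDiff_coords

theorem contMDiff_z : ContMDiff 𝓘(ℝ, ℝ × ℝ × ℝ) 𝓘(ℝ, ℝ) ∞ Heisenberg.z :=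
  (contDiff_snd.comp contDiff_snd).contMDiff.comp contMDiff_coords

theorem contMDiff_mk {V H M : Type*} [NormedAddCommGroup V] [NormedSpace ℝ V] [TopologicalSpace H]
    {I : ModelWithCorners ℝ V H} [TopologicalSpace M] [ChartedSpace H M] {x y z : M → ℝ}
    (hx : ContMDiff I 𝓘(ℝ, ℝ) ∞ x) (hy : ContMDiff I 𝓘(ℝ, ℝ) ∞ y)
    (hz : ContMDiff I 𝓘(ℝ, ℝ) ∞ z) :
    ContMDiff I 𝓘(ℝ, ℝ × ℝ × ℝ) ∞ (fun m => (⟨x m, y m, z m⟩ : Heisenberg)) :=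
  contMDiff_coords_symm.comp (hx.prodMk_space (hy.prodMk_space hz))

theorem continuous_x : Continuous Heisenberg.x := contMDiff_x.continuous
theorem continuous_y : Continuous Heisenberg.y := contMDiff_y.continuous
theorem continuous_z : Continuous Heisenberg.z := contMDiff_z.continuous

theorem continuous_mk {X : Type*} [TopologicalSpace X] {x y z : X → ℝ}
    (hx : Continuous x) (hy : Continuous y) (hz : Continuous z) :
    Continuous (fun m => (⟨x m, y m, z m⟩ : Heisenberg)) :=
  contMDiff_coords_symm.continuous.comp (hx.prodMk (hy.prodMk hz))

instance : IsTopologicalGroup Heisenberg where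
  continuous_mul := by
    have h1 := continuous_x.comp (continuous_fst (X := Heisenberg) (Y := Heisenberg))
    have h2 := continuous_x.comp (continuous_snd (X := Heisenberg) (Y := Heisenberg))
    have h3 := continuous_y.comp (continuous_fst (X := Heisenberg) (Y := Heisenberg))
    have h4 := continuous_y.comp (continuous_snd (X := Heisenberg) (Y := Heisenberg))
    have h5 := continuous_z.comp (continuous_fst (X := Heisenberg) (Y := Heisenberg))
    have h6 := continuous_z.comp (continuous_snd (X := Heisenberg) (Y := Heisenberg))
    exact continuous_mk (h1.add h2) (h3.add h4) ((h5.add h6).add (h1.mul h4))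
  continuous_inv :=
    continuous_mk continuous_x.neg continuous_y.neg
      (continuous_z.neg.add (continuous_x.mul continuous_y))

instance : T2Space Heisenberg := coordsHomeomorph.symm.t2Space
instance : PathConnectedSpace Heisenberg :=
  coordsHomeomorph.symm.surjective.pathConnectedSpace coordsHomeomorph.symm.continuous

end Heisenberg

/-! ### Coverings of simply connected groups -/

/-- A local homeomorphism at `1` has open, hence closed, image and discrete kernel, so it is a
covering onto the connected group `G`. Simple connectedness then provides a global section. -/
theorem MonoidHom.bijective_of_simplyConnected {A G : Type*} [Group A] [TopologicalSpace A]
    [IsTopologicalGroup A] [ConnectedSpace A] [Group G] [TopologicalSpace G] [IsTopologicalGroup G]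
    [SimplyConnectedSpace G] [LocallyPathConnectedSpace G] (f : A →* G)
    (hf : Filter.map f (𝓝 1) = 𝓝 1) {U : Set A} (hU : U ∈ 𝓝 1) (hinj : Set.InjOn f U) :
    Function.Bijective f := by
  have hmap : ∀ a, Filter.map f (𝓝 a) = 𝓝 (f a) := by
    intro a
    rw [← map_mul_left_nhds_one a, ← map_mul_left_nhds_one (f a), ← hf, Filter.map_map,
      Filter.map_map]
    congr 1
    ext b
    simp
  have hcont : Continuous f := continuous_iff_continuousAt.2 fun a => (hmap a).le
  have hopen : IsOpenMap f := isOpenMap_iff_nhds_le.2 fun a => (hmap a).ge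
  have hsurj : Function.Surjective f := by
    have h1 : IsOpen (f.range : Set G) := by
      rw [MonoidHom.coe_range]; exact hopen.isOpen_range
    have h2 : IsClosed (f.range : Set G) := Subgroup.isClosed_of_isOpen _ h1
    have h3 := IsClopen.eq_univ ⟨h2, h1⟩ ⟨1, f.range.one_mem⟩
    rw [MonoidHom.coe_range] at h3
    exact Set.range_eq_univ.1 h3
  have hdisc : IsDiscrete (f.ker : Set A) := by
    refine ⟨?_⟩
    refine discreteTopology_of_isOpen_singleton_one (G := f.ker) ?_
    obtain ⟨V, hVU, hV, h1V⟩ := mem_nhds_iff.1 hU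
    have : ({1} : Set f.ker) = Subtype.val ⁻¹' V := by
      ext ⟨a, ha⟩
      simp only [Set.mem_singleton_iff, Set.mem_preimage]
      constructor
      · intro h
        rw [Subtype.ext_iff] at h
        have h : a = 1 := h
        rwa [h]
      · intro h
        refine Subtype.ext (hinj (hVU h) (hVU h1V) ?_)
        exact (MonoidHom.mem_ker.1 ha).trans (map_one f).symm
    rw [this]
    exact hV.preimage continuous_subtype_val
  have hcov : IsCoveringMap f :=
    (Topology.IsQuotientMap.isQuotientCoveringMap_of_isDiscrete_ker_monoidHom
      (hopen.isQuotientMap hcont hsurj) hdisc).isCoveringMap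
  -- `F` lifts the identity of `G` with `F 1 = 1`. Then `F ∘ f` and the identity of `A` are lifts of
  -- `f` that agree at `1`, so they agree on the connected group `A`.
  obtain ⟨F, ⟨hF1, hF⟩, -⟩ := hcov.existsUnique_continuousMap_lifts (ContinuousMap.id G)
    (1 : G) (1 : A) (by simp)
  have h4 : F ∘ f = _root_.id := by
    refine hcov.eq_of_comp_eq (F.continuous.comp hcont) continuous_id ?_ 1 ?_
    · rw [← Function.comp_assoc, hF]; rfl
    · simp [hF1]
  exact ⟨Function.LeftInverse.injective (g := F) fun a => congrFun h4 a, hsurj⟩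

/-! ### Integration of a Heisenberg frame to a smooth homomorphism into `G` -/

section HeisenbergExp

set_option linter.unusedSectionVars false

open Set Filter

variable {E : Type*} [NormedAddCommGroup E] [NormedSpace ℝ E]
  {G : Type*} [TopologicalSpace G] [ChartedSpace E G] [Group G] [LieGroup 𝓘(ℝ, E) ∞ G]
  [CompleteSpace E] [T2Space G] {d : ℕ}

variable (G) in
/-- A linear parametrization of the Lie algebra of `G` by the Lie algebra of the product of the
Heisenberg group with `ℝᵈ`, compatible with the brackets. -/
structure IsHeisenbergFrame (L : (ℝ × ℝ × ℝ × (Fin d → ℝ)) ≃ₗ[ℝ] E) : Prop where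
  bracket : groupBracket (E := E) G (L (1, 0, 0, 0)) (L (0, 1, 0, 0)) = L (0, 0, 1, 0)
  central : ∀ v z w, groupBracket (E := E) G v (L (0, 0, z, w)) = 0

variable (G) in
/-- The homomorphism with values in `G` integrating a Heisenberg frame. -/
noncomputable def heisenbergExp (L : (ℝ × ℝ × ℝ × (Fin d → ℝ)) ≃ₗ[ℝ] E)
    (p : Heisenberg × (Fin d → ℝ)) : G :=
  lieExp G (L (0, 0, p.1.z, p.2)) * lieExp G (p.1.y • L (0, 1, 0, 0)) *
    lieExp G (p.1.x • L (1, 0, 0, 0))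

variable {L : (ℝ × ℝ × ℝ × (Fin d → ℝ)) ≃ₗ[ℝ] E}

theorem IsHeisenbergFrame.commute (hL : IsHeisenbergFrame G L) (z : ℝ) (w : Fin d → ℝ) (v : E) :
    Commute (lieExp G v) (lieExp G (L (0, 0, z, w))) :=
  commute_lieExp (hL.central v z w)

theorem IsHeisenbergFrame.lieExp_add (hL : IsHeisenbergFrame G L) (z z' : ℝ) (w w' : Fin d → ℝ) :
    lieExp G (L (0, 0, z + z', w + w')) =
      lieExp G (L (0, 0, z, w)) * lieExp G (L (0, 0, z', w')) := by
  rw [← _root_.lieExp_add (hL.central _ _ _), ← map_add]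
  simp

theorem IsHeisenbergFrame.lieExp_mul (hL : IsHeisenbergFrame G L) (x y : ℝ) :
    lieExp G (x • L (1, 0, 0, 0)) * lieExp G (y • L (0, 1, 0, 0)) =
      lieExp G (L (0, 0, x * y, 0)) * lieExp G (y • L (0, 1, 0, 0)) *
        lieExp G (x • L (1, 0, 0, 0)) := by
  refine lieExp_mul_lieExp ?_ (hL.central _ _ _) (hL.central _ _ _)
  rw [groupBracket_smul_left, groupBracket_smul_right, hL.bracket, ← map_smul, ← map_smul]
  simp

/-- The order of the factors copies `h(x, y, z) = h(0, 0, z) h(0, y, 0) h(x, 0, 0)`. In a product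
only `exp(xX)` has to pass `exp(y'Y)`, which costs the central factor `exp(xy'Z)`, the term `x * y'`
of the Heisenberg law. -/
theorem IsHeisenbergFrame.heisenbergExp_mul (hL : IsHeisenbergFrame G L)
    (p q : Heisenberg × (Fin d → ℝ)) :
    heisenbergExp G L (p.1 * q.1, p.2 + q.2) = heisenbergExp G L p * heisenbergExp G L q := by
  obtain ⟨⟨x, y, z⟩, w⟩ := p
  obtain ⟨⟨x', y', z'⟩, w'⟩ := q
  simp only [heisenbergExp, Heisenberg.mul_def]
  have h1 : lieExp G (L (0, 0, z + z' + x * y', w + w')) = lieExp G (L (0, 0, z, w)) *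
      lieExp G (L (0, 0, z', w')) * lieExp G (L (0, 0, x * y', 0)) := by
    rw [← hL.lieExp_add, ← hL.lieExp_add, add_zero]
  rw [h1, add_comm y y', lieExp_add_smul y' y, add_comm x x', lieExp_add_smul x' x]
  have c1 := hL.commute z' w' (y • L (0, 1, 0, 0))
  have c2 := hL.commute z' w' (x • L (1, 0, 0, 0))
  have c3 := hL.commute (x * y') 0 (y • L (0, 1, 0, 0))
  have h2 := hL.lieExp_mul x y'
  have c4 : Commute (lieExp G (x • L (1, 0, 0, 0))) (lieExp G (x' • L (1, 0, 0, 0))) := by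
    have := (lieExp_add_smul (G := G) x x' (L (1, 0, 0, 0)))
    rw [add_comm, lieExp_add_smul] at this
    exact this.symm
  have c5 : Commute (lieExp G (y • L (0, 1, 0, 0))) (lieExp G (y' • L (0, 1, 0, 0))) := by
    have := (lieExp_add_smul (G := G) y y' (L (0, 1, 0, 0)))
    rw [add_comm, lieExp_add_smul] at this
    exact this.symm
  generalize lieExp G (x • L (1, 0, 0, 0)) = X at *
  generalize lieExp G (x' • L (1, 0, 0, 0)) = X' at *
  generalize lieExp G (y • L (0, 1, 0, 0)) = Y at *
  generalize lieExp G (y' • L (0, 1, 0, 0)) = Y' at *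
  generalize lieExp G (L (0, 0, z, w)) = C at *
  generalize lieExp G (L (0, 0, z', w')) = C' at *
  generalize lieExp G (L (0, 0, x * y', 0)) = Z at *
  calc C * C' * Z * (Y' * Y) * (X' * X) = C * C' * (Z * (Y' * Y)) * (X' * X) := by group
    _ = C * C' * (Y * Z * Y') * (X * X') := by
      rw [c5.eq.symm, ← mul_assoc Z, c3.eq.symm, c4.eq]
    _ = C * (C' * Y) * (Z * Y' * X) * X' := by group
    _ = C * (Y * C') * (X * Y') * X' := by rw [c1.eq, h2]
    _ = C * Y * (C' * X) * Y' * X' := by group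
    _ = C * Y * (X * C') * Y' * X' := by rw [c2.eq]
    _ = C * Y * X * (C' * Y' * X') := by group

/-- The exponential map is known to be smooth only along lines. On the central summand it is a
product of such lines, one for each basis vector, so an induction over the basis suffices. -/
theorem IsHeisenbergFrame.contMDiff_lieExp_sum (hL : IsHeisenbergFrame G L) (s : Finset (Fin d)) :
    ContMDiff 𝓘(ℝ, Fin d → ℝ) 𝓘(ℝ, E) ∞
      (fun w : Fin d → ℝ => lieExp G (L (0, 0, 0, ∑ i ∈ s, w i • (Pi.single i 1 : Fin d → ℝ)))) := by
  classical
  induction s using Finset.induction_on with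
  | empty =>
    simp only [Finset.sum_empty]
    exact contMDiff_const
  | insert i s hi ih =>
    have h1 : ContMDiff 𝓘(ℝ, Fin d → ℝ) 𝓘(ℝ, E) ∞
        (fun w : Fin d → ℝ => lieExp G (w i • L (0, 0, 0, Pi.single i 1))) :=
      (contMDiff_lieExp_smul _).comp (contDiff_apply ℝ ℝ i).contMDiff
    refine (h1.mul ih).congr fun w => ?_
    have h2 := hL.lieExp_add 0 0 (w i • Pi.single i 1) (∑ i ∈ s, w i • Pi.single i 1)
    have h3 : w i • L (0, 0, 0, Pi.single i 1) = L (0, 0, 0, w i • Pi.single i 1) := by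
      rw [← map_smul]
      simp
    rw [add_zero] at h2
    rw [Finset.sum_insert hi, h2, ← h3]
    rfl

theorem IsHeisenbergFrame.contMDiff_heisenbergExp (hL : IsHeisenbergFrame G L) :
    ContMDiff (𝓘(ℝ, ℝ × ℝ × ℝ).prod 𝓘(ℝ, Fin d → ℝ)) 𝓘(ℝ, E) ∞ (heisenbergExp G L) := by
  have h1 : ContMDiff 𝓘(ℝ, Fin d → ℝ) 𝓘(ℝ, E) ∞ (fun w => lieExp G (L (0, 0, 0, w))) := by
    refine (hL.contMDiff_lieExp_sum Finset.univ).congr fun w => ?_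
    congr 5
    ext j
    simp [Finset.sum_apply, Pi.single_apply]
  have h2 : ∀ z w, lieExp G (L (0, 0, z, w)) =
      lieExp G (z • L (0, 0, 1, 0)) * lieExp G (L (0, 0, 0, w)) := by
    intro z w
    have := hL.lieExp_add z 0 0 w
    rw [add_zero, zero_add] at this
    rw [this, ← map_smul]
    simp
  refine ContMDiff.congr ?_ (f := fun p : Heisenberg × (Fin d → ℝ) =>
    lieExp G (p.1.z • L (0, 0, 1, 0)) * lieExp G (L (0, 0, 0, p.2)) *
      lieExp G (p.1.y • L (0, 1, 0, 0)) * lieExp G (p.1.x • L (1, 0, 0, 0)))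
    fun p => by rw [heisenbergExp, h2]
  exact ((((contMDiff_lieExp_smul _).comp (Heisenberg.contMDiff_z.comp contMDiff_fst)).mul
    (h1.comp contMDiff_snd)).mul
    ((contMDiff_lieExp_smul _).comp (Heisenberg.contMDiff_y.comp contMDiff_fst))).mul
    ((contMDiff_lieExp_smul _).comp (Heisenberg.contMDiff_x.comp contMDiff_fst))

/-- The global coordinates on the product of the Heisenberg group with `ℝᵈ`. -/
def prodOfCoords (u : ℝ × ℝ × ℝ × (Fin d → ℝ)) : Heisenberg × (Fin d → ℝ) :=
  (⟨u.1, u.2.1, u.2.2.1⟩, u.2.2.2)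

theorem contMDiff_prodOfCoords : ContMDiff 𝓘(ℝ, ℝ × ℝ × ℝ × (Fin d → ℝ))
    (𝓘(ℝ, ℝ × ℝ × ℝ).prod 𝓘(ℝ, Fin d → ℝ)) ∞ (prodOfCoords (d := d)) := by
  have h1 : ContDiff ℝ ∞ (fun u : ℝ × ℝ × ℝ × (Fin d → ℝ) => u.1) := by fun_prop
  have h2 : ContDiff ℝ ∞ (fun u : ℝ × ℝ × ℝ × (Fin d → ℝ) => u.2.1) := by fun_prop
  have h3 : ContDiff ℝ ∞ (fun u : ℝ × ℝ × ℝ × (Fin d → ℝ) => u.2.2.1) := by fun_prop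
  have h4 : ContDiff ℝ ∞ (fun u : ℝ × ℝ × ℝ × (Fin d → ℝ) => u.2.2.2) := by fun_prop
  exact (Heisenberg.contMDiff_mk h1.contMDiff h2.contMDiff h3.contMDiff).prodMk h4.contMDiff

theorem lieExp_map_zero : lieExp G (L (0, 0, 0, 0)) = 1 := by
  rw [show ((0, 0, 0, 0) : ℝ × ℝ × ℝ × (Fin d → ℝ)) = 0 from rfl, map_zero, lieExp_zero]

theorem heisenbergExp_zero : heisenbergExp G L (prodOfCoords 0) = 1 := by
  change lieExp G (L (0, 0, 0, 0)) * lieExp G ((0 : ℝ) • _) * lieExp G ((0 : ℝ) • _) = 1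
  rw [lieExp_map_zero, zero_smul, zero_smul, lieExp_zero, mul_one, mul_one]

theorem IsHeisenbergFrame.contDiffAt_heisenbergExp (hL : IsHeisenbergFrame G L) :
    ContDiffAt ℝ ∞ (fun u => extChartAt 𝓘(ℝ, E) (1 : G) (heisenbergExp G L (prodOfCoords u))) 0 :=
  contDiffAt_extChartAt_one_comp
    (hL.contMDiff_heisenbergExp.comp contMDiff_prodOfCoords).contMDiffAt heisenbergExp_zero

theorem IsHeisenbergFrame.fderiv_heisenbergExp [FiniteDimensional ℝ E]
    (hL : IsHeisenbergFrame G L) :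
    HasFDerivAt (fun u => extChartAt 𝓘(ℝ, E) (1 : G) (heisenbergExp G L (prodOfCoords u)))
      (L.toContinuousLinearEquiv : (ℝ × ℝ × ℝ × (Fin d → ℝ)) →L[ℝ] E) 0 := by
  have hd := (hL.contDiffAt_heisenbergExp.differentiableAt (by simp)).hasFDerivAt
  set D := fderiv ℝ (fun u => extChartAt 𝓘(ℝ, E) (1 : G)
    (heisenbergExp G L (prodOfCoords u))) 0 with hD
  -- Where the map runs along the one-parameter subgroup of velocity `L u`, its derivative in the
  -- direction `u` is `L u`. The `x` axis, the `y` axis and the central subspace satisfy this, and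
  -- together they span.
  have hline : ∀ u : ℝ × ℝ × ℝ × (Fin d → ℝ), (∀ t : ℝ,
      heisenbergExp G L (prodOfCoords (t • u)) = lieExp G (t • L u)) → D u = L u := by
    intro u hu
    have h1 := (isOneParameter_lieExp (G := G) (L u)).deriv
    have h2 : HasDerivAt (fun t : ℝ => t • u) u 0 := by
      simpa using (hasDerivAt_id (0 : ℝ)).smul_const u
    rw [show (0 : ℝ × ℝ × ℝ × (Fin d → ℝ)) = (0 : ℝ) • u by simp] at hd
    have h3 := HasFDerivAt.comp_hasDerivAt (f := fun t : ℝ => t • u) (0 : ℝ) hd h2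
    simp only [Function.comp_def, hu] at h3
    exact h3.unique h1
  have e1 := hline (1, 0, 0, 0) fun t => by
    simp [heisenbergExp, prodOfCoords, lieExp_zero, lieExp_map_zero]
  have e2 := hline (0, 1, 0, 0) fun t => by
    simp [heisenbergExp, prodOfCoords, lieExp_zero, lieExp_map_zero]
  have e3 := fun z w => hline (0, 0, z, w) fun t => by
    rw [← map_smul]
    simp [heisenbergExp, prodOfCoords, lieExp_zero]
  have : D = (L.toContinuousLinearEquiv : (ℝ × ℝ × ℝ × (Fin d → ℝ)) →L[ℝ] E) := by
    refine ContinuousLinearMap.ext fun ⟨x, y, z, w⟩ => ?_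
    have : ((x, y, z, w) : ℝ × ℝ × ℝ × (Fin d → ℝ)) = x • ((1 : ℝ), (0 : ℝ), (0 : ℝ), (0 : Fin d → ℝ)) +
      y • ((0 : ℝ), (1 : ℝ), (0 : ℝ), (0 : Fin d → ℝ)) + (0, 0, z, w) := by simp
    rw [this, map_add, map_add, map_smul, map_smul, e1, e2, e3]
    simp only [ContinuousLinearEquiv.coe_coe, LinearEquiv.coe_toContinuousLinearEquiv', map_add,
      map_smul]
  rwa [← this]

end HeisenbergExp

/-! ### The diffeomorphism of `G` with the product of the Heisenberg group and `ℝᵈ` -/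

section HeisenbergDiffeomorph

set_option linter.unusedSectionVars false

open Set Filter

variable {d : ℕ}

/-- The global coordinates on the product of the Heisenberg group with `ℝᵈ`, as a
homeomorphism. -/
def prodOfCoordsHomeomorph : ℝ × ℝ × ℝ × (Fin d → ℝ) ≃ₜ Heisenberg × (Fin d → ℝ) where
  toFun := prodOfCoords
  invFun p := (p.1.x, p.1.y, p.1.z, p.2)
  left_inv _ := rfl
  right_inv _ := rfl
  continuous_toFun := contMDiff_prodOfCoords.continuous
  continuous_invFun := (Heisenberg.continuous_x.comp continuous_fst).prodMk
    ((Heisenberg.continuous_y.comp continuous_fst).prodMk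
      ((Heisenberg.continuous_z.comp continuous_fst).prodMk continuous_snd))

theorem contMDiff_heisenberg_prod_mul_left (p : Heisenberg × (Fin d → ℝ)) :
    ContMDiff (𝓘(ℝ, ℝ × ℝ × ℝ).prod 𝓘(ℝ, Fin d → ℝ)) (𝓘(ℝ, ℝ × ℝ × ℝ).prod 𝓘(ℝ, Fin d → ℝ)) ∞
      (fun q : Heisenberg × (Fin d → ℝ) => (p.1 * q.1, p.2 + q.2)) := by
  have hx := Heisenberg.contMDiff_x
  have hy := Heisenberg.contMDiff_y
  have hz := Heisenberg.contMDiff_z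
  have h : ContMDiff 𝓘(ℝ, ℝ × ℝ × ℝ) 𝓘(ℝ, ℝ × ℝ × ℝ) ∞ (fun q : Heisenberg => p.1 * q) := by
    simp only [Heisenberg.mul_def]
    exact Heisenberg.contMDiff_mk (contMDiff_const.add hx) (contMDiff_const.add hy)
      ((contMDiff_const.add hz).add (contMDiff_const.mul hy))
  exact (h.comp contMDiff_fst).prodMk (contMDiff_const.add contMDiff_snd)

variable {E : Type*} [NormedAddCommGroup E] [NormedSpace ℝ E] [FiniteDimensional ℝ E]
  {G : Type*} [TopologicalSpace G] [ChartedSpace E G] [Group G] [LieGroup 𝓘(ℝ, E) ∞ G]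
  [CompleteSpace E] [T2Space G] {L : (ℝ × ℝ × ℝ × (Fin d → ℝ)) ≃ₗ[ℝ] E}

/-- `heisenbergExp` as a homomorphism. -/
noncomputable def IsHeisenbergFrame.hom (hL : IsHeisenbergFrame G L) :
    Heisenberg × Multiplicative (Fin d → ℝ) →* G :=
  MonoidHom.mk' (fun p => heisenbergExp G L (p.1, p.2.toAdd))
    fun p q => hL.heisenbergExp_mul (p.1, p.2.toAdd) (q.1, q.2.toAdd)

theorem IsHeisenbergFrame.eventually_mem_source (hL : IsHeisenbergFrame G L) :
    ∀ᶠ u in 𝓝 0, heisenbergExp G L (prodOfCoords u) ∈ (extChartAt 𝓘(ℝ, E) (1 : G)).source := by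
  have h := (hL.contMDiff_heisenbergExp.comp contMDiff_prodOfCoords).continuous.continuousAt
    (x := 0)
  refine h.eventually_mem ?_
  rw [Function.comp_apply, heisenbergExp_zero]
  exact extChartAt_source_mem_nhds _

theorem IsHeisenbergFrame.map_heisenbergExp_nhds (hL : IsHeisenbergFrame G L) :
    map (fun u => heisenbergExp G L (prodOfCoords u)) (𝓝 0) = 𝓝 1 := by
  have h1 := (hL.contDiffAt_heisenbergExp.hasStrictFDerivAt' hL.fderiv_heisenbergExp
    (by simp)).map_nhds_eq_of_equiv
  rw [heisenbergExp_zero] at h1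
  have h2 : (fun u => heisenbergExp G L (prodOfCoords u)) =ᶠ[𝓝 0]
      (extChartAt 𝓘(ℝ, E) (1 : G)).symm ∘
        fun u => extChartAt 𝓘(ℝ, E) (1 : G) (heisenbergExp G L (prodOfCoords u)) := by
    filter_upwards [hL.eventually_mem_source] with u hu
    exact ((extChartAt 𝓘(ℝ, E) (1 : G)).left_inv hu).symm
  rw [map_congr h2, ← map_map, h1]
  have h3 := (chartAt E (1 : G)).symm.map_nhds_eq (x := chartAt E (1 : G) 1) (by simp)
  simpa using h3

theorem IsHeisenbergFrame.injOn_heisenbergExp (hL : IsHeisenbergFrame G L) :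
    ∃ U ∈ 𝓝 (0 : ℝ × ℝ × ℝ × (Fin d → ℝ)),
      InjOn (fun u => heisenbergExp G L (prodOfCoords u)) U := by
  set e := hL.contDiffAt_heisenbergExp.toOpenPartialHomeomorph _ hL.fderiv_heisenbergExp
    (by simp) with he
  refine ⟨e.source, e.open_source.mem_nhds
    (ContDiffAt.mem_toOpenPartialHomeomorph_source _ _ _), fun u hu v hv huv => ?_⟩
  refine e.injOn hu hv ?_
  have huv : heisenbergExp G L (prodOfCoords u) = heisenbergExp G L (prodOfCoords v) := huv
  change extChartAt 𝓘(ℝ, E) (1 : G) (heisenbergExp G L (prodOfCoords u)) =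
    extChartAt 𝓘(ℝ, E) (1 : G) (heisenbergExp G L (prodOfCoords v))
  rw [huv]

theorem IsHeisenbergFrame.bijective_heisenbergExp [SimplyConnectedSpace G]
    (hL : IsHeisenbergFrame G L) : Function.Bijective (heisenbergExp G L) := by
  have : IsTopologicalGroup G := topologicalGroup_of_lieGroup 𝓘(ℝ, E) ∞
  have : LocallyPathConnectedSpace G := ChartedSpace.locallyPathConnectedSpace E G
  have : ConnectedSpace (Multiplicative (Fin d → ℝ)) :=
    inferInstanceAs (ConnectedSpace (Fin d → ℝ))
  have : ConnectedSpace Heisenberg := inferInstance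
  let P : ℝ × ℝ × ℝ × (Fin d → ℝ) ≃ₜ Heisenberg × Multiplicative (Fin d → ℝ) :=
    prodOfCoordsHomeomorph
  have hP : map P (𝓝 0) = 𝓝 1 := P.map_nhds_eq 0
  obtain ⟨U, hU, hinj⟩ := hL.injOn_heisenbergExp
  refine MonoidHom.bijective_of_simplyConnected hL.hom ?_ (U := P '' U) ?_ ?_
  · rw [← hP, map_map]
    exact hL.map_heisenbergExp_nhds
  · rw [← hP]
    exact image_mem_map hU
  · rintro _ ⟨u, hu, rfl⟩ _ ⟨v, hv, rfl⟩ huv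
    exact congrArg P (hinj hu hv huv)

/-- Near `1` the inverse is smooth by the inverse function theorem; as it is a homomorphism, left
translation spreads this to every point. -/
theorem IsHeisenbergFrame.contMDiff_heisenbergExp_symm (hL : IsHeisenbergFrame G L)
    (e : Heisenberg × (Fin d → ℝ) ≃ G) (he : ∀ p, e p = heisenbergExp G L p) :
    ContMDiff 𝓘(ℝ, E) (𝓘(ℝ, ℝ × ℝ × ℝ).prod 𝓘(ℝ, Fin d → ℝ)) ∞ e.symm := by
  have hmul : ∀ g g' : G, e.symm (g * g') =
      ((e.symm g).1 * (e.symm g').1, (e.symm g).2 + (e.symm g').2) := by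
    intro g g'
    rw [Equiv.symm_apply_eq, he, hL.heisenbergExp_mul, ← he, ← he, Equiv.apply_symm_apply,
      Equiv.apply_symm_apply]
  set f := fun u => extChartAt 𝓘(ℝ, E) (1 : G) (heisenbergExp G L (prodOfCoords u)) with hf
  have hn : (∞ : WithTop ℕ∞) ≠ 0 := by simp
  set ψ := hL.contDiffAt_heisenbergExp.localInverse hL.fderiv_heisenbergExp hn with hψ
  have hf0 : f 0 = extChartAt 𝓘(ℝ, E) (1 : G) 1 := by
    simp only [hf, heisenbergExp_zero]
  have h1 : ContDiffAt ℝ ∞ ψ (extChartAt 𝓘(ℝ, E) (1 : G) 1) := by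
    rw [← hf0]
    exact ContDiffAt.to_localInverse _ _ hn
  have hψ0 : ψ (extChartAt 𝓘(ℝ, E) (1 : G) 1) = 0 := by
    rw [← hf0]
    exact ContDiffAt.localInverse_apply_image _ _ hn
  have hφ : ContMDiffAt 𝓘(ℝ, E) 𝓘(ℝ, E) ∞ (extChartAt 𝓘(ℝ, E) (1 : G)) 1 := contMDiffAt_extChartAt
  have h2 : ContMDiffAt 𝓘(ℝ, E) 𝓘(ℝ, ℝ × ℝ × ℝ × (Fin d → ℝ)) ∞
      (fun g : G => ψ (extChartAt 𝓘(ℝ, E) (1 : G) g)) 1 := h1.contMDiffAt.comp 1 hφ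
  have h3 : ∀ᶠ g in 𝓝 (1 : G), e.symm g = prodOfCoords (ψ (extChartAt 𝓘(ℝ, E) (1 : G) g)) := by
    have h4 : ∀ᶠ v in 𝓝 (f 0), f (ψ v) = v :=
      (hL.contDiffAt_heisenbergExp.hasStrictFDerivAt' hL.fderiv_heisenbergExp
        hn).eventually_right_inverse
    rw [hf0] at h4
    have h5 := hL.eventually_mem_source
    have h6 := h2.continuousAt.tendsto
    rw [hψ0] at h6
    filter_upwards [h6.eventually h5, hφ.continuousAt.eventually h4,
      extChartAt_source_mem_nhds (I := 𝓘(ℝ, E)) (1 : G)] with g hg1 hg2 hg3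
    rw [Equiv.symm_apply_eq, he]
    exact (extChartAt 𝓘(ℝ, E) (1 : G)).injOn hg3 hg1 hg2.symm
  have h7 : ContMDiffAt 𝓘(ℝ, E) (𝓘(ℝ, ℝ × ℝ × ℝ).prod 𝓘(ℝ, Fin d → ℝ)) ∞ e.symm 1 :=
    ((contMDiff_prodOfCoords _).comp 1 h2).congr_of_eventuallyEq h3
  intro g
  have h8 : ContMDiff 𝓘(ℝ, E) 𝓘(ℝ, E) ∞ (fun g' : G => g⁻¹ * g') := contMDiff_mul_left
  have h9 : ContMDiffAt 𝓘(ℝ, E) (𝓘(ℝ, ℝ × ℝ × ℝ).prod 𝓘(ℝ, Fin d → ℝ)) ∞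
      (fun g' => e.symm (g⁻¹ * g')) g :=
    ContMDiffAt.comp g (g := e.symm) (f := fun g' : G => g⁻¹ * g')
      (by rw [inv_mul_cancel]; exact h7) h8.contMDiffAt
  refine ((contMDiff_heisenberg_prod_mul_left (e.symm g)).contMDiffAt.comp g h9).congr_of_eventuallyEq
    (Eventually.of_forall fun g' => ?_)
  simp only [Function.comp_apply]
  rw [← hmul, mul_inv_cancel_left]

theorem IsHeisenbergFrame.exists_diffeomorph [SimplyConnectedSpace G]
    (hL : IsHeisenbergFrame G L) :
    ∃ Ψ : Diffeomorph 𝓘(ℝ, E) (𝓘(ℝ, ℝ × ℝ × ℝ).prod 𝓘(ℝ, Fin d → ℝ))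
          G (Heisenberg × (Fin d → ℝ)) ∞,
        ∀ g g' : G, (Ψ (g * g')).1 = (Ψ g).1 * (Ψ g').1 ∧
          (Ψ (g * g')).2 = (Ψ g).2 + (Ψ g').2 := by
  set e := Equiv.ofBijective _ hL.bijective_heisenbergExp with he
  refine ⟨⟨e.symm, hL.contMDiff_heisenbergExp_symm e fun p => rfl,
    hL.contMDiff_heisenbergExp⟩, fun g g' => ?_⟩
  have hmul : e.symm (g * g') =
      ((e.symm g).1 * (e.symm g').1, (e.symm g).2 + (e.symm g').2) := by
    have h : ∀ p, e p = heisenbergExp G L p := fun p => rfl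
    rw [Equiv.symm_apply_eq, h, hL.heisenbergExp_mul, ← h, ← h, Equiv.apply_symm_apply,
      Equiv.apply_symm_apply]
  exact ⟨congrArg Prod.fst hmul, congrArg Prod.snd hmul⟩

end HeisenbergDiffeomorph

/-! ### Two-step nilpotent Lie algebras with a center of codimension two -/

section LieAlgebraFrame

theorem Submodule.exists_lifts_of_quotient {V : Type*} [AddCommGroup V] [Module ℝ V]
    [FiniteDimensional ℝ V] (S : Submodule ℝ V) {n : ℕ} (h : Module.finrank ℝ (V ⧸ S) = n) :
    ∃ X : Fin n → V, ∀ v, ∃ a : Fin n → ℝ, v - ∑ i, a i • X i ∈ S := by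
  let b := Module.finBasisOfFinrankEq ℝ (V ⧸ S) h
  choose X hX using fun i => S.mkQ_surjective (b i)
  refine ⟨X, fun v => ⟨fun i => b.repr (S.mkQ v) i, ?_⟩⟩
  suffices h : S.mkQ (v - ∑ i, b.repr (S.mkQ v) i • X i) = 0 by
    simpa [S.ker_mkQ] using LinearMap.mem_ker.2 h
  rw [map_sub, map_sum]
  simp only [map_smul, hX, b.sum_repr, sub_self]

/-- Two-step nilpotency puts all brackets in the center, and the bracket of two lifts of a basis of
the quotient spans them all. It is nonzero, so it can be taken as the first vector of a basis of the
center; the other `d` are lifts of a basis of the center modulo it. -/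
theorem LieAlgebra.exists_heisenberg_frame {𝔤 : Type*} [LieRing 𝔤] [LieAlgebra ℝ 𝔤]
    [FiniteDimensional ℝ 𝔤] (h2 : LieModule.nilpotencyLength 𝔤 𝔤 = 2)
    (hdim : Module.finrank ℝ (𝔤 ⧸ LieAlgebra.center ℝ 𝔤) = 2) :
    ∃ d : ℕ, Module.finrank ℝ (LieAlgebra.center ℝ 𝔤) = d + 1 ∧
      ∃ L : (ℝ × ℝ × ℝ × (Fin d → ℝ)) ≃ₗ[ℝ] 𝔤,
        ⁅L (1, 0, 0, 0), L (0, 1, 0, 0)⁆ = L (0, 0, 1, 0) ∧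
        ∀ (v : 𝔤) z w, ⁅v, L (0, 0, z, w)⁆ = 0 := by
  obtain ⟨hl2, hl1⟩ := (LieModule.nilpotencyLength_eq_succ_iff ℝ 𝔤 𝔤 1).1 h2
  have hC : ∀ c : 𝔤, c ∈ LieAlgebra.center ℝ 𝔤 ↔ ∀ v : 𝔤, ⁅v, c⁆ = 0 := fun c =>
    LieModule.mem_maxTrivSubmodule ℝ 𝔤 𝔤 c
  set C : Submodule ℝ 𝔤 := (LieAlgebra.center ℝ 𝔤).toSubmodule with hCdef
  have hCmem : ∀ c : 𝔤, c ∈ C ↔ ∀ v : 𝔤, ⁅v, c⁆ = 0 := hC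
  have hdim' : Module.finrank ℝ (𝔤 ⧸ C) = 2 := hdim
  have hbr : ∀ v w : 𝔤, ⁅v, w⁆ ∈ C := by
    intro v w
    rw [hCmem]
    intro u
    have h1 : ⁅v, w⁆ ∈ LieModule.lowerCentralSeries ℝ 𝔤 𝔤 1 := by
      rw [LieModule.lowerCentralSeries_succ]
      exact LieSubmodule.lie_mem_lie (LieSubmodule.mem_top v) (by simp)
    have h3 : ⁅u, ⁅v, w⁆⁆ ∈ LieModule.lowerCentralSeries ℝ 𝔤 𝔤 (1 + 1) := by
      rw [LieModule.lowerCentralSeries_succ]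
      exact LieSubmodule.lie_mem_lie (LieSubmodule.mem_top u) h1
    rw [hl2] at h3
    simpa using h3
  obtain ⟨X, hX⟩ := C.exists_lifts_of_quotient hdim'
  simp only [Fin.sum_univ_two] at hX
  have hleft : ∀ c ∈ C, ∀ v : 𝔤, ⁅c, v⁆ = 0 := fun c hc v => by
    rw [← lie_skew, (hCmem c).1 hc, neg_zero]
  -- Otherwise every bracket vanishes and the nilpotency length is at most one.
  have hne : ⁅X 0, X 1⁆ ≠ 0 := by
    intro h0
    apply hl1
    have h10 : ⁅X 1, X 0⁆ = 0 := by rw [← lie_skew, h0, neg_zero]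
    have hall : ∀ v w : 𝔤, ⁅v, w⁆ = 0 := by
      intro v w
      obtain ⟨a, ha⟩ := hX v
      obtain ⟨b, hb⟩ := hX w
      have hv : v = a 0 • X 0 + a 1 • X 1 + (v - (a 0 • X 0 + a 1 • X 1)) := by abel
      have hw : w = b 0 • X 0 + b 1 • X 1 + (w - (b 0 • X 0 + b 1 • X 1)) := by abel
      generalize v - (a 0 • X 0 + a 1 • X 1) = c at *
      generalize w - (b 0 • X 0 + b 1 • X 1) = c' at *
      rw [hv, hw]
      simp only [lie_add, add_lie, lie_smul, smul_lie, lie_self, h0, h10, (hCmem _).1 hb,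
        hleft _ ha, smul_zero, add_zero]
    rw [LieModule.lowerCentralSeries_succ, LieSubmodule.lie_eq_bot_iff]
    exact fun x _ m _ => hall x m
  let Z : C := ⟨⁅X 0, X 1⁆, hbr _ _⟩
  have hZ : Z ≠ 0 := fun h => hne (congrArg Subtype.val h)
  have hpos : 0 < Module.finrank ℝ C := Module.finrank_pos_iff_exists_ne_zero.2 ⟨Z, hZ⟩
  obtain ⟨d, hd⟩ : ∃ d, Module.finrank ℝ C = d + 1 := ⟨_, (Nat.succ_pred_eq_of_pos hpos).symm⟩
  have hq : Module.finrank ℝ (C ⧸ Submodule.span ℝ {Z}) = d := by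
    have h3 := Submodule.finrank_quotient_add_finrank (Submodule.span ℝ {Z})
    rw [finrank_span_singleton hZ, hd] at h3
    omega
  obtain ⟨c, hc⟩ := Submodule.exists_lifts_of_quotient _ hq
  let L₀ : (ℝ × ℝ × ℝ × (Fin d → ℝ)) →ₗ[ℝ] 𝔤 :=
    (LinearMap.toSpanSingleton ℝ 𝔤 (X 0)).coprod
      ((LinearMap.toSpanSingleton ℝ 𝔤 (X 1)).coprod
        ((LinearMap.toSpanSingleton ℝ 𝔤 ⁅X 0, X 1⁆).coprod
          (C.subtype ∘ₗ Fintype.linearCombination ℝ c)))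
  have hL₀ : ∀ x y z w, L₀ (x, y, z, w) =
      x • X 0 + (y • X 1 + (z • ⁅X 0, X 1⁆ + ((∑ i, w i • c i : C) : 𝔤))) := by
    intro x y z w
    simp [L₀, Fintype.linearCombination_apply]
  have hsurj : Function.Surjective L₀ := by
    intro v
    obtain ⟨a, ha⟩ := hX v
    obtain ⟨w, hw⟩ := hc ⟨_, ha⟩
    obtain ⟨z, hz⟩ := Submodule.mem_span_singleton.1 hw
    refine ⟨(a 0, a 1, z, w), ?_⟩
    have h3 := congrArg Subtype.val hz
    rw [Submodule.coe_sub, Submodule.coe_smul] at h3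
    rw [hL₀]
    change z • ⁅X 0, X 1⁆ = _ at h3
    rw [h3]
    change a 0 • X 0 + (a 1 • X 1 + (v - (a 0 • X 0 + a 1 • X 1) - _ + _)) = v
    abel
  have hfr : Module.finrank ℝ (ℝ × ℝ × ℝ × (Fin d → ℝ)) = Module.finrank ℝ 𝔤 := by
    have h3 := Submodule.finrank_quotient_add_finrank C
    rw [hdim', hd] at h3
    simp only [Module.finrank_prod, Module.finrank_self, Module.finrank_fin_fun]
    omega
  have hinj := (LinearMap.injective_iff_surjective_of_finrank_eq_finrank hfr).2 hsurj
  have hL : ∀ u, LinearEquiv.ofBijective L₀ (And.intro hinj hsurj : Function.Bijective L₀) u =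
    L₀ u := fun _ => rfl
  refine ⟨d, hd, LinearEquiv.ofBijective L₀ (And.intro hinj hsurj : Function.Bijective L₀), ?_,
    fun v z w => ?_⟩
  · simp only [hL, hL₀]
    simp
  · rw [hL, hL₀, lie_add, lie_add, lie_add, lie_smul, lie_smul, lie_smul,
      (hCmem _).1 (hbr _ _), (hCmem _).1 (Subtype.prop _)]
    simp

variable {E : Type*} [NormedAddCommGroup E] [NormedSpace ℝ E] [FiniteDimensional ℝ E]
  [CompleteSpace E] {G : Type*} [TopologicalSpace G] [ChartedSpace E G] [Group G]
  [LieGroup 𝓘(ℝ, E) ∞ G]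

theorem exists_isHeisenbergFrame
    (h_two_step : LieModule.nilpotencyLength
      (GroupLieAlgebra 𝓘(ℝ, E) G) (GroupLieAlgebra 𝓘(ℝ, E) G) = 2)
    (h_dim : Module.finrank ℝ (GroupLieAlgebra 𝓘(ℝ, E) G ⧸
      LieAlgebra.center ℝ (GroupLieAlgebra 𝓘(ℝ, E) G)) = 2) :
    ∃ d : ℕ,
      Module.finrank ℝ (LieAlgebra.center ℝ (GroupLieAlgebra 𝓘(ℝ, E) G)) = d + 1 ∧
      ∃ L : (ℝ × ℝ × ℝ × (Fin d → ℝ)) ≃ₗ[ℝ] E, IsHeisenbergFrame G L := by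
  have : FiniteDimensional ℝ (GroupLieAlgebra 𝓘(ℝ, E) G) :=
    inferInstanceAs (FiniteDimensional ℝ E)
  obtain ⟨d, hd, L, h1, h2⟩ := LieAlgebra.exists_heisenberg_frame h_two_step h_dim
  exact ⟨d, hd, L, h1, h2⟩

end LieAlgebraFrame

/-! ### Continuous homomorphisms that vanish on a lattice -/

-- `f` descends to `F : G ⧸ Γ → ℝ` with `F (a • m) = f a + F m`, so the image of the invariant
-- probability measure is invariant under translation by `f a`. If `f a > 0`, the half-lines `Iic (n
-- * f a)`, `n ∈ ℤ`, all have the same measure, although these measures tend to `1` and to `0` at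
-- the two ends.
open MeasureTheory Filter in
theorem IsLattice.eq_zero_of_forall_mem {G : Type*} [Group G] [TopologicalSpace G]
    [IsTopologicalGroup G] {Γ : Subgroup G} (hΓ : IsLattice Γ) (f : G → ℝ) (hf : Continuous f)
    (hmul : ∀ g h, f (g * h) = f g + f h) (h0 : ∀ g ∈ Γ, f g = 0) (g : G) : f g = 0 := by
  let _ : MeasurableSpace (G ⧸ Γ) := borel (G ⧸ Γ)
  have : BorelSpace (G ⧸ Γ) := ⟨rfl⟩
  obtain ⟨μ, hμ, hinv⟩ := hΓ.finite_covolume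
  have hdesc : ∀ a b : G, QuotientGroup.leftRel Γ a b → f a = f b := by
    intro a b hab
    have h1 := h0 _ (QuotientGroup.leftRel_apply.1 hab)
    have h2 := hmul a (a⁻¹ * b)
    rw [mul_inv_cancel_left, h1, add_zero] at h2
    exact h2.symm
  let F : G ⧸ Γ → ℝ := Quotient.lift f hdesc
  have hF : Continuous F := hf.quotient_lift hdesc
  have hFmk : ∀ a : G, F (QuotientGroup.mk a) = f a := fun _ => rfl
  have hFs : ∀ (a : G) (m : G ⧸ Γ), F (a • m) = f a + F m := by
    intro a m
    obtain ⟨b, rfl⟩ := QuotientGroup.mk_surjective m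
    rw [MulAction.Quotient.smul_mk, hFmk, hFmk, smul_eq_mul, hmul]
  let ν : Measure ℝ := μ.map F
  have hν : IsProbabilityMeasure ν := Measure.isProbabilityMeasure_map hF.measurable.aemeasurable
  have hshift : ∀ (a : G) (t : ℝ), ν (Set.Iic (t + f a)) = ν (Set.Iic t) := by
    intro a t
    have h1 : Measurable (fun m : G ⧸ Γ => a • m) :=
      (continuous_const_smul a).measurable
    rw [Measure.map_apply hF.measurable measurableSet_Iic,
      Measure.map_apply hF.measurable measurableSet_Iic]
    conv_lhs => rw [← hinv a]
    rw [Measure.map_apply h1 (hF.measurable measurableSet_Iic)]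
    congr 1
    ext m
    simp only [Set.mem_preimage, Set.mem_Iic, hFs]
    constructor <;> intro h <;> linarith
  have key : ∀ a : G, ¬ 0 < f a := by
    intro a ha
    have hn : ∀ n : ℕ, ν (Set.Iic (n * f a)) = ν (Set.Iic 0) := by
      intro n
      induction n with
      | zero => simp
      | succ n ih =>
        rw [← ih, ← hshift a (n * f a)]
        congr 2
        push_cast
        ring
    have hn' : ∀ n : ℕ, ν (Set.Iic (-(n * f a))) = ν (Set.Iic 0) := by
      intro n
      induction n with
      | zero => simp
      | succ n ih =>
        rw [← ih, ← hshift a]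
        congr 2
        push_cast
        ring
    have ht : Tendsto (fun n : ℕ => (n : ℝ) * f a) atTop atTop :=
      tendsto_natCast_atTop_atTop.atTop_mul_const ha
    have h1 := (tendsto_measure_Iic_atTop ν).comp ht
    have h2 : Tendsto (fun t : ℝ => ν (Set.Iic t)) atBot (𝓝 0) := by
      have := tendsto_measure_iInter_atBot (μ := ν) (s := fun t : ℝ => Set.Iic t)
        (fun t => measurableSet_Iic.nullMeasurableSet) (fun s t h => Set.Iic_subset_Iic.2 h)
        ⟨0, measure_ne_top _ _⟩
      have h3 : ⋂ t : ℝ, Set.Iic t = ∅ := Set.eq_empty_of_forall_notMem fun t ht => by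
        have := Set.mem_iInter.1 ht (t - 1)
        simp only [Set.mem_Iic] at this
        linarith
      rwa [h3, measure_empty] at this
    have h3 := h2.comp (tendsto_neg_atTop_atBot.comp ht)
    simp only [Function.comp_def, hn, hn'] at h1 h3
    have h4 := tendsto_nhds_unique tendsto_const_nhds h1
    have h5 := tendsto_nhds_unique tendsto_const_nhds h3
    rw [h5, measure_univ] at h4
    exact zero_ne_one h4
  have hf1 : f 1 = 0 := h0 1 Γ.one_mem
  have h1 := key g
  have h2 := key g⁻¹
  have h3 := hmul g g⁻¹
  rw [mul_inv_cancel, hf1] at h3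
  linarith

theorem IsLattice.finite_mem_of_isCompact {G : Type*} [Group G] [TopologicalSpace G]
    [IsTopologicalGroup G] [T2Space G] {Γ : Subgroup G} (hΓ : IsLattice Γ) {K : Set G}
    (hK : IsCompact K) : {g | g ∈ Γ ∧ g ∈ K}.Finite := by
  have : DiscreteTopology Γ := hΓ.discrete.to_subtype
  have h : IsClosed (Γ : Set G) := Subgroup.isClosed_of_discrete
  exact (hK.inter_left h).finite (hΓ.discrete.mono Set.inter_subset_left)

/-! ### Symmetric coordinates -/

section SymmetricCoordinates

/-- The space of symmetric coordinates `(x, y, s, w)` of the product of the Heisenberg group with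
`ℝᵈ`, where `s = z - x y / 2`. -/
abbrev SymSpace (d : ℕ) : Type := ℝ × ℝ × ℝ × (Fin d → ℝ)

variable {d : ℕ}

/-- The commutator form. -/
def symForm (u v : SymSpace d) : ℝ := u.1 * v.2.1 - u.2.1 * v.1

/-- The group law in symmetric coordinates. -/
noncomputable def symMul (u v : SymSpace d) : SymSpace d := u + v + (0, 0, symForm u v / 2, 0)

theorem symForm_self (u : SymSpace d) : symForm u u = 0 := by
  simp only [symForm]
  ring

theorem symForm_smul_left (a : ℝ) (u v : SymSpace d) : symForm (a • u) v = a * symForm u v := by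
  simp only [symForm, Prod.smul_fst, Prod.smul_snd, smul_eq_mul]
  ring

theorem symForm_smul_right (a : ℝ) (u v : SymSpace d) : symForm u (a • v) = a * symForm u v := by
  simp only [symForm, Prod.smul_fst, Prod.smul_snd, smul_eq_mul]
  ring

/-- Symmetric coordinates on the topological group `G`. -/
structure IsSymCoord {G : Type*} [Group G] [TopologicalSpace G] (σ : G ≃ₜ SymSpace d) : Prop where
  map_mul : ∀ g h, σ (g * h) = symMul (σ g) (σ h)

theorem symForm_add_left (u v w : SymSpace d) :
    symForm (u + v) w = symForm u w + symForm v w := by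
  simp only [symForm, Prod.fst_add, Prod.snd_add]
  ring

theorem symForm_add_right (u v w : SymSpace d) :
    symForm u (v + w) = symForm u v + symForm u w := by
  simp only [symForm, Prod.fst_add, Prod.snd_add]
  ring

theorem symMul_mk (x y s x' y' s' : ℝ) (w w' : Fin d → ℝ) :
    symMul (x, y, s, w) (x', y', s', w') =
      (x + x', y + y', s + s' + (x * y' - y * x') / 2, w + w') := by
  simp [symMul, symForm]

theorem symMul_neg_self (u : SymSpace d) : symMul u (-u) = 0 := by
  obtain ⟨x, y, s, w⟩ := u
  change symMul _ (-x, -y, -s, -w) = (0, 0, 0, 0)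
  simp only [symMul_mk, add_neg_cancel, Prod.mk.injEq, and_true, true_and]
  ring

theorem neg_symMul_cancel_left (u v : SymSpace d) : symMul (-u) (symMul u v) = v := by
  obtain ⟨x, y, s, w⟩ := u
  obtain ⟨x', y', s', w'⟩ := v
  change symMul (-x, -y, -s, -w) _ = _
  simp only [symMul_mk, Prod.mk.injEq]
  refine ⟨by ring, by ring, by ring, by abel⟩

theorem symMul_smul_smul (u : SymSpace d) (a b : ℝ) : symMul (a • u) (b • u) = (a + b) • u := by
  obtain ⟨x, y, s, w⟩ := u
  simp only [Prod.smul_mk, symMul_mk, Prod.mk.injEq, smul_eq_mul]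
  exact ⟨by ring, by ring, by ring, (add_smul _ _ _).symm⟩

theorem symMul_commutator (u v : SymSpace d) :
    symMul (symMul u v) (symMul (-u) (-v)) = (0, 0, symForm u v, 0) := by
  obtain ⟨x, y, s, w⟩ := u
  obtain ⟨x', y', s', w'⟩ := v
  change symMul _ (symMul (-x, -y, -s, -w) (-x', -y', -s', -w')) = _
  simp only [symMul_mk, symForm, Prod.mk.injEq]
  refine ⟨by ring, by ring, by ring, by abel⟩

theorem symForm_symMul_left (u v w : SymSpace d) :
    symForm (symMul u v) w = symForm u w + symForm v w := by
  simp only [symMul, symForm, Prod.fst_add, Prod.snd_add]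
  ring

theorem symForm_symMul_right (u v w : SymSpace d) :
    symForm u (symMul v w) = symForm u v + symForm u w := by
  simp only [symMul, symForm, Prod.fst_add, Prod.snd_add]
  ring

namespace IsSymCoord

variable {G : Type*} [Group G] [TopologicalSpace G] {σ : G ≃ₜ SymSpace d}

theorem map_one (hσ : IsSymCoord σ) : σ 1 = 0 := by
  have h := hσ.map_mul 1 1
  rw [mul_one] at h
  have h2 := neg_symMul_cancel_left (σ 1) (σ 1)
  rw [← h] at h2
  rw [← h2]
  have h3 := symMul_neg_self (-σ 1)
  rwa [neg_neg] at h3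

theorem map_inv (hσ : IsSymCoord σ) (g : G) : σ g⁻¹ = -σ g := by
  have h : g * σ.symm (-σ g) = 1 := σ.injective (by
    rw [hσ.map_mul, σ.apply_symm_apply, symMul_neg_self, hσ.map_one])
  rw [← eq_inv_of_mul_eq_one_right h, σ.apply_symm_apply]

end IsSymCoord

theorem AddSubgroup.discreteTopology_of_finite_inter_closedBall {V : Type*}
    [NormedAddCommGroup V] (H : AddSubgroup V)
    (h : ((H : Set V) ∩ Metric.closedBall 0 1).Finite) : DiscreteTopology H := by
  refine discreteTopology_of_isOpen_singleton_zero (G := H) ?_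
  have h1 : IsClosed (((H : Set V) ∩ Metric.closedBall 0 1) \ {0}) := h.sdiff.isClosed
  have h2 : ({0} : Set H) = Subtype.val ⁻¹'
      (Metric.ball (0 : V) 1 ∩ (((H : Set V) ∩ Metric.closedBall 0 1) \ {0})ᶜ) := by
    ext ⟨v, hv⟩
    simp only [Set.mem_singleton_iff, Set.mem_preimage, Set.mem_inter_iff, Set.mem_compl_iff,
      Set.mem_sdiff]
    constructor
    · intro h0
      have h0 : v = 0 := congrArg Subtype.val h0
      subst h0
      simp
    · rintro ⟨h3, h4⟩
      by_contra h0
      exact h4 ⟨⟨hv, Metric.ball_subset_closedBall h3⟩, fun h5 => h0 (Subtype.ext h5)⟩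
  rw [h2]
  exact (Metric.isOpen_ball.inter h1.isOpen_compl).preimage continuous_subtype_val

/-- The properties of the image of a lattice under symmetric coordinates. -/
structure IsSymLattice (S : Set (SymSpace d)) : Prop where
  zero_mem : 0 ∈ S
  mul_mem : ∀ {u v}, u ∈ S → v ∈ S → symMul u v ∈ S
  neg_mem : ∀ {u}, u ∈ S → -u ∈ S
  finite : ∀ R, (S ∩ Metric.closedBall 0 R).Finite
  span : ∀ ℓ : SymSpace d →ₗ[ℝ] ℝ, ℓ (0, 0, 1, 0) = 0 → (∀ u ∈ S, ℓ u = 0) → ∀ u, ℓ u = 0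

theorem IsLattice.isSymLattice {G : Type*} [Group G] [TopologicalSpace G] [IsTopologicalGroup G]
    [T2Space G] {σ : G ≃ₜ SymSpace d} (hσ : IsSymCoord σ) {Γ : Subgroup G} (hΓ : IsLattice Γ) :
    IsSymLattice (σ '' (Γ : Set G)) where
  zero_mem := ⟨1, Γ.one_mem, hσ.map_one⟩
  mul_mem := by
    rintro _ _ ⟨g, hg, rfl⟩ ⟨h, hh, rfl⟩
    exact ⟨g * h, Γ.mul_mem hg hh, hσ.map_mul g h⟩
  neg_mem := by
    rintro _ ⟨g, hg, rfl⟩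
    exact ⟨g⁻¹, Γ.inv_mem hg, hσ.map_inv g⟩
  finite R := by
    have h := hΓ.finite_mem_of_isCompact
      (σ.isCompact_preimage.2 (isCompact_closedBall (0 : SymSpace d) R))
    refine (h.image σ).subset ?_
    rintro _ ⟨⟨g, hg, rfl⟩, hR⟩
    exact ⟨g, ⟨hg, hR⟩, rfl⟩
  span ℓ h0 h u := by
    -- `ℓ` ignores the twist in `symMul`, which lies in the `s` direction, so `ℓ ∘ σ` is a
    -- homomorphism to `ℝ`.
    have h1 := hΓ.eq_zero_of_forall_mem (fun g => ℓ (σ g))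
      ((LinearMap.continuous_of_finiteDimensional ℓ).comp σ.continuous) (fun g g' => by
        have h2 : ((0, 0, symForm (σ g) (σ g') / 2, 0) : SymSpace d) =
            (symForm (σ g) (σ g') / 2) • (0, 0, 1, 0) := by simp
        rw [hσ.map_mul, symMul, map_add, map_add, h2, map_smul, h0, smul_zero, add_zero])
      (fun g hg => h _ ⟨g, hg, rfl⟩) (σ.symm u)
    rwa [σ.apply_symm_apply] at h1

end SymmetricCoordinates

/-! ### Commutators in the lattice and generators modulo the center -/

section SymLattice

variable {d : ℕ} {S : Set (SymSpace d)}

namespace IsSymLattice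

theorem zsmul_mem (hS : IsSymLattice S) {u : SymSpace d} (hu : u ∈ S) (n : ℤ) :
    (n : ℝ) • u ∈ S := by
  have h : ∀ n : ℕ, (n : ℝ) • u ∈ S := by
    intro n
    induction n with
    | zero => simpa using hS.zero_mem
    | succ n ih =>
      have := hS.mul_mem ih hu
      rwa [← one_smul ℝ u, smul_smul, mul_one, symMul_smul_smul, ← Nat.cast_succ] at this
  obtain ⟨m, rfl | rfl⟩ := n.eq_nat_or_neg
  · simpa using h m
  · simpa using hS.neg_mem (h m)

/-- The elements of the lattice with trivial `x` and `y`. -/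
def centralPart (hS : IsSymLattice S) : AddSubgroup (ℝ × (Fin d → ℝ)) where
  carrier := {p | ((0, 0, p) : SymSpace d) ∈ S}
  zero_mem' := hS.zero_mem
  add_mem' := by
    rintro ⟨s, w⟩ ⟨s', w'⟩ hp hq
    have := hS.mul_mem hp hq
    simpa [symMul_mk] using this
  neg_mem' := by
    rintro ⟨s, w⟩ hp
    have := hS.neg_mem hp
    simpa using this

theorem mem_centralPart (hS : IsSymLattice S) (p : ℝ × (Fin d → ℝ)) :
    p ∈ hS.centralPart ↔ ((0, 0, p) : SymSpace d) ∈ S := Iff.rfl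

theorem symForm_mem_centralPart (hS : IsSymLattice S) {u v : SymSpace d} (hu : u ∈ S)
    (hv : v ∈ S) : (symForm u v, 0) ∈ hS.centralPart := by
  rw [mem_centralPart, ← symMul_commutator]
  exact hS.mul_mem (hS.mul_mem hu hv) (hS.mul_mem (hS.neg_mem hu) (hS.neg_mem hv))

/-- If the form vanished on `S`, then for `u ∈ S` the functional `symForm u` would kill `S` and so
be zero, forcing `u.1 = 0`. The coordinate `x` would then kill `S` as well, a second use of `span`
that is absurd. -/
theorem exists_symForm_ne_zero (hS : IsSymLattice S) : ∃ u ∈ S, ∃ v ∈ S, symForm u v ≠ 0 := by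
  by_contra! h
  have h1 : ∀ u ∈ S, u.1 = 0 := by
    intro u hu
    let ℓ : SymSpace d →ₗ[ℝ] ℝ :=
      { toFun := fun v => symForm u v
        map_add' := fun v w => symForm_add_right u v w
        map_smul' := fun a v => symForm_smul_right a u v }
    have h2 := hS.span ℓ (by simp [ℓ, symForm]) (fun v hv => h u hu v hv) (0, 1, 0, 0)
    simpa [ℓ, symForm] using h2
  have h3 := hS.span (LinearMap.fst ℝ ℝ (ℝ × ℝ × (Fin d → ℝ))) rfl h1 (1, 0, 0, 0)
  exact one_ne_zero h3

theorem exists_zmultiples (hS : IsSymLattice S) :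
    ∃ ζ : ℝ, ∀ c : ℝ, (c, (0 : Fin d → ℝ)) ∈ hS.centralPart ↔ ∃ m : ℤ, c = m * ζ := by
  let Z : AddSubgroup ℝ := hS.centralPart.comap (AddMonoidHom.inl ℝ (Fin d → ℝ))
  have hZ : ∀ c, c ∈ Z ↔ (c, (0 : Fin d → ℝ)) ∈ hS.centralPart := fun c => Iff.rfl
  have hdisc : DiscreteTopology Z := by
    refine Z.discreteTopology_of_finite_inter_closedBall ?_
    refine ((hS.finite 1).image fun u => u.2.2.1).subset ?_
    rintro c ⟨hc, hc1⟩
    refine ⟨(0, 0, c, 0), ⟨hc, ?_⟩, rfl⟩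
    rw [mem_closedBall_zero_iff] at hc1 ⊢
    simpa [Prod.norm_def] using hc1
  obtain ⟨ζ, hζ⟩ := (AddSubgroup.isAddCyclic_iff_exists_zmultiples_eq_top Z).1
    (AddSubgroup.discrete_iff_addCyclic.2 hdisc)
  refine ⟨ζ, fun c => ?_⟩
  rw [← hZ, ← hζ, AddSubgroup.mem_zmultiples_iff]
  simp only [zsmul_eq_mul, eq_comm]

/-- A pair of elements of the lattice whose commutator is minimal generates the lattice modulo the
center. -/
theorem exists_generators (hS : IsSymLattice S) : ∃ γ₁ ∈ S, ∃ γ₂ ∈ S, ∃ k : ℕ, 0 < k ∧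
    symForm γ₁ γ₂ ≠ 0 ∧
    (∀ c : ℝ, (c, (0 : Fin d → ℝ)) ∈ hS.centralPart ↔ ∃ m : ℤ, c = m / k * symForm γ₁ γ₂) ∧
    ∀ γ ∈ S, (∃ a : ℤ, symForm γ γ₂ = a * symForm γ₁ γ₂) ∧
      ∃ b : ℤ, symForm γ₁ γ = b * symForm γ₁ γ₂ := by
  classical
  obtain ⟨ζ, hζ⟩ := hS.exists_zmultiples
  have hform : ∀ u ∈ S, ∀ v ∈ S, ∃ m : ℤ, symForm u v = m * ζ := fun u hu v hv =>
    (hζ _).1 (hS.symForm_mem_centralPart hu hv)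
  -- Commutators are integer multiples of `ζ`. The least positive multiple that occurs, up to sign,
  -- is the `k` of the conclusion, so that `ζ = ± symForm γ₁ γ₂ / k`.
  have hex : ∃ n : ℕ, 0 < n ∧ ∃ u ∈ S, ∃ v ∈ S, |symForm u v| = n * |ζ| := by
    obtain ⟨u, hu, v, hv, h⟩ := hS.exists_symForm_ne_zero
    obtain ⟨m, hm⟩ := hform u hu v hv
    refine ⟨m.natAbs, Int.natAbs_pos.2 fun h0 => h (by simp [hm, h0]), u, hu, v, hv, ?_⟩
    rw [hm, abs_mul, Nat.cast_natAbs, Int.cast_abs]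
  have hζ0 : ζ ≠ 0 := by
    obtain ⟨u, hu, v, hv, h⟩ := hS.exists_symForm_ne_zero
    obtain ⟨m, hm⟩ := hform u hu v hv
    rintro rfl
    exact h (by simp [hm])
  obtain ⟨hk, γ₁, h₁, γ₂, h₂, hω⟩ := Nat.find_spec hex
  have hmin := fun m (hm : m < Nat.find hex) => Nat.find_min hex hm
  generalize Nat.find hex = k at *
  have hk' : (0 : ℝ) < k := Nat.cast_pos.2 hk
  have hω0 : symForm γ₁ γ₂ ≠ 0 := by
    rw [← abs_pos, hω]
    exact mul_pos hk' (abs_pos.2 hζ0)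
  have hsmall : ∀ u ∈ S, ∀ v ∈ S, |symForm u v| < |symForm γ₁ γ₂| → symForm u v = 0 := by
    intro u hu v hv h
    obtain ⟨m, hm⟩ := hform u hu v hv
    by_contra h0
    have hm0 : m ≠ 0 := fun h1 => h0 (by simp [hm, h1])
    have h2 : |symForm u v| = m.natAbs * |ζ| := by
      rw [hm, abs_mul, Nat.cast_natAbs, Int.cast_abs]
    refine hmin m.natAbs ?_ ⟨Int.natAbs_pos.2 hm0, u, hu, v, hv, h2⟩
    rw [h2, hω] at h
    exact Nat.cast_lt.1 (lt_of_mul_lt_mul_right h (abs_nonneg ζ))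
  have hfract : ∀ r : ℝ, Int.fract r * symForm γ₁ γ₂ = 0 → r = ⌊r⌋ := by
    intro r hr
    have := (mul_eq_zero.1 hr).resolve_right hω0
    rw [← Int.self_sub_floor] at this
    linarith
  have hlt : ∀ r : ℝ, |Int.fract r * symForm γ₁ γ₂| < |symForm γ₁ γ₂| := by
    intro r
    rw [abs_mul, abs_of_nonneg (Int.fract_nonneg r)]
    exact mul_lt_of_lt_one_left (abs_pos.2 hω0) (Int.fract_lt_one r)
  refine ⟨γ₁, h₁, γ₂, h₂, k, hk, hω0, fun c => ?_, fun γ hγ => ⟨?_, ?_⟩⟩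
  · rw [hζ]
    rcases abs_eq_abs.1 (hω.trans (by rw [abs_mul, Nat.abs_cast] : (k : ℝ) * |ζ| = |k * ζ|))
      with h | h
    · refine exists_congr fun m => ?_
      rw [h, ← mul_assoc, div_mul_cancel₀ _ hk'.ne']
    · constructor
      · rintro ⟨m, rfl⟩
        refine ⟨-m, ?_⟩
        rw [h, Int.cast_neg]
        field_simp
      · rintro ⟨m, rfl⟩
        refine ⟨-m, ?_⟩
        rw [h, Int.cast_neg]
        field_simp
  · set r := symForm γ γ₂ / symForm γ₁ γ₂ with hr
    have hr' : symForm γ γ₂ = r * symForm γ₁ γ₂ := (div_mul_cancel₀ _ hω0).symm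
    -- Division with remainder: removing `⌊r⌋` copies of `γ₁` leaves a commutator smaller than the
    -- minimum, hence zero, so `r` is an integer.
    have h3 : symForm (symMul (((-⌊r⌋ : ℤ) : ℝ) • γ₁) γ) γ₂ = Int.fract r * symForm γ₁ γ₂ := by
      rw [symForm_symMul_left, symForm_smul_left, hr', ← Int.self_sub_floor, Int.cast_neg]
      ring
    have h4 := hsmall _ (hS.mul_mem (hS.zsmul_mem h₁ (-⌊r⌋)) hγ) γ₂ h₂ (h3 ▸ hlt r)
    exact ⟨⌊r⌋, by rw [← hfract r (h3 ▸ h4), hr']⟩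
  · set r := symForm γ₁ γ / symForm γ₁ γ₂ with hr
    have hr' : symForm γ₁ γ = r * symForm γ₁ γ₂ := (div_mul_cancel₀ _ hω0).symm
    have h3 : symForm γ₁ (symMul (((-⌊r⌋ : ℤ) : ℝ) • γ₂) γ) = Int.fract r * symForm γ₁ γ₂ := by
      rw [symForm_symMul_right, symForm_smul_right, hr', ← Int.self_sub_floor, Int.cast_neg]
      ring
    have h4 := hsmall γ₁ h₁ _ (hS.mul_mem (hS.zsmul_mem h₂ (-⌊r⌋)) hγ) (h3 ▸ hlt r)
    exact ⟨⌊r⌋, by rw [← hfract r (h3 ▸ h4), hr']⟩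

end IsSymLattice

end SymLattice

/-! ### Normal form of a lattice under automorphisms -/

section SymLatticeNormalForm

variable {d : ℕ} {S : Set (SymSpace d)}

namespace IsSymLattice

/-- The projection of the central part of the lattice. -/
def centralProj (hS : IsSymLattice S) : AddSubgroup (Fin d → ℝ) :=
  hS.centralPart.map (AddMonoidHom.snd ℝ (Fin d → ℝ))

theorem mem_centralProj (hS : IsSymLattice S) (w : Fin d → ℝ) :
    w ∈ hS.centralProj ↔ ∃ s : ℝ, (s, w) ∈ hS.centralPart := by
  constructor
  · rintro ⟨⟨s, w⟩, h, rfl⟩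
    exact ⟨s, h⟩
  · rintro ⟨s, h⟩
    exact ⟨(s, w), h, rfl⟩

/-- Multiplying a lift by a power of the central element `(c, 0)` brings its `s` coordinate into a
bounded range. A bounded part of the projection is therefore covered by a bounded, hence finite,
part of `S`. -/
theorem discreteTopology_centralProj (hS : IsSymLattice S) {c : ℝ} (hc : c ≠ 0)
    (hmem : (c, (0 : Fin d → ℝ)) ∈ hS.centralPart) : DiscreteTopology hS.centralProj := by
  refine AddSubgroup.discreteTopology_of_finite_inter_closedBall _ ?_
  refine ((hS.finite (max 1 |c|)).image fun u => u.2.2.2).subset ?_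
  rintro w ⟨hw, hw1⟩
  obtain ⟨s, hs⟩ := (hS.mem_centralProj w).1 hw
  have h1 : (Int.fract (s / c) * c, w) ∈ hS.centralPart := by
    have h2 := hS.centralPart.sub_mem hs (hS.centralPart.zsmul_mem hmem ⌊s / c⌋)
    have h3 : (s, w) - ⌊s / c⌋ • (c, (0 : Fin d → ℝ)) = (Int.fract (s / c) * c, w) := by
      rw [← Int.self_sub_floor, sub_mul, div_mul_cancel₀ _ hc]
      simp
    rwa [h3] at h2
  refine ⟨(0, 0, Int.fract (s / c) * c, w), ⟨h1, ?_⟩, rfl⟩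
  rw [mem_closedBall_zero_iff] at hw1 ⊢
  have h4 : |Int.fract (s / c) * c| ≤ |c| := by
    rw [abs_mul, abs_of_nonneg (Int.fract_nonneg _)]
    exact mul_le_of_le_one_left (abs_nonneg c) (Int.fract_lt_one _).le
  simp only [Prod.norm_def, norm_zero, Real.norm_eq_abs]
  refine max_le (by positivity) (max_le (by positivity) (max_le ?_ ?_))
  · exact h4.trans (le_max_right _ _)
  · exact hw1.trans (le_max_left _ _)

/-- The coordinates of a vector with respect to two vectors with nonzero commutator. -/
theorem coord_eq {γ₁ γ₂ u : SymSpace d} (hω : symForm γ₁ γ₂ ≠ 0) {a b : ℝ}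
    (ha : symForm u γ₂ = a * symForm γ₁ γ₂) (hb : symForm γ₁ u = b * symForm γ₁ γ₂) :
    u.1 = a * γ₁.1 + b * γ₂.1 ∧ u.2.1 = a * γ₁.2.1 + b * γ₂.2.1 := by
  constructor <;> apply mul_right_cancel₀ hω <;> simp only [symForm] at *
  · linear_combination γ₁.1 * ha + γ₂.1 * hb
  · linear_combination γ₁.2.1 * ha + γ₂.2.1 * hb

/-- By `coord_eq`, `γ` and the word `γ₂^b γ₁^a` have the same `x` and `y`, so their quotient lies in
the central part. -/
theorem exists_centralPart_of_symForm (hS : IsSymLattice S) {γ₁ γ₂ γ : SymSpace d}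
    (h₁ : γ₁ ∈ S) (h₂ : γ₂ ∈ S) (hγ : γ ∈ S) (hω : symForm γ₁ γ₂ ≠ 0) {a b : ℤ}
    (ha : symForm γ γ₂ = a * symForm γ₁ γ₂) (hb : symForm γ₁ γ = b * symForm γ₁ γ₂) :
    ∃ p ∈ hS.centralPart, γ = symMul (symMul ((b : ℝ) • γ₂) ((a : ℝ) • γ₁)) (0, 0, p) := by
  set q := symMul ((b : ℝ) • γ₂) ((a : ℝ) • γ₁) with hq
  have hqS : q ∈ S := hS.mul_mem (hS.zsmul_mem h₂ b) (hS.zsmul_mem h₁ a)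
  have h3 := hS.mul_mem (hS.neg_mem hqS) hγ
  obtain ⟨hx, hy⟩ := coord_eq hω ha hb
  have h4 : symMul (-q) γ = (0, 0, (symMul (-q) γ).2.2) := by
    refine Prod.ext ?_ (Prod.ext ?_ rfl)
    · simp only [hq, symMul, Prod.fst_add, Prod.fst_neg, Prod.smul_fst, smul_eq_mul, hx]
      ring
    · simp only [hq, symMul, Prod.fst_add, Prod.snd_add, Prod.snd_neg, Prod.smul_snd, Prod.fst_neg,
        Prod.smul_fst, smul_eq_mul, hy]
      ring
  refine ⟨(symMul (-q) γ).2.2, by rw [mem_centralPart, ← h4]; exact h3, ?_⟩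
  rw [← h4]
  have := neg_symMul_cancel_left (-q) γ
  rw [neg_neg] at this
  exact this.symm

theorem span_centralProj (hS : IsSymLattice S) {γ₁ γ₂ : SymSpace d}
    (h₁ : γ₁ ∈ S) (h₂ : γ₂ ∈ S) (hω : symForm γ₁ γ₂ ≠ 0)
    (hgen : ∀ γ ∈ S, (∃ a : ℤ, symForm γ γ₂ = a * symForm γ₁ γ₂) ∧
      ∃ b : ℤ, symForm γ₁ γ = b * symForm γ₁ γ₂) :
    Submodule.span ℝ (hS.centralProj : Set (Fin d → ℝ)) = ⊤ := by
  by_contra hne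
  obtain ⟨ℓ, hℓ0, hℓ⟩ := Submodule.exists_le_ker_of_lt_top _ (lt_top_iff_ne_top.2 hne)
  apply hℓ0
  let pr : SymSpace d →ₗ[ℝ] (Fin d → ℝ) :=
    LinearMap.snd ℝ ℝ _ ∘ₗ LinearMap.snd ℝ ℝ _ ∘ₗ LinearMap.snd ℝ ℝ _
  -- For a functional `ℓ` that kills the projection, this is `ℓ` of the `w` component minus the
  -- contributions of `γ₁` and `γ₂`, scaled by `symForm γ₁ γ₂` to avoid division. It kills `S`,
  -- hence everything, and evaluation on the `w` directions gives `ℓ = 0`.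
  let f : SymSpace d →ₗ[ℝ] ℝ :=
    { toFun := fun u => symForm γ₁ γ₂ * ℓ u.2.2.2 - symForm u γ₂ * ℓ γ₁.2.2.2 -
        symForm γ₁ u * ℓ γ₂.2.2.2
      map_add' := fun u v => by
        simp only [symForm_add_left, symForm_add_right, Prod.snd_add, map_add]
        ring
      map_smul' := fun a u => by
        simp only [symForm_smul_left, symForm_smul_right, Prod.smul_snd, map_smul, smul_eq_mul,
          RingHom.id_apply]
        ring }
  have hf : ∀ u, f u = symForm γ₁ γ₂ * ℓ u.2.2.2 - symForm u γ₂ * ℓ γ₁.2.2.2 -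
        symForm γ₁ u * ℓ γ₂.2.2.2 := fun _ => rfl
  have h3 := hS.span f (by simp [hf, symForm]) fun γ hγ => by
    obtain ⟨⟨a, ha⟩, b, hb⟩ := hgen γ hγ
    obtain ⟨⟨s, w⟩, hp, hγp⟩ := hS.exists_centralPart_of_symForm h₁ h₂ hγ hω ha hb
    have h4 : ℓ w = 0 := hℓ (Submodule.subset_span ((hS.mem_centralProj w).2 ⟨s, hp⟩))
    have h5 : γ.2.2.2 = (b : ℝ) • γ₂.2.2.2 + (a : ℝ) • γ₁.2.2.2 + w := by
      rw [hγp]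
      simp [symMul]
    rw [hf, ha, hb, h5, map_add, map_add, map_smul, map_smul, h4]
    simp only [smul_eq_mul]
    ring
  refine LinearMap.pi_ext' fun i => LinearMap.ext_ring ?_
  have h6 := h3 (0, 0, 0, Pi.single i 1)
  rw [hf] at h6
  have h7 : symForm ((0, 0, 0, Pi.single i 1) : SymSpace d) γ₂ = 0 := by simp [symForm]
  have h8 : symForm γ₁ ((0, 0, 0, Pi.single i 1) : SymSpace d) = 0 := by simp [symForm]
  rw [h7, h8, zero_mul, zero_mul, sub_zero, sub_zero] at h6
  exact (mul_eq_zero.1 h6).resolve_left hω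

theorem exists_normalForm (hS : IsSymLattice S) : ∃ k : ℕ, 0 < k ∧
    ∃ T : SymSpace d ≃ₗ[ℝ] SymSpace d, (∀ u v, T (symMul u v) = symMul (T u) (T v)) ∧
    ∀ u, T u ∈ S ↔ ∃ a b c : ℤ, ∃ n : Fin d → ℤ,
      u = ((a : ℝ), (b : ℝ), (c : ℝ) / k - a * b / 2, fun i => (n i : ℝ)) := by
  obtain ⟨γ₁, h₁, γ₂, h₂, k, hk, hω, hZ, hgen⟩ := hS.exists_generators
  have hk' : (k : ℝ) ≠ 0 := Nat.cast_ne_zero.2 hk.ne'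
  have hdisc := hS.discreteTopology_centralProj hω (hS.symForm_mem_centralPart h₁ h₂)
  let K : Submodule ℤ (Fin d → ℝ) := AddSubgroup.toIntSubmodule hS.centralProj
  have hKmem : ∀ w, w ∈ K ↔ ∃ s : ℝ, (s, w) ∈ hS.centralPart := hS.mem_centralProj
  have hKdisc : DiscreteTopology K := hdisc
  have hKlat : IsZLattice ℝ K := ⟨hS.span_centralProj h₁ h₂ hω hgen⟩
  have hfin : Module.Finite ℤ K := ZLattice.module_finite ℝ K
  have hfree : Module.Free ℤ K := ZLattice.module_free ℝ K
  have hrank : Module.finrank ℤ K = d := by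
    rw [ZLattice.rank ℝ K, Module.finrank_fin_fun]
  let b := Module.finBasisOfFinrankEq ℤ K hrank
  let B := b.ofZLatticeBasis ℝ K
  have hB : ∀ i, B i = b i := fun i => b.ofZLatticeBasis_apply ℝ K i
  choose s hs using fun i => (hKmem (B i)).1 (by rw [hB]; exact (b i).2)
  -- The images of the coordinate vectors are `γ₁`, `γ₂`, their commutator, and central lattice
  -- elements over a basis of the projected central part.
  let T₀ : SymSpace d →ₗ[ℝ] SymSpace d :=
    (LinearMap.toSpanSingleton ℝ _ γ₁).coprod ((LinearMap.toSpanSingleton ℝ _ γ₂).coprod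
      ((LinearMap.toSpanSingleton ℝ _ (0, 0, symForm γ₁ γ₂, 0)).coprod
        (Fintype.linearCombination ℝ fun i => ((0, 0, s i, B i) : SymSpace d))))
  have hsum : ∀ w : Fin d → ℝ, ∑ i, w i • ((0, 0, s i, B i) : SymSpace d) =
      (0, 0, ∑ i, w i • (s i, B i)) := fun w => by
    simp [Prod.ext_iff, Prod.fst_sum, Prod.snd_sum]
  have hT₀ : ∀ x y z w, T₀ (x, y, z, w) =
      x • γ₁ + y • γ₂ + (0, 0, (z * symForm γ₁ γ₂, 0) + ∑ i, w i • (s i, B i)) := by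
    intro x y z w
    have : T₀ (x, y, z, w) = x • γ₁ + (y • γ₂ + (z • ((0, 0, symForm γ₁ γ₂, 0) : SymSpace d) +
        ∑ i, w i • ((0, 0, s i, B i) : SymSpace d))) := by
      simp [T₀, Fintype.linearCombination_apply]
    rw [this, hsum, ← add_assoc]
    simp
  have hsum2 : ∀ w : Fin d → ℝ, (∑ i, w i • (s i, B i)).2 = ∑ i, w i • B i := fun w => by
    simp [Prod.snd_sum]
  have hform₁ : ∀ u, symForm (T₀ u) γ₂ = u.1 * symForm γ₁ γ₂ := by
    rintro ⟨x, y, z, w⟩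
    rw [hT₀, symForm_add_left, symForm_add_left, symForm_smul_left, symForm_smul_left,
      symForm_self]
    simp [symForm]
  have hform₂ : ∀ u, symForm γ₁ (T₀ u) = u.2.1 * symForm γ₁ γ₂ := by
    rintro ⟨x, y, z, w⟩
    rw [hT₀, symForm_add_right, symForm_add_right, symForm_smul_right, symForm_smul_right,
      symForm_self]
    simp [symForm]
  -- The form is multiplied by the same factor as the `s` direction, which makes `T₀` a homomorphism
  -- for `symMul`.
  have hform : ∀ u v, symForm (T₀ u) (T₀ v) = symForm u v * symForm γ₁ γ₂ := by
    intro u v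
    obtain ⟨hx, hy⟩ := coord_eq hω (hform₁ u) (hform₂ u)
    obtain ⟨hx', hy'⟩ := coord_eq hω (hform₁ v) (hform₂ v)
    simp only [symForm, hx, hy, hx', hy']
    ring
  have hinj : Function.Injective T₀ := by
    refine (injective_iff_map_eq_zero T₀).2 ?_
    rintro ⟨x, y, z, w⟩ h
    have hx : x = 0 := by
      have := hform₁ (x, y, z, w)
      rw [h] at this
      exact (mul_eq_zero.1 (this.symm.trans (by simp [symForm]))).resolve_right hω
    have hy : y = 0 := by
      have := hform₂ (x, y, z, w)
      rw [h] at this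
      exact (mul_eq_zero.1 (this.symm.trans (by simp [symForm]))).resolve_right hω
    subst hx hy
    rw [hT₀, zero_smul, zero_smul, zero_add, zero_add] at h
    have h' : (z * symForm γ₁ γ₂, 0) + ∑ i, w i • (s i, B i) = 0 :=
      congrArg (fun u : SymSpace d => u.2.2) h
    have hw : w = 0 := by
      have h2 := congrArg Prod.snd h'
      rw [Prod.snd_add, zero_add, hsum2] at h2
      exact funext fun i => (Fintype.linearIndependent_iff.1 B.linearIndependent) w h2 i
    subst hw
    have hz : z = 0 := by
      have h2 := congrArg Prod.fst h'
      simpa [hω] using h2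
    rw [hz]
    rfl
  let T := LinearEquiv.ofInjectiveEndo T₀ hinj
  have hT : ∀ u, T u = T₀ u := fun _ => rfl
  -- The sum `x • γ₁ + y • γ₂` differs from the word `γ₂^y γ₁^x` by half a commutator. This is the
  -- origin of the term `- a * b / 2` in the normal form.
  have hTfac : ∀ x y z w, T₀ (x, y, z, w) = symMul (symMul (y • γ₂) (x • γ₁))
      (0, 0, ((z + x * y / 2) * symForm γ₁ γ₂, 0) + ∑ i, w i • (s i, B i)) := by
    intro x y z w
    rw [hT₀]
    generalize ∑ i, w i • (s i, B i) = p
    obtain ⟨p, q⟩ := p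
    obtain ⟨x₁, y₁, s₁, w₁⟩ := γ₁
    obtain ⟨x₂, y₂, s₂, w₂⟩ := γ₂
    simp only [Prod.smul_mk, Prod.mk_add_mk, symMul_mk, symForm, smul_eq_mul, Prod.mk.injEq]
    exact ⟨by ring, by ring, by ring, by abel⟩
  have hnS : ∀ n : Fin d → ℤ, ∑ i, (n i : ℝ) • (s i, B i) ∈ hS.centralPart := fun n => by
    refine hS.centralPart.sum_mem fun i _ => ?_
    rw [Int.cast_smul_eq_zsmul]
    exact hS.centralPart.zsmul_mem (hs i) _
  refine ⟨k, hk, T, fun u v => ?_, fun u => ⟨fun hu => ?_, ?_⟩⟩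
  · rw [hT, hT, hT, symMul, symMul, map_add, map_add, hform]
    congr 1
    rw [hT₀]
    simp only [zero_smul, zero_add, Pi.zero_apply, Finset.sum_const_zero, add_zero]
    rw [mul_div_right_comm]
  · obtain ⟨x, y, z, w⟩ := u
    obtain ⟨⟨a, ha⟩, b', hb⟩ := hgen _ hu
    have hx : x = a := by
      have := hform₁ (x, y, z, w)
      rw [← hT, ha] at this
      exact (mul_right_cancel₀ hω this).symm
    have hy : y = b' := by
      have := hform₂ (x, y, z, w)
      rw [← hT, hb] at this
      exact (mul_right_cancel₀ hω this).symm
    obtain ⟨p, hp, hpe⟩ := hS.exists_centralPart_of_symForm h₁ h₂ hu hω ha hb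
    rw [hT, hTfac, hx, hy] at hpe
    have hpe' := congrArg (symMul (-symMul ((b' : ℝ) • γ₂) ((a : ℝ) • γ₁))) hpe
    rw [neg_symMul_cancel_left, neg_symMul_cancel_left] at hpe'
    have hp' : ((z + a * b' / 2) * symForm γ₁ γ₂, 0) + ∑ i, w i • (s i, B i) = p :=
      congrArg (fun u : SymSpace d => u.2.2) hpe'
    have hp2 : p.2 = ∑ i, w i • B i := by rw [← hp', Prod.snd_add, zero_add, hsum2]
    have hwK : ∑ i, w i • B i ∈ K := (hKmem _).2 ⟨p.1, hp2 ▸ hp⟩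
    rw [← hp'] at hp
    -- The `w i` are the coordinates of an element of the `ℤ`-lattice `K` in a `ℤ`-basis. Once the
    -- integral combination of the lifts is removed, what is left lies in the commutator direction,
    -- where `hZ` applies.
    obtain ⟨n, hn⟩ : ∃ n : Fin d → ℤ, ∀ i, w i = n i := by
      refine ⟨fun i => b.repr ⟨_, hwK⟩ i, fun i => ?_⟩
      rw [← b.ofZLatticeBasis_repr_apply ℝ K ⟨_, hwK⟩ i]
      change w i = B.repr (∑ i, w i • B i) i
      rw [B.repr_sum_self]
    have hnS' := hnS n
    simp only [← hn] at hnS'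
    have hz := hS.centralPart.sub_mem hp hnS'
    rw [add_sub_cancel_right, hZ] at hz
    obtain ⟨c, hc⟩ := hz
    refine ⟨a, b', c, n, ?_⟩
    rw [hx, hy, ← mul_right_cancel₀ hω hc, add_sub_cancel_right, ← funext hn]
  · rintro ⟨a, b', c, n, rfl⟩
    rw [hT, hTfac]
    refine hS.mul_mem (hS.mul_mem (hS.zsmul_mem h₂ b') (hS.zsmul_mem h₁ a)) ?_
    refine (hS.mem_centralPart _).1 (hS.centralPart.add_mem ?_ (hnS n))
    rw [hZ]
    exact ⟨c, by rw [sub_add_cancel]⟩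

end IsSymLattice

end SymLatticeNormalForm

/-! ### Midpoint blockable pairs are blockable -/

section MidpointBlocking

variable {G : Type*} [Group G] [TopologicalSpace G] [IsTopologicalGroup G] {Γ : Subgroup G}

theorem QuotientGroup.t1Space_of_isClosed (hΓ : IsClosed (Γ : Set G)) : T1Space (G ⧸ Γ) := by
  refine ⟨fun m => ?_⟩
  obtain ⟨g, rfl⟩ := QuotientGroup.mk_surjective m
  rw [← QuotientGroup.isOpenQuotientMap_mk.isQuotientMap.isClosed_preimage]
  have : (QuotientGroup.mk : G → G ⧸ Γ) ⁻¹' {QuotientGroup.mk g} = (fun h => g⁻¹ * h) ⁻¹' Γ := by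
    ext h
    simp only [Set.mem_preimage, Set.mem_singleton_iff, SetLike.mem_coe]
    rw [eq_comm, QuotientGroup.eq]
  rw [this]
  exact hΓ.preimage (continuous_const_mul _)

/-- A midpoint may coincide with an endpoint. Halving the time repeatedly, the last `s = 2⁻ⁿ` with
`c s = m₂` yields an initial piece of `c` that is again a connecting curve and whose midpoint avoids
both endpoints. -/
theorem exists_midpoint_of_mem_connectingCurves [T1Space (G ⧸ Γ)] {m₁ m₂ : G ⧸ Γ}
    {c : ℝ → G ⧸ Γ} (hc : c ∈ connectingCurves m₁ m₂) :
    ∃ s ∈ Set.Icc (0 : ℝ) 1, (fun t => c (s * t)) ∈ connectingCurves m₁ m₂ ∧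
      c (s / 2) ≠ m₁ ∧ c (s / 2) ≠ m₂ := by
  obtain ⟨⟨φ, hφ⟩, hc0, hc1, t₀, ht₀, hne⟩ := hc
  have hadd : ∀ s t, c (s + t) = φ (Multiplicative.ofAdd s) • c t := by
    intro s t
    rw [hφ, hφ, ofAdd_add, map_mul, mul_smul]
  have hcont : Continuous c := by
    have h1 : Continuous fun t : ℝ => φ (Multiplicative.ofAdd t) • m₁ :=
      (φ.continuous_toFun.comp continuous_ofAdd).smul continuous_const
    exact h1.congr fun t => (hφ t).symm
  -- If `c (2⁻ⁿ) = m₂` for all `n`, then `m₁ = m₂` by continuity, and the times at which `c` is at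
  -- `m₁` form a closed subgroup with arbitrarily small positive elements. That subgroup is all of
  -- `ℝ`, against nonconstancy.
  obtain ⟨n, hn, hn'⟩ : ∃ n : ℕ, c ((1 / 2) ^ n) = m₂ ∧ c ((1 / 2) ^ (n + 1)) ≠ m₂ := by
    by_contra! h
    have hall : ∀ n : ℕ, c ((1 / 2) ^ n) = m₂ := by
      intro n
      induction n with
      | zero => simpa using hc1
      | succ n ih => exact h n ih
    have hlim : Filter.Tendsto (fun n : ℕ => ((1 : ℝ) / 2) ^ n) Filter.atTop (𝓝 0) :=
      tendsto_pow_atTop_nhds_zero_of_lt_one (by norm_num) (by norm_num)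
    have h12 : m₁ = m₂ := by
      rw [← hc0]
      exact (isClosed_singleton.preimage hcont).mem_of_tendsto hlim
        (Filter.Eventually.of_forall hall)
    let A : AddSubgroup ℝ :=
      { carrier := {t | c t = m₁}
        zero_mem' := hc0
        add_mem' := fun {s t} hs ht => by
          simp only [Set.mem_ofPred_eq] at hs ht ⊢
          rw [hadd, ht, ← hφ, hs]
        neg_mem' := fun {t} ht => by
          simp only [Set.mem_ofPred_eq] at ht ⊢
          have h1 := hadd (-t) t
          rw [neg_add_cancel, hc0, ht, ← hφ] at h1
          exact h1.symm }
    have hA : ∀ t, t ∈ A ↔ c t = m₁ := fun t => Iff.rfl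
    have hdense : Dense (A : Set ℝ) := by
      refine A.dense_of_not_isolated_zero fun ε hε => ?_
      obtain ⟨n, hn⟩ := exists_pow_lt_of_lt_one hε (show (1 : ℝ) / 2 < 1 by norm_num)
      exact ⟨_, (hA _).2 ((hall n).trans h12.symm), by positivity, hn⟩
    have hclosed : IsClosed (A : Set ℝ) := isClosed_singleton.preimage hcont
    have h1 : t₀ ∈ (A : Set ℝ) := by
      rw [← hclosed.closure_eq, hdense.closure_eq]
      trivial
    exact hne h1
  have hhalf : (1 / 2 : ℝ) ^ (n + 1) = (1 / 2) ^ n / 2 := by ring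
  -- If the first half of the piece returned to `m₁`, so would the second, and `m₂ = m₁ = c (s /
  -- 2)`, contrary to the choice of `n`.
  have hm₁ : c ((1 / 2) ^ n / 2) ≠ m₁ := by
    intro h
    have h1 := hadd ((1 / 2) ^ n / 2) ((1 / 2) ^ n / 2)
    rw [add_halves, h, ← hφ, h, hn] at h1
    rw [hhalf, h] at hn'
    exact hn' h1.symm
  have hle : (1 / 2 : ℝ) ^ n ≤ 1 := pow_le_one₀ (by norm_num) (by norm_num)
  refine ⟨(1 / 2) ^ n, ⟨by positivity, hle⟩, ⟨⟨⟨(φ : Multiplicative ℝ →* G).comp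
    (AddMonoidHom.toMultiplicative (AddMonoidHom.mulLeft ((1 / 2 : ℝ) ^ n))), ?_⟩,
    fun t => hφ _⟩, by simpa using hc0, by simpa using hn, 1 / 2, by norm_num, ?_⟩, hm₁,
    hhalf ▸ hn'⟩
  · exact φ.continuous_toFun.comp (continuous_ofAdd.comp
      ((continuous_const_mul _).comp continuous_toAdd))
  · simpa only [mul_one_div] using hm₁

theorem MidpointBlockable.blockable [T1Space (G ⧸ Γ)] {m₁ m₂ : G ⧸ Γ}
    (h : MidpointBlockable m₁ m₂) : Blockable m₁ m₂ := by
  refine ⟨{m | ∃ c ∈ connectingCurves m₁ m₂, m = c (1 / 2)} \ {m₁, m₂}, h.sdiff,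
    fun m hm => hm.2, fun c hc => ?_⟩
  obtain ⟨s, ⟨hs0, hs1⟩, hsc, h1, h2⟩ := exists_midpoint_of_mem_connectingCurves hc
  refine ⟨c (s / 2), ⟨s / 2, ⟨by linarith, by linarith⟩, rfl⟩,
    ⟨_, hsc, by rw [mul_one_div]⟩, ?_⟩
  simp [h1, h2]

end MidpointBlocking

/-! ### Connecting curves in symmetric coordinates -/

section Curves

variable {d : ℕ} {G : Type*} [Group G] [TopologicalSpace G] {σ : G ≃ₜ SymSpace d}

theorem IsSymCoord.oneParameter (hσ : IsSymCoord σ) (φ : Multiplicative ℝ →ₜ* G) (t : ℝ) :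
    σ (φ (Multiplicative.ofAdd t)) = t • σ (φ (Multiplicative.ofAdd 1)) := by
  have hcont : Continuous fun t : ℝ => σ (φ (Multiplicative.ofAdd t)) :=
    σ.continuous.comp (φ.continuous_toFun.comp continuous_ofAdd)
  have hmul : ∀ s t : ℝ, σ (φ (Multiplicative.ofAdd (s + t))) =
      symMul (σ (φ (Multiplicative.ofAdd s))) (σ (φ (Multiplicative.ofAdd t))) := by
    intro s t
    rw [ofAdd_add, _root_.map_mul, hσ.map_mul]
  have hx : ∀ t : ℝ, (σ (φ (Multiplicative.ofAdd t))).1 =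
      t * (σ (φ (Multiplicative.ofAdd 1))).1 := by
    intro t
    have := map_real_smul (AddMonoidHom.mk' (fun t : ℝ => (σ (φ (Multiplicative.ofAdd t))).1)
      fun s t => by rw [hmul]; simp [symMul]) (continuous_fst.comp hcont) t 1
    simpa using this
  have hy : ∀ t : ℝ, (σ (φ (Multiplicative.ofAdd t))).2.1 =
      t * (σ (φ (Multiplicative.ofAdd 1))).2.1 := by
    intro t
    have := map_real_smul (AddMonoidHom.mk' (fun t : ℝ => (σ (φ (Multiplicative.ofAdd t))).2.1)
      fun s t => by rw [hmul]; simp [symMul]) (continuous_fst.comp (continuous_snd.comp hcont)) t 1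
    simpa using this
  -- As `x` and `y` are linear in `t`, the twist vanishes along the subgroup; `σ ∘ φ` is then
  -- additive and continuous, hence linear.
  have hform : ∀ s t : ℝ, symForm (σ (φ (Multiplicative.ofAdd s)))
      (σ (φ (Multiplicative.ofAdd t))) = 0 := by
    intro s t
    rw [symForm, hx s, hx t, hy s, hy t]
    ring
  have := map_real_smul (AddMonoidHom.mk' (fun t : ℝ => σ (φ (Multiplicative.ofAdd t)))
    fun s t => by
      rw [hmul, symMul, hform, zero_div]
      exact add_zero _) hcont t 1
  simpa using this

/-- The one-parameter subgroup with a given initial velocity in symmetric coordinates. -/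
noncomputable def IsSymCoord.line (hσ : IsSymCoord σ) (v : SymSpace d) :
    Multiplicative ℝ →ₜ* G where
  toFun t := σ.symm (t.toAdd • v)
  map_one' := by
    rw [toAdd_one, zero_smul, ← hσ.map_one, σ.symm_apply_apply]
  map_mul' s t := σ.injective (by
    rw [hσ.map_mul, σ.apply_symm_apply, σ.apply_symm_apply, σ.apply_symm_apply, symMul_smul_smul,
      toAdd_mul])
  continuous_toFun := σ.symm.continuous.comp (continuous_toAdd.smul continuous_const)

/-- The curve runs from `p` to the lift `qγ` of the second point, and all its coordinates are affine
in `t`. -/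
theorem symMul_curve (p q γ : SymSpace d) (t : ℝ) :
    symMul (t • symMul (symMul q γ) (-p)) p =
      (p.1 + t * (q.1 - p.1 + γ.1), p.2.1 + t * (q.2.1 - p.2.1 + γ.2.1),
        p.2.2.1 + t * (q.2.2.1 - p.2.2.1 + γ.2.2.1) + t / 2 * (q.1 * γ.2.1 - q.2.1 * γ.1),
        p.2.2.2 + t • (q.2.2.2 - p.2.2.2 + γ.2.2.2)) := by
  obtain ⟨x, y, s, w⟩ := p
  obtain ⟨x', y', s', w'⟩ := q
  obtain ⟨a, b, c, n⟩ := γ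
  simp only [Prod.neg_mk, symMul_mk, Prod.smul_mk, smul_eq_mul, Prod.mk.injEq]
  refine ⟨by ring, by ring, by ring, ?_⟩
  rw [add_comm w]
  congr 2
  abel

variable {Γ : Subgroup G}

/-- With `γ = g₂⁻¹ φ(1) g₁`, the lift starting at `g₁` ends at `g₂γ`; since subgroups are lines, `γ`
determines the curve. -/
theorem IsSymCoord.exists_eq_of_mem_connectingCurves (hσ : IsSymCoord σ) {g₁ g₂ : G}
    {c : ℝ → G ⧸ Γ} (hc : c ∈ connectingCurves (g₁ : G ⧸ Γ) (g₂ : G ⧸ Γ)) :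
    ∃ γ ∈ Γ, ∀ t, c t = (σ.symm (symMul (t • symMul (symMul (σ g₂) (σ γ)) (-σ g₁)) (σ g₁)) :
      G) := by
  obtain ⟨⟨φ, hφ⟩, -, hc1, -⟩ := hc
  have h1 : g₂⁻¹ * (φ (Multiplicative.ofAdd 1) * g₁) ∈ Γ := by
    rw [← QuotientGroup.eq, ← hc1, hφ]
    rfl
  refine ⟨_, h1, fun t => ?_⟩
  rw [hφ]
  change ((φ (Multiplicative.ofAdd t) * g₁ : G) : G ⧸ Γ) = _
  congr 1
  apply σ.injective
  rw [σ.apply_symm_apply, hσ.map_mul, hσ.oneParameter, ← hσ.map_mul g₂, ← hσ.map_inv,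
    ← hσ.map_mul]
  congr 4
  group

theorem IsSymCoord.mem_connectingCurves (hσ : IsSymCoord σ) {g₁ g₂ : G}
    (hne : (g₁ : G ⧸ Γ) ≠ (g₂ : G ⧸ Γ)) {γ : G} (hγ : γ ∈ Γ) :
    (fun t : ℝ => ((σ.symm (symMul (t • symMul (symMul (σ g₂) (σ γ)) (-σ g₁)) (σ g₁)) : G) :
      G ⧸ Γ)) ∈ connectingCurves (g₁ : G ⧸ Γ) (g₂ : G ⧸ Γ) := by
  have hcurve : ∀ t : ℝ,
      ((σ.symm (symMul (t • symMul (symMul (σ g₂) (σ γ)) (-σ g₁)) (σ g₁)) : G) : G ⧸ Γ) =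
      hσ.line (symMul (symMul (σ g₂) (σ γ)) (-σ g₁)) (Multiplicative.ofAdd t) •
        (g₁ : G ⧸ Γ) := by
    intro t
    change _ = ((σ.symm (t • symMul (symMul (σ g₂) (σ γ)) (-σ g₁)) * g₁ : G) : G ⧸ Γ)
    congr 1
    rw [Homeomorph.symm_apply_eq, hσ.map_mul, σ.apply_symm_apply]
  have h0 : ((σ.symm (symMul ((0 : ℝ) • symMul (symMul (σ g₂) (σ γ)) (-σ g₁)) (σ g₁)) : G) :
      G ⧸ Γ) = g₁ := by
    rw [hcurve, ofAdd_zero, _root_.map_one, one_smul]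
  have h1 : ((σ.symm (symMul ((1 : ℝ) • symMul (symMul (σ g₂) (σ γ)) (-σ g₁)) (σ g₁)) : G) :
      G ⧸ Γ) = g₂ := by
    rw [one_smul, ← hσ.map_mul g₂, ← hσ.map_inv, ← hσ.map_mul, ← hσ.map_mul,
      inv_mul_cancel_right, σ.symm_apply_apply]
    exact (QuotientGroup.eq.2 (by simpa using hγ)).symm
  refine ⟨⟨_, hcurve⟩, h0, h1, 1, by simp, ?_⟩
  simp only [h1]
  exact hne.symm

end Curves

/-! ### Blocking and rationality -/

section Rationality

variable {d : ℕ} {G : Type*} [Group G] [TopologicalSpace G] {σ : G ≃ₜ SymSpace d}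
  {Γ : Subgroup G} {k : ℕ}

/-- The elements of the standard lattices in symmetric coordinates. -/
noncomputable def latticePoint (k : ℕ) (a b c : ℤ) (n : Fin d → ℤ) : SymSpace d :=
  ((a : ℝ), (b : ℝ), (c : ℝ) / k - a * b / 2, fun i => (n i : ℝ))

/-- Symmetric coordinates which map `Γ` onto a standard lattice. -/
structure IsAdapted (σ : G ≃ₜ SymSpace d) (Γ : Subgroup G) (k : ℕ) : Prop
    extends IsSymCoord σ where
  pos : 0 < k
  mem_iff : ∀ g, g ∈ Γ ↔ ∃ a b c : ℤ, ∃ n : Fin d → ℤ, σ g = latticePoint k a b c n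

/-- The differences of the `x` and of the `y` coordinates are rational. -/
def IsRationalPair (p q : SymSpace d) : Prop :=
  ∃ a b : ℚ, q.1 - p.1 = a ∧ q.2.1 - p.2.1 = b

theorem IsAdapted.mk_symm_eq_iff (hσ : IsAdapted σ Γ k) (u v : SymSpace d) :
    ((σ.symm u : G) : G ⧸ Γ) = (σ.symm v : G) ↔
      ∃ a b c : ℤ, ∃ n : Fin d → ℤ, v = symMul u (latticePoint k a b c n) := by
  rw [QuotientGroup.eq, hσ.mem_iff]
  refine exists_congr fun a => exists_congr fun b => exists_congr fun c => exists_congr fun n => ?_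
  rw [hσ.map_mul, hσ.map_inv, σ.apply_symm_apply, σ.apply_symm_apply]
  constructor
  · intro h
    have h1 := neg_symMul_cancel_left (-u) v
    rw [neg_neg, h] at h1
    exact h1.symm
  · rintro rfl
    exact neg_symMul_cancel_left _ _

/-- Right multiplication by the lattice reduces the integers `a`, `b`, `n` of the midpoint modulo
`2`. With differences in `(1/N)ℤ`, what is left of the central coordinate is a multiple of
`1/(4Nk)`, and it matters only modulo `1/k`. -/
theorem IsAdapted.midpointBlockable_of_isRationalPair (hσ : IsAdapted σ Γ k) {g₁ g₂ : G}
    (h : IsRationalPair (σ g₁) (σ g₂)) :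
    MidpointBlockable (g₁ : G ⧸ Γ) (g₂ : G ⧸ Γ) := by
  classical
  obtain ⟨N, hN, A, B, hA, hB⟩ : ∃ N : ℕ, 0 < N ∧ ∃ A B : ℤ,
      (σ g₂).1 - (σ g₁).1 = A / N ∧ (σ g₂).2.1 - (σ g₁).2.1 = B / N := by
    obtain ⟨p, q, hp, hq⟩ := h
    refine ⟨p.den * q.den, Nat.mul_pos p.pos q.pos, p.num * q.den, q.num * p.den, ?_, ?_⟩
    · rw [hp]
      conv_lhs => rw [← Rat.num_div_den p]
      have := q.den_nz
      push_cast
      field_simp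
    · rw [hq]
      conv_lhs => rw [← Rat.num_div_den q]
      have := p.den_nz
      push_cast
      field_simp
  let f : ℤ × ℤ × ℤ × (Fin d → ℤ) → G ⧸ Γ := fun e => ((σ.symm
    (((σ g₁).1 + (σ g₂).1 + e.1) / 2, ((σ g₁).2.1 + (σ g₂).2.1 + e.2.1) / 2,
      ((σ g₁).2.2.1 + (σ g₂).2.2.1) / 2 + ((σ g₂).1 * e.2.1 - (σ g₂).2.1 * e.1) / 4 +
        e.2.2.1 / (4 * N * k),
      fun i => ((σ g₁).2.2.2 i + (σ g₂).2.2.2 i + e.2.2.2 i) / 2) : G) : G ⧸ Γ)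
  refine ((Set.finite_Icc (0 : ℤ × ℤ × ℤ × (Fin d → ℤ)) (1, 1, 4 * N, 1)).image f).subset ?_
  rintro m ⟨c, hc, rfl⟩
  obtain ⟨γ, hγ, hcγ⟩ := hσ.exists_eq_of_mem_connectingCurves hc
  obtain ⟨a, b, z, n, hγσ⟩ := (hσ.mem_iff γ).1 hγ
  -- `R / (4Nk)` is the central term left after right translation by `(-⌊a/2⌋, -⌊b/2⌋)`. That
  -- translation pairs with `x` and `y` of the midpoint, and only the differences `A/N`, `B/N`
  -- survive. The remaining reduction modulo `4N` is a shift by the central lattice.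
  set R : ℤ := 2 * z * N - k * N * (a * b + b / 2 * a - a / 2 * b) + k * (b / 2 * A - a / 2 * B) -
    2 * k * N * (a / 2) * (b / 2) with hR
  have hN4 : (0 : ℤ) < 4 * N := by omega
  refine ⟨(a % 2, b % 2, R % (4 * N), fun i => n i % 2), ⟨⟨?_, ?_, ?_, fun i => ?_⟩,
    ⟨?_, ?_, ?_, fun i => ?_⟩⟩, ?_⟩
  · exact Int.emod_nonneg _ (by norm_num)
  · exact Int.emod_nonneg _ (by norm_num)
  · exact Int.emod_nonneg _ hN4.ne'
  · exact Int.emod_nonneg _ (by norm_num)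
  · change a % 2 ≤ 1
    omega
  · change b % 2 ≤ 1
    omega
  · exact (Int.emod_lt_of_pos _ hN4).le
  · change n i % 2 ≤ 1
    omega
  · rw [hcγ, eq_comm, hσ.mk_symm_eq_iff]
    refine ⟨-(a / 2), -(b / 2), -(R / (4 * N)), fun i => -(n i / 2), ?_⟩
    rw [symMul_curve, hγσ]
    have ha : (a : ℝ) = 2 * (a / 2 : ℤ) + (a % 2 : ℤ) := by
      exact_mod_cast (Int.mul_ediv_add_emod a 2).symm
    have hb : (b : ℝ) = 2 * (b / 2 : ℤ) + (b % 2 : ℤ) := by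
      exact_mod_cast (Int.mul_ediv_add_emod b 2).symm
    have hn : ∀ i, (n i : ℝ) = 2 * (n i / 2 : ℤ) + (n i % 2 : ℤ) := fun i => by
      exact_mod_cast (Int.mul_ediv_add_emod (n i) 2).symm
    have hr : (R : ℝ) = 4 * N * (R / (4 * N) : ℤ) + (R % (4 * N) : ℤ) := by
      exact_mod_cast (Int.mul_ediv_add_emod R (4 * N)).symm
    have hR' : (R : ℝ) = 2 * z * N - k * N * (a * b + (b / 2 : ℤ) * a - (a / 2 : ℤ) * b) +
        k * ((b / 2 : ℤ) * A - (a / 2 : ℤ) * B) - 2 * k * N * (a / 2 : ℤ) * (b / 2 : ℤ) := by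
      rw [hR]
      push_cast
      ring
    have hk0 : (k : ℝ) ≠ 0 := Nat.cast_ne_zero.2 hσ.pos.ne'
    have hN0 : (N : ℝ) ≠ 0 := Nat.cast_ne_zero.2 hN.ne'
    clear_value R
    generalize σ g₁ = p at *
    generalize σ g₂ = q at *
    obtain ⟨x, y, s, w⟩ := p
    obtain ⟨x', y', s', w'⟩ := q
    simp only [latticePoint, symMul_mk, Prod.mk.injEq] at *
    have hx' : x' = x + A / N := by linarith
    have hy' : y' = y + B / N := by linarith
    have hr' : ((R % (4 * N) : ℤ) : ℝ) = R - 4 * N * (R / (4 * N) : ℤ) := by linarith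
    generalize (R % (4 * N) : ℤ) = r at *
    generalize (R / (4 * N) : ℤ) = r₁ at *
    generalize a / 2 = a₁ at *
    generalize b / 2 = b₁ at *
    generalize a % 2 = a₂ at *
    generalize b % 2 = b₂ at *
    refine ⟨?_, ?_, ?_, ?_⟩
    · rw [ha]
      push_cast
      ring
    · rw [hb]
      push_cast
      ring
    · rw [hr', hR', hx', hy', ha, hb]
      push_cast
      field_simp
      ring
    · ext i
      simp only [Pi.add_apply, Pi.smul_apply, Pi.sub_apply, smul_eq_mul]
      rw [hn i]
      push_cast
      ring

/-- One of the two axes works. The condition `a * b = 0` removes the term `a * b / 2` from the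
lattice points used below. -/
theorem exists_irrational_direction {p q : SymSpace d} (h : ¬ IsRationalPair p q) :
    ∃ a b : ℤ, a * b = 0 ∧ ∀ r : ℚ, (q.1 - p.1) * b - (q.2.1 - p.2.1) * a ≠ r := by
  by_cases hx : ∃ r : ℚ, q.1 - p.1 = r
  · obtain ⟨r, hr⟩ := hx
    refine ⟨1, 0, by norm_num, fun s hs => h ⟨r, -s, hr, ?_⟩⟩
    push_cast at hs ⊢
    linarith
  · refine ⟨0, 1, by norm_num, fun s hs => hx ⟨s, ?_⟩⟩
    push_cast at hs
    linarith

theorem IsAdapted.exists_curve_mem (hσ : IsAdapted σ Γ k) {g₁ g₂ : G}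
    (hne : (g₁ : G ⧸ Γ) ≠ (g₂ : G ⧸ Γ)) {B : Set (G ⧸ Γ)}
    (hB : IsBlockingSet (g₁ : G ⧸ Γ) (g₂ : G ⧸ Γ) B) (a b c : ℤ) :
    ∃ t : ℝ, 0 < t ∧ t < 1 ∧ ∃ m ∈ B, ∃ a' b' c' : ℤ, ∃ n' : Fin d → ℤ,
      symMul (t • symMul (symMul (σ g₂) (latticePoint k a b c 0)) (-σ g₁)) (σ g₁) =
        symMul (σ m.out) (latticePoint k a' b' c' n') := by
  have hγ : σ.symm (latticePoint k a b c 0) ∈ Γ :=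
    (hσ.mem_iff _).2 ⟨a, b, c, 0, σ.apply_symm_apply _⟩
  have hc := hσ.mem_connectingCurves hne hγ
  obtain ⟨m, ⟨t, ⟨ht0, ht1⟩, htm⟩, hmB⟩ := hB.meets _ hc
  have hc0 := hc.2.1
  have hc1 := hc.2.2.1
  simp only [σ.apply_symm_apply] at htm hc0 hc1
  have hm := hB.subset hmB
  refine ⟨t, lt_of_le_of_ne ht0 ?_, lt_of_le_of_ne ht1 ?_, m, hmB, ?_⟩
  · rintro rfl
    exact hm (Or.inl (htm.symm.trans hc0))
  · rintro rfl
    exact hm (Or.inr (htm.symm.trans hc1))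
  · rw [← hσ.mk_symm_eq_iff, htm, σ.symm_apply_apply]
    exact Quotient.out_eq m

/-- The curves used are those to `g₂γ` with `γ = (j a₀, j b₀, i/k)`. Letting `i` vary for fixed `j`
makes a meeting time rational; letting `j` vary then makes the number attached to the direction
`(a₀, b₀)` rational, contrary to its choice. -/
theorem IsAdapted.isRationalPair_of_blockable (hσ : IsAdapted σ Γ k) {g₁ g₂ : G}
    (h : Blockable (g₁ : G ⧸ Γ) (g₂ : G ⧸ Γ)) : IsRationalPair (σ g₁) (σ g₂) := by
  by_contra hnr
  obtain ⟨B, hB⟩ := h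
  have hk0 : (k : ℝ) ≠ 0 := Nat.cast_ne_zero.2 hσ.pos.ne'
  have hne : (g₁ : G ⧸ Γ) ≠ (g₂ : G ⧸ Γ) := by
    intro h
    rw [← σ.symm_apply_apply g₁, ← σ.symm_apply_apply g₂, hσ.mk_symm_eq_iff] at h
    obtain ⟨a, b, c, n, h⟩ := h
    refine hnr ⟨a, b, ?_, ?_⟩ <;> rw [h] <;> simp [symMul, latticePoint]
  obtain ⟨a₀, b₀, hab, hirr⟩ := exists_irrational_direction hnr
  have hab' : (a₀ : ℝ) * b₀ = 0 := by exact_mod_cast hab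
  -- the equations for the intersection points
  have hmeet : ∀ j i : ℕ, ∃ t : ℝ, 0 < t ∧ t < 1 ∧ ∃ m ∈ B, ∃ a b c : ℤ,
      (σ g₁).1 + t * ((σ g₂).1 - (σ g₁).1 + j * a₀) = (σ m.out).1 + a ∧
      (σ g₁).2.1 + t * ((σ g₂).2.1 - (σ g₁).2.1 + j * b₀) = (σ m.out).2.1 + b ∧
      (σ g₁).2.2.1 + t * ((σ g₂).2.2.1 - (σ g₁).2.2.1 + i / k) +
        t / 2 * ((σ g₂).1 * (j * b₀) - (σ g₂).2.1 * (j * a₀)) =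
        (σ m.out).2.2.1 + (c / k - a * b / 2) +
          ((σ m.out).1 * b - (σ m.out).2.1 * a) / 2 := by
    intro j i
    obtain ⟨t, ht0, ht1, m, hm, a, b, c, n, he⟩ :=
      hσ.exists_curve_mem hne hB (j * a₀) (j * b₀) i
    refine ⟨t, ht0, ht1, m, hm, a, b, c, ?_⟩
    rw [symMul_curve] at he
    generalize σ m.out = β at *
    obtain ⟨X, Y, Z, W⟩ := β
    simp only [latticePoint, symMul_mk, Prod.mk.injEq] at he
    obtain ⟨h1, h2, h3, -⟩ := he
    push_cast at h1 h2 h3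
    refine ⟨h1, h2, ?_⟩
    have h4 : (j : ℝ) * a₀ * (j * b₀) = 0 := by linear_combination (j : ℝ) * j * hab'
    rw [h4] at h3
    linear_combination h3
  generalize σ g₁ = p at *
  generalize σ g₂ = q at *
  obtain ⟨x, y, s, w⟩ := p
  obtain ⟨x', y', s', w'⟩ := q
  simp only [IsRationalPair] at *
  -- the intersection times are rational for some curves
  have hrat : ∀ j : ℕ, ∃ i : ℕ, ∃ t : ℚ, 0 < t ∧ t < 1 ∧ ∃ m ∈ B, ∃ a b c : ℤ,
      x + t * (x' - x + j * a₀) = (σ m.out).1 + a ∧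
      y + t * (y' - y + j * b₀) = (σ m.out).2.1 + b ∧
      s + t * (s' - s + i / k) + t / 2 * (x' * (j * b₀) - y' * (j * a₀)) =
        (σ m.out).2.2.1 + (c / k - a * b / 2) +
          ((σ m.out).1 * b - (σ m.out).2.1 * a) / 2 := by
    intro j
    choose t ht0 ht1 m hm a b c h1 h2 h3 using hmeet j
    obtain ⟨M₁, hM₁⟩ := (hB.finite.image fun m => |(σ m.out).1|).bddAbove
    obtain ⟨M₂, hM₂⟩ := (hB.finite.image fun m => |(σ m.out).2.1|).bddAbove
    set R₁ := |x| + |x' - x + j * a₀| + M₁ with hR₁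
    set R₂ := |y| + |y' - y + j * b₀| + M₂ with hR₂
    -- The `x` and `y` coordinates of the curves do not depend on `i` and stay bounded, so only
    -- finitely many integers `a`, `b` occur besides the finitely many points of `B`.
    have hbound : ∀ {α u v X A M : ℝ}, 0 < α → α < 1 → |X| ≤ M → u + α * v = X + A →
        |A| ≤ |u| + |v| + M := by
      intro α u v X A M h0 h1 hX he
      have h2 : A = u + α * v - X := by linarith
      have h3 : |α * v| ≤ |v| := by
        rw [abs_mul, abs_of_pos h0]
        exact mul_le_of_le_one_left (abs_nonneg v) h1.le
      rw [h2]
      calc |u + α * v - X| ≤ |u + α * v| + |X| := abs_sub _ _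
        _ ≤ |u| + |α * v| + |X| := by gcongr; exact abs_add_le _ _
        _ ≤ |u| + |v| + M := by gcongr
    have hfl : ∀ {A : ℤ} {R : ℝ}, |(A : ℝ)| ≤ R → A ∈ Set.Icc (-⌊R⌋) ⌊R⌋ := by
      intro A R h
      rw [Set.mem_Icc, ← abs_le, Int.le_floor]
      exact_mod_cast h
    have hfin := (hB.finite.prod ((Set.finite_Icc (-⌊R₁⌋) ⌊R₁⌋).prod
      (Set.finite_Icc (-⌊R₂⌋) ⌊R₂⌋)))
    have hmaps : Set.MapsTo (fun i : ℕ => (m i, a i, b i)) Set.univ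
        (B ×ˢ (Set.Icc (-⌊R₁⌋) ⌊R₁⌋ ×ˢ Set.Icc (-⌊R₂⌋) ⌊R₂⌋)) := fun i _ => ⟨hm i,
        hfl (hbound (ht0 i) (ht1 i) (hM₁ ⟨_, hm i, rfl⟩) (h1 i)),
        hfl (hbound (ht0 i) (ht1 i) (hM₂ ⟨_, hm i, rfl⟩) (h2 i))⟩
    obtain ⟨i, -, i', -, hii, heq⟩ := Set.infinite_univ.exists_ne_map_eq_of_mapsTo hmaps hfin
    simp only [Prod.mk.injEq] at heq
    obtain ⟨hmm, haa, hbb⟩ := heq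
    have e1 := h1 i
    have e2 := h2 i
    have e3 := h3 i
    have e1' := h1 i'
    have e2' := h2 i'
    have e3' := h3 i'
    rw [← hmm, ← haa] at e1'
    rw [← hmm, ← hbb] at e2'
    rw [← hmm, ← hbb, ← haa] at e3'
    -- Two different times at the same `x`, `y` position would give `x' - x = -j a₀` and `y' - y =
    -- -j b₀`, which are rational.
    have htt : t i = t i' := by
      by_contra hne
      have hne' : t i - t i' ≠ 0 := sub_ne_zero.2 hne
      refine hnr ⟨-j * a₀, -j * b₀, ?_, ?_⟩ <;> push_cast <;> apply mul_left_cancel₀ hne'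
      · linear_combination e1 - e1'
      · linear_combination e2 - e2'
    rw [← htt] at e3'
    have hii' : (i : ℝ) - i' ≠ 0 := sub_ne_zero.2 (by exact_mod_cast hii)
    -- At equal times the central equations subtract to `t (i - i') = c i - c i'`.
    have htq : t i = (((c i - c i' : ℤ) : ℚ) / ((i : ℚ) - i') : ℚ) := by
      push_cast
      rw [eq_div_iff hii']
      have e4 : t i * (i / k) - t i * (i' / k) = c i / k - c i' / k := by
        linear_combination e3 - e3'
      field_simp at e4
      linear_combination e4
    refine ⟨i, ((c i - c i' : ℤ) : ℚ) / ((i : ℚ) - i'), ?_, ?_, m i, hm i, a i, b i, c i, ?_⟩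
    · have := ht0 i
      rw [htq] at this
      exact_mod_cast this
    · have := ht1 i
      rw [htq] at this
      exact_mod_cast this
    · rw [← htq]
      exact ⟨e1, e2, e3⟩
  choose i t ht0 ht1 m hm a b c h1 h2 h3 using hrat
  obtain ⟨j, -, j', -, hjj, hmm⟩ := Set.infinite_univ.exists_ne_map_eq_of_mapsTo
      (f := m) (fun j _ => hm j) hB.finite
  have e1 := h1 j
  have e2 := h2 j
  have e3 := h3 j
  have e1' := h1 j'
  have e2' := h2 j'
  have e3' := h3 j'
  rw [← hmm] at e1' e2' e3'
  -- If the rational times differed, the first two equations would determine `x' - x` and `y' - y`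
  -- as rational numbers.
  have htt : t j = t j' := by
    by_contra hne
    have hne' : (t j : ℝ) - t j' ≠ 0 := sub_ne_zero.2 (by exact_mod_cast hne)
    refine hnr ⟨(a j - a j' - (t j * j - t j' * j') * a₀) / (t j - t j'),
      (b j - b j' - (t j * j - t j' * j') * b₀) / (t j - t j'), ?_, ?_⟩ <;> push_cast <;>
      rw [eq_div_iff hne']
    · linear_combination e1 - e1'
    · linear_combination e2 - e2'
  rw [← htt] at e1' e2' e3'
  have hjj' : (j : ℝ) - j' ≠ 0 := sub_ne_zero.2 (by exact_mod_cast hjj)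
  have ht0' : (t j : ℝ) ≠ 0 := by exact_mod_cast (ht0 j).ne'
  have ht1' : (1 : ℝ) - t j ≠ 0 := sub_ne_zero.2 (by exact_mod_cast (ht1 j).ne')
  -- Substituting the `x`, `y` equations in the difference of the central ones leaves `τ (j - j') (1
  -- - τ) / 2` times `(x' - x) b₀ - (y' - y) a₀` equal to a rational number. The factor `τ (1 - τ)`
  -- is nonzero because blocking points are not endpoints.
  refine hirr (2 * ((c j - c j') / k - (a j * b j - a j' * b j') / 2 - t j * (i j - i j') / k -
    t j / 2 * (j - j') * (a j * b₀ - b j * a₀)) / (t j * (j - j') * (1 - t j))) ?_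
  push_cast
  rw [eq_div_iff (mul_ne_zero (mul_ne_zero ht0' hjj') ht1')]
  generalize ((t j : ℚ) : ℝ) = τ at *
  generalize (σ (m j).out) = β at *
  have d1 : τ * (j - j') * a₀ = a j - a j' := by linear_combination e1 - e1'
  have d2 : τ * (j - j') * b₀ = b j - b j' := by linear_combination e2 - e2'
  have hX : β.1 = x + τ * (x' - x + j * a₀) - a j := by linear_combination -e1
  have hY : β.2.1 = y + τ * (y' - y + j * b₀) - b j := by linear_combination -e2
  have d3 : τ * (i j - i j') / k + τ / 2 * (j - j') * (x' * b₀ - y' * a₀) =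
      (c j - c j') / k - (a j * b j - a j' * b j') / 2 +
        (β.1 * (b j - b j') - β.2.1 * (a j - a j')) / 2 := by
    linear_combination e3 - e3'
  rw [← d1, ← d2, hX, hY] at d3
  linear_combination 2 * d3

theorem IsAdapted.blockable_iff [IsTopologicalGroup G] [T1Space (G ⧸ Γ)] (hσ : IsAdapted σ Γ k)
    (g₁ g₂ : G) : Blockable (g₁ : G ⧸ Γ) (g₂ : G ⧸ Γ) ↔ IsRationalPair (σ g₁) (σ g₂) :=
  ⟨hσ.isRationalPair_of_blockable,
    fun h => (hσ.midpointBlockable_of_isRationalPair h).blockable⟩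

theorem IsAdapted.blockable_iff_midpointBlockable [IsTopologicalGroup G] [T1Space (G ⧸ Γ)]
    (hσ : IsAdapted σ Γ k) (n₁ n₂ : G ⧸ Γ) : Blockable n₁ n₂ ↔ MidpointBlockable n₁ n₂ := by
  obtain ⟨g₁, rfl⟩ := QuotientGroup.mk_surjective n₁
  obtain ⟨g₂, rfl⟩ := QuotientGroup.mk_surjective n₂
  exact ⟨fun h => hσ.midpointBlockable_of_isRationalPair (hσ.isRationalPair_of_blockable h),
    fun h => h.blockable⟩

theorem IsAdapted.blockable_self [IsTopologicalGroup G] [T1Space (G ⧸ Γ)]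
    (hσ : IsAdapted σ Γ k) (n : G ⧸ Γ) : Blockable n n := by
  obtain ⟨g, rfl⟩ := QuotientGroup.mk_surjective n
  exact (hσ.blockable_iff g g).2 ⟨0, 0, by simp, by simp⟩

end Rationality

/-! ### The standard lattices of the Heisenberg group -/

namespace Heisenberg

/-- The lattice of the elements `h(a, b, c / k)` with `a`, `b`, `c` integers. -/
def stdLattice (k : ℕ) (hk : 0 < k) : Subgroup Heisenberg where
  carrier := {h | ∃ a b c : ℤ, h = ⟨a, b, c / k⟩}
  one_mem' := ⟨0, 0, 0, by simp [one_def]⟩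
  mul_mem' := by
    rintro _ _ ⟨a, b, c, rfl⟩ ⟨a', b', c', rfl⟩
    refine ⟨a + a', b + b', c + c' + k * (a * b'), ?_⟩
    have hk0 : (k : ℝ) ≠ 0 := Nat.cast_ne_zero.2 hk.ne'
    rw [mul_def]
    ext <;> push_cast
    · rfl
    · rfl
    · field_simp
  inv_mem' := by
    rintro _ ⟨a, b, c, rfl⟩
    refine ⟨-a, -b, -c + k * (a * b), ?_⟩
    have hk0 : (k : ℝ) ≠ 0 := Nat.cast_ne_zero.2 hk.ne'
    rw [inv_def]
    ext <;> push_cast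
    · rfl
    · rfl
    · field_simp

theorem mem_stdLattice {k : ℕ} {hk : 0 < k} {h : Heisenberg} :
    h ∈ stdLattice k hk ↔ ∃ a b c : ℤ, h = ⟨a, b, c / k⟩ := Iff.rfl

theorem isDiscrete_stdLattice (k : ℕ) (hk : 0 < k) :
    IsDiscrete (stdLattice k hk : Set Heisenberg) := by
  refine ⟨discreteTopology_of_isOpen_singleton_one (G := stdLattice k hk) ?_⟩
  have hk0 : (0 : ℝ) < k := Nat.cast_pos.2 hk
  have hopen : IsOpen {h : Heisenberg | |h.x| < 1 ∧ |h.y| < 1 ∧ |h.z * k| < 1} :=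
    (isOpen_lt continuous_x.abs continuous_const).inter
      ((isOpen_lt continuous_y.abs continuous_const).inter
        (isOpen_lt (continuous_z.mul continuous_const).abs continuous_const))
  have : ({1} : Set (stdLattice k hk)) =
      Subtype.val ⁻¹' {h : Heisenberg | |h.x| < 1 ∧ |h.y| < 1 ∧ |h.z * k| < 1} := by
    ext ⟨h, hh⟩
    constructor
    · intro h1
      have h1 : h = 1 := congrArg Subtype.val h1
      subst h1
      simp [one_def]
    · obtain ⟨a, b, c, rfl⟩ := hh
      rintro ⟨h1, h2, h3⟩
      simp only [div_mul_cancel₀ _ hk0.ne'] at h1 h2 h3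
      have ha : a = 0 := Int.abs_lt_one_iff.1 (by exact_mod_cast h1)
      have hb : b = 0 := Int.abs_lt_one_iff.1 (by exact_mod_cast h2)
      have hc : c = 0 := Int.abs_lt_one_iff.1 (by exact_mod_cast h3)
      subst ha hb hc
      refine Subtype.ext ?_
      simp [one_def]
  rw [this]
  exact hopen.preimage continuous_subtype_val

/-- The symmetric coordinates of the Heisenberg group. -/
noncomputable def symCoord : Heisenberg ≃ₜ SymSpace 0 where
  toFun h := (h.x, h.y, h.z - h.x * h.y / 2, 0)
  invFun u := ⟨u.1, u.2.1, u.2.2.1 + u.1 * u.2.1 / 2⟩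
  left_inv h := by ext <;> simp
  right_inv u := by
    refine Prod.ext rfl (Prod.ext rfl (Prod.ext ?_ (Subsingleton.elim _ _)))
    simp
  continuous_toFun := continuous_x.prodMk (continuous_y.prodMk
    ((continuous_z.sub ((continuous_x.mul continuous_y).div_const 2)).prodMk continuous_const))
  continuous_invFun := continuous_mk (by fun_prop) (by fun_prop) (by fun_prop)

theorem isAdapted_symCoord (k : ℕ) (hk : 0 < k) :
    IsAdapted symCoord (stdLattice k hk) k where
  map_mul g h := by
    change ((g * h).x, (g * h).y, (g * h).z - (g * h).x * (g * h).y / 2, (0 : Fin 0 → ℝ)) =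
      symMul (g.x, g.y, g.z - g.x * g.y / 2, 0) (h.x, h.y, h.z - h.x * h.y / 2, 0)
    simp only [mul_def, symMul_mk, Prod.mk.injEq]
    exact ⟨trivial, trivial, by ring, (add_zero _).symm⟩
  pos := hk
  mem_iff h := by
    rw [mem_stdLattice]
    refine exists_congr fun a => exists_congr fun b => exists_congr fun c => ?_
    change _ ↔ ∃ n : Fin 0 → ℤ, (h.x, h.y, h.z - h.x * h.y / 2, (0 : Fin 0 → ℝ)) = _
    constructor
    · rintro rfl
      exact ⟨0, by simp [latticePoint, eq_iff_true_of_subsingleton]⟩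
    · rintro ⟨n, hn⟩
      simp only [latticePoint, Prod.mk.injEq] at hn
      obtain ⟨h1, h2, h3, -⟩ := hn
      rw [h1, h2] at h3
      ext
      · exact h1
      · exact h2
      · simpa using h3

end Heisenberg

/-! ### The splitting of `G ⧸ Γ` into a Heisenberg manifold and a torus -/

section Decomposition

variable {d : ℕ}

/-- Symmetric coordinates on the product of the Heisenberg group with `ℝᵈ`. -/
noncomputable def symDiffeomorph (d : ℕ) :
    Diffeomorph (𝓘(ℝ, ℝ × ℝ × ℝ).prod 𝓘(ℝ, Fin d → ℝ)) 𝓘(ℝ, SymSpace d)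
      (Heisenberg × (Fin d → ℝ)) (SymSpace d) ∞ where
  toFun p := (p.1.x, p.1.y, p.1.z - p.1.x * p.1.y / 2, p.2)
  invFun u := (⟨u.1, u.2.1, u.2.2.1 + u.1 * u.2.1 / 2⟩, u.2.2.2)
  left_inv p := by
    refine Prod.ext ?_ rfl
    ext <;> simp
  right_inv u := by
    refine Prod.ext rfl (Prod.ext rfl (Prod.ext ?_ rfl))
    simp
  contMDiff_toFun := by
    have hx := Heisenberg.contMDiff_x.comp
      (contMDiff_fst (I := 𝓘(ℝ, ℝ × ℝ × ℝ)) (J := 𝓘(ℝ, Fin d → ℝ)) (M := Heisenberg)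
        (N := Fin d → ℝ) (n := ∞))
    have hy := Heisenberg.contMDiff_y.comp
      (contMDiff_fst (I := 𝓘(ℝ, ℝ × ℝ × ℝ)) (J := 𝓘(ℝ, Fin d → ℝ)) (M := Heisenberg)
        (N := Fin d → ℝ) (n := ∞))
    have hz := Heisenberg.contMDiff_z.comp
      (contMDiff_fst (I := 𝓘(ℝ, ℝ × ℝ × ℝ)) (J := 𝓘(ℝ, Fin d → ℝ)) (M := Heisenberg)
        (N := Fin d → ℝ) (n := ∞))
    have hs : ContDiff ℝ ∞ (fun u : ℝ × ℝ × ℝ => u.2.2 - u.1 * u.2.1 / 2) := by fun_prop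
    exact hx.prodMk_space (hy.prodMk_space
      ((hs.contMDiff.comp (hx.prodMk_space (hy.prodMk_space hz))).prodMk_space contMDiff_snd))
  contMDiff_invFun := by
    have h1 : ContDiff ℝ ∞ (fun u : SymSpace d => u.1) := by fun_prop
    have h2 : ContDiff ℝ ∞ (fun u : SymSpace d => u.2.1) := by fun_prop
    have h3 : ContDiff ℝ ∞ (fun u : SymSpace d => u.2.2.1 + u.1 * u.2.1 / 2) := by fun_prop
    have h4 : ContDiff ℝ ∞ (fun u : SymSpace d => u.2.2.2) := by fun_prop
    exact (Heisenberg.contMDiff_mk h1.contMDiff h2.contMDiff h3.contMDiff).prodMk h4.contMDiff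

theorem symDiffeomorph_apply (p : Heisenberg × (Fin d → ℝ)) :
    symDiffeomorph d p = (p.1.x, p.1.y, p.1.z - p.1.x * p.1.y / 2, p.2) := rfl

theorem symDiffeomorph_mul (p q : Heisenberg × (Fin d → ℝ)) :
    symDiffeomorph d (p.1 * q.1, p.2 + q.2) =
      symMul (symDiffeomorph d p) (symDiffeomorph d q) := by
  simp only [symDiffeomorph_apply, Heisenberg.mul_def, symMul_mk, Prod.mk.injEq]
  exact ⟨trivial, trivial, by ring, trivial⟩

theorem symDiffeomorph_symm_symMul (u v : SymSpace d) :
    (symDiffeomorph d).symm (symMul u v) =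
      (((symDiffeomorph d).symm u).1 * ((symDiffeomorph d).symm v).1,
        ((symDiffeomorph d).symm u).2 + ((symDiffeomorph d).symm v).2) := by
  apply (symDiffeomorph d).injective
  change symDiffeomorph d _ = symDiffeomorph d _
  rw [symDiffeomorph_mul, Diffeomorph.apply_symm_apply, Diffeomorph.apply_symm_apply,
    Diffeomorph.apply_symm_apply]

variable {E : Type*} [NormedAddCommGroup E] [NormedSpace ℝ E]
  {G : Type*} [TopologicalSpace G] [ChartedSpace E G] [Group G] {Γ : Subgroup G}

/-- After an automorphism, a lattice in the product of the Heisenberg group with `ℝᵈ` is the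
product of a standard lattice with `ℤᵈ`. -/
theorem IsLattice.exists_adapted_diffeomorph [IsTopologicalGroup G] [T2Space G]
    (hΓ : IsLattice Γ)
    (Ψ : Diffeomorph 𝓘(ℝ, E) (𝓘(ℝ, ℝ × ℝ × ℝ).prod 𝓘(ℝ, Fin d → ℝ))
          G (Heisenberg × (Fin d → ℝ)) ∞)
    (hΨ : ∀ g g' : G, (Ψ (g * g')).1 = (Ψ g).1 * (Ψ g').1 ∧
          (Ψ (g * g')).2 = (Ψ g).2 + (Ψ g').2) :
    ∃ k : ℕ, ∃ Φ : Diffeomorph 𝓘(ℝ, E) (𝓘(ℝ, ℝ × ℝ × ℝ).prod 𝓘(ℝ, Fin d → ℝ))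
          G (Heisenberg × (Fin d → ℝ)) ∞,
      (∀ g g' : G, (Φ (g * g')).1 = (Φ g).1 * (Φ g').1 ∧
          (Φ (g * g')).2 = (Φ g).2 + (Φ g').2) ∧
      IsAdapted (Φ.trans (symDiffeomorph d)).toHomeomorph Γ k := by
  set σ := (Ψ.trans (symDiffeomorph d)).toHomeomorph with hσdef
  have hσapp : ∀ g, σ g = symDiffeomorph d (Ψ g) := fun _ => rfl
  have hσ : IsSymCoord σ := ⟨fun g h => by
    rw [hσapp, hσapp, hσapp, ← symDiffeomorph_mul, ← (hΨ g h).1, ← (hΨ g h).2]⟩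
  obtain ⟨k, hk, T, hTmul, hT⟩ := (hΓ.isSymLattice hσ).exists_normalForm
  have hTsymm : ∀ u v, T.symm (symMul u v) = symMul (T.symm u) (T.symm v) := by
    intro u v
    rw [LinearEquiv.symm_apply_eq, hTmul, T.apply_symm_apply, T.apply_symm_apply]
  -- The isomorphism is corrected by the automorphism `T⁻¹`, conjugated back from symmetric
  -- coordinates.
  let Φ := ((Ψ.trans (symDiffeomorph d)).trans
    (T.symm.toContinuousLinearEquiv.toDiffeomorph)).trans (symDiffeomorph d).symm
  have hΦ : ∀ g, symDiffeomorph d (Φ g) = T.symm (σ g) := fun g =>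
    (symDiffeomorph d).apply_symm_apply _
  have hΦ' : ∀ g, Φ g = (symDiffeomorph d).symm (T.symm (σ g)) := fun g => rfl
  refine ⟨k, Φ, fun g g' => ?_, ⟨⟨fun g g' => ?_⟩, hk, fun g => ?_⟩⟩
  · rw [hΦ', hΦ', hΦ', hσ.map_mul, hTsymm, symDiffeomorph_symm_symMul]
    exact ⟨rfl, rfl⟩
  · change symDiffeomorph d (Φ (g * g')) = symMul (symDiffeomorph d (Φ g)) (symDiffeomorph d (Φ g'))
    rw [hΦ, hΦ, hΦ, hσ.map_mul, hTsymm]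
  · change _ ↔ ∃ a b c n, symDiffeomorph d (Φ g) = _
    rw [hΦ]
    have h1 := hT (T.symm (σ g))
    rw [T.apply_symm_apply] at h1
    rw [← SetLike.mem_coe, ← σ.injective.mem_set_image, h1]
    rfl

theorem IsAdapted.mem_iff_of_diffeomorph {k : ℕ}
    {Φ : Diffeomorph 𝓘(ℝ, E) (𝓘(ℝ, ℝ × ℝ × ℝ).prod 𝓘(ℝ, Fin d → ℝ))
          G (Heisenberg × (Fin d → ℝ)) ∞}
    (hσ : IsAdapted (Φ.trans (symDiffeomorph d)).toHomeomorph Γ k) (g : G) :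
    g ∈ Γ ↔ (Φ g).1 ∈ Heisenberg.stdLattice k hσ.pos ∧
      ∃ n : Fin d → ℤ, (Φ g).2 = fun i => (n i : ℝ) := by
  rw [hσ.mem_iff, Heisenberg.mem_stdLattice]
  change (∃ a b c n, symDiffeomorph d (Φ g) = _) ↔ _
  rw [symDiffeomorph_apply]
  generalize Φ g = p
  obtain ⟨⟨x, y, z⟩, w⟩ := p
  simp only [latticePoint, Prod.mk.injEq, Heisenberg.mk.injEq]
  constructor
  · rintro ⟨a, b, c, n, h1, h2, h3, h4⟩
    rw [h1, h2, sub_left_inj] at h3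
    exact ⟨⟨a, b, c, h1, h2, h3⟩, n, h4⟩
  · rintro ⟨⟨a, b, c, h1, h2, h3⟩, n, h4⟩
    exact ⟨a, b, c, n, h1, h2, by rw [h1, h2, h3], h4⟩

-- The invariant measure is pushed forward along the projection of `G ⧸ Γ` to the Heisenberg factor;
-- it remains invariant because each `h` lifts to the element `Φ.symm (h, 0)` of `G`.
open MeasureTheory in
theorem IsLattice.isLattice_stdLattice [IsTopologicalGroup G] (hΓ : IsLattice Γ) {k : ℕ}
    {Φ : Diffeomorph 𝓘(ℝ, E) (𝓘(ℝ, ℝ × ℝ × ℝ).prod 𝓘(ℝ, Fin d → ℝ))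
          G (Heisenberg × (Fin d → ℝ)) ∞}
    (hΦ : ∀ g g' : G, (Φ (g * g')).1 = (Φ g).1 * (Φ g').1 ∧
          (Φ (g * g')).2 = (Φ g).2 + (Φ g').2)
    (hσ : IsAdapted (Φ.trans (symDiffeomorph d)).toHomeomorph Γ k) :
    IsLattice (Heisenberg.stdLattice k hσ.pos) where
  discrete := Heisenberg.isDiscrete_stdLattice k hσ.pos
  finite_covolume := by
    set Λ := Heisenberg.stdLattice k hσ.pos
    let _ : MeasurableSpace (G ⧸ Γ) := borel (G ⧸ Γ)
    have : BorelSpace (G ⧸ Γ) := ⟨rfl⟩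
    let _ : MeasurableSpace (Heisenberg ⧸ Λ) := borel (Heisenberg ⧸ Λ)
    have : BorelSpace (Heisenberg ⧸ Λ) := ⟨rfl⟩
    obtain ⟨μ, hμ, hinv⟩ := hΓ.finite_covolume
    have hdesc : ∀ a b : G, QuotientGroup.leftRel Γ a b →
        ((Φ a).1 : Heisenberg ⧸ Λ) = (Φ b).1 := by
      intro a b hab
      have h1 := ((hσ.mem_iff_of_diffeomorph _).1 (QuotientGroup.leftRel_apply.1 hab)).1
      have h2 := (hΦ a (a⁻¹ * b)).1
      rw [mul_inv_cancel_left] at h2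
      rw [QuotientGroup.eq, h2, inv_mul_cancel_left]
      exact h1
    let p : G ⧸ Γ → Heisenberg ⧸ Λ := Quotient.lift (fun g => ((Φ g).1 : Heisenberg ⧸ Λ)) hdesc
    have hp : Continuous p := (continuous_quotient_mk'.comp
      (continuous_fst.comp Φ.continuous)).quotient_lift hdesc
    have hps : ∀ (g : G) (m : G ⧸ Γ), p (g • m) = (Φ g).1 • p m := by
      intro g m
      obtain ⟨b, rfl⟩ := QuotientGroup.mk_surjective m
      change ((Φ (g * b)).1 : Heisenberg ⧸ Λ) = (((Φ g).1 * (Φ b).1 : Heisenberg) : Heisenberg ⧸ Λ)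
      rw [(hΦ g b).1]
    refine ⟨μ.map p, Measure.isProbabilityMeasure_map hp.measurable.aemeasurable, fun h => ?_⟩
    have h1 : Measurable (fun m : G ⧸ Γ => Φ.symm (h, 0) • m) :=
      (continuous_const_smul _).measurable
    have h2 : Measurable (fun m : Heisenberg ⧸ Λ => h • m) :=
      (continuous_const_smul _).measurable
    rw [Measure.map_map h2 hp.measurable]
    conv_rhs => rw [← hinv (Φ.symm (h, 0)), Measure.map_map hp.measurable h1]
    congr 1
    ext m
    simp only [Function.comp_apply]
    rw [hps, Φ.apply_symm_apply]

/-- `G ⧸ Γ` and the product are both images of `G` under open quotient maps with the same fibres. -/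
theorem IsAdapted.exists_homeomorph {k : ℕ}
    {Φ : Diffeomorph 𝓘(ℝ, E) (𝓘(ℝ, ℝ × ℝ × ℝ).prod 𝓘(ℝ, Fin d → ℝ))
          G (Heisenberg × (Fin d → ℝ)) ∞}
    (hΦ : ∀ g g' : G, (Φ (g * g')).1 = (Φ g).1 * (Φ g').1 ∧
          (Φ (g * g')).2 = (Φ g).2 + (Φ g').2)
    (hσ : IsAdapted (Φ.trans (symDiffeomorph d)).toHomeomorph Γ k) :
    ∃ F : G ⧸ Γ ≃ₜ (Heisenberg ⧸ Heisenberg.stdLattice k hσ.pos) × (Fin d → UnitAddCircle),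
      ∀ g : G, F (QuotientGroup.mk g) =
          (QuotientGroup.mk (Φ g).1, fun i => (((Φ g).2 i : ℝ) : UnitAddCircle)) := by
  set Λ := Heisenberg.stdLattice k hσ.pos
  let q : Heisenberg × (Fin d → ℝ) → (Heisenberg ⧸ Λ) × (Fin d → UnitAddCircle) :=
    Prod.map QuotientGroup.mk (Pi.map fun _ (t : ℝ) => (t : UnitAddCircle))
  have hq : IsOpenQuotientMap q :=
    QuotientGroup.isOpenQuotientMap_mk.prodMap
      (IsOpenQuotientMap.piMap fun _ => QuotientAddGroup.isOpenQuotientMap_mk)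
  have hqΦ : IsOpenQuotientMap (fun g : G => q (Φ g)) :=
    hq.comp Φ.toHomeomorph.isOpenQuotientMap
  have hker : ∀ a b : G, q (Φ a) = q (Φ b) ↔ a⁻¹ * b ∈ Γ := by
    intro a b
    have h2 := hΦ a (a⁻¹ * b)
    rw [mul_inv_cancel_left] at h2
    rw [hσ.mem_iff_of_diffeomorph, Prod.ext_iff]
    refine and_congr ?_ ?_
    · change ((Φ a).1 : Heisenberg ⧸ Λ) = (Φ b).1 ↔ _
      rw [QuotientGroup.eq, h2.1, inv_mul_cancel_left]
    · change (fun i => ((Φ a).2 i : UnitAddCircle)) = (fun i => ((Φ b).2 i : UnitAddCircle)) ↔ _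
      rw [h2.2, funext_iff]
      simp only [funext_iff, Pi.add_apply]
      rw [← Classical.skolem (p := fun i (n : ℤ) => (Φ (a⁻¹ * b)).2 i = n)]
      refine forall_congr' fun i => ?_
      rw [AddCircle.coe_add, left_eq_add, AddCircle.coe_eq_zero_iff]
      simp only [zsmul_eq_mul, mul_one, eq_comm]
  let F : G ⧸ Γ → (Heisenberg ⧸ Λ) × (Fin d → UnitAddCircle) :=
    Quotient.lift (fun g => q (Φ g)) fun a b hab => (hker a b).2 (QuotientGroup.leftRel_apply.1 hab)
  have hF : Continuous F := hqΦ.continuous.quotient_lift _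
  have hbij : Function.Bijective F := by
    constructor
    · intro m m' h
      obtain ⟨a, rfl⟩ := QuotientGroup.mk_surjective m
      obtain ⟨b, rfl⟩ := QuotientGroup.mk_surjective m'
      exact QuotientGroup.eq.2 ((hker a b).1 h)
    · intro m
      obtain ⟨g, hg⟩ := hqΦ.surjective m
      exact ⟨g, hg⟩
  have hopen : IsOpenMap F := by
    intro U hU
    have h1 := hqΦ.isOpenMap _ (hU.preimage continuous_quotient_mk')
    convert! h1 using 1
    ext m
    constructor
    · rintro ⟨n, hn, rfl⟩
      obtain ⟨g, rfl⟩ := QuotientGroup.mk_surjective n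
      exact ⟨g, hn, rfl⟩
    · rintro ⟨g, hg, rfl⟩
      exact ⟨_, hg, rfl⟩
  exact ⟨(Equiv.ofBijective F hbij).toHomeomorphOfContinuousOpen hF hopen, fun g => rfl⟩

theorem IsAdapted.blockable_iff_blockable_heisenberg [IsTopologicalGroup G] [T1Space (G ⧸ Γ)]
    {k : ℕ}
    {Φ : Diffeomorph 𝓘(ℝ, E) (𝓘(ℝ, ℝ × ℝ × ℝ).prod 𝓘(ℝ, Fin d → ℝ))
          G (Heisenberg × (Fin d → ℝ)) ∞}
    (hσ : IsAdapted (Φ.trans (symDiffeomorph d)).toHomeomorph Γ k) (g₁ g₂ : G) :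
    Blockable (g₁ : G ⧸ Γ) (g₂ : G ⧸ Γ) ↔
      Blockable ((Φ g₁).1 : Heisenberg ⧸ Heisenberg.stdLattice k hσ.pos) (Φ g₂).1 := by
  have hdisc := (Heisenberg.isDiscrete_stdLattice k hσ.pos).to_subtype
  have : T1Space (Heisenberg ⧸ Heisenberg.stdLattice k hσ.pos) :=
    QuotientGroup.t1Space_of_isClosed Subgroup.isClosed_of_discrete
  rw [hσ.blockable_iff, (Heisenberg.isAdapted_symCoord k hσ.pos).blockable_iff]
  -- Rationality involves only `x` and `y`, which the Heisenberg component shares with the full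
  -- coordinates.
  rfl

end Decomposition

/-! ### Smooth charts of the quotient by a discrete subgroup -/

section QuotientCharts

variable {E : Type*} [NormedAddCommGroup E] [NormedSpace ℝ E]
  {G : Type*} [TopologicalSpace G] [ChartedSpace E G] [Group G] {Γ : Subgroup G}

/-- `h⁻¹ * ℓ h` is continuous with values in the discrete group `Γ`, hence locally constant. -/
theorem eventually_section_eq_mul [IsTopologicalGroup G] (hΓ : IsDiscrete (Γ : Set G))
    {ℓ : OpenPartialHomeomorph (G ⧸ Γ) G}
    (hℓ : ∀ m ∈ ℓ.source, (ℓ m : G ⧸ Γ) = m) {g : G} (hg : (g : G ⧸ Γ) ∈ ℓ.source) :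
    ∀ᶠ h : G in 𝓝 g, ℓ (h : G ⧸ Γ) = h * (g⁻¹ * ℓ (g : G ⧸ Γ)) := by
  have hmk : Continuous (QuotientGroup.mk : G → G ⧸ Γ) := continuous_quotient_mk'
  have hmem : ∀ h : G, (h : G ⧸ Γ) ∈ ℓ.source → h⁻¹ * ℓ (h : G ⧸ Γ) ∈ Γ := fun h hh =>
    QuotientGroup.eq.1 (hℓ _ hh).symm
  have hcont : ContinuousAt (fun h : G => h⁻¹ * ℓ (h : G ⧸ Γ)) g :=
    continuousAt_id.inv.mul ((ℓ.continuousAt hg).comp hmk.continuousAt)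
  have hU := isDiscrete_iff_nhdsWithin.1 hΓ _ (hmem g hg)
  have h1 : ∀ᶠ γ in 𝓝 (g⁻¹ * ℓ (g : G ⧸ Γ)), γ ∈ (Γ : Set G) → γ = g⁻¹ * ℓ (g : G ⧸ Γ) := by
    rw [← eventually_nhdsWithin_iff, hU]
    simp
  filter_upwards [hcont.eventually h1,
    (hmk.continuousAt (x := g)).eventually (ℓ.open_source.mem_nhds hg)] with h h2 h3
  rw [← h2 (hmem h h3), mul_inv_cancel_left]

/-- Two local sections differ locally by right translation with an element of `Γ`, which is smooth.
Arbitrary sections and charts are allowed so that adapted charts of the quotient can be used later.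
-/
theorem mem_contDiffGroupoid_of_sections [LieGroup 𝓘(ℝ, E) ∞ G] (hΓ : IsDiscrete (Γ : Set G))
    {ℓ ℓ' : OpenPartialHomeomorph (G ⧸ Γ) G}
    (hℓ : ∀ g ∈ ℓ.target, ℓ.symm g = (g : G ⧸ Γ))
    (hℓ' : ∀ g ∈ ℓ'.target, ℓ'.symm g = (g : G ⧸ Γ))
    {φ φ' : OpenPartialHomeomorph G E} (hφ : φ ∈ IsManifold.maximalAtlas 𝓘(ℝ, E) ∞ G)
    (hφ' : φ' ∈ IsManifold.maximalAtlas 𝓘(ℝ, E) ∞ G) :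
    (ℓ.trans φ).symm.trans (ℓ'.trans φ') ∈ contDiffGroupoid ∞ 𝓘(ℝ, E) := by
  have : IsTopologicalGroup G := topologicalGroup_of_lieGroup 𝓘(ℝ, E) ∞
  have key : ∀ {ℓ ℓ' : OpenPartialHomeomorph (G ⧸ Γ) G},
      (∀ g ∈ ℓ.target, ℓ.symm g = (g : G ⧸ Γ)) → (∀ g ∈ ℓ'.target, ℓ'.symm g = (g : G ⧸ Γ)) →
      ∀ {φ φ' : OpenPartialHomeomorph G E}, φ ∈ IsManifold.maximalAtlas 𝓘(ℝ, E) ∞ G →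
      φ' ∈ IsManifold.maximalAtlas 𝓘(ℝ, E) ∞ G →
      ContDiffOn ℝ ∞ ((ℓ.trans φ).symm.trans (ℓ'.trans φ'))
        ((ℓ.trans φ).symm.trans (ℓ'.trans φ')).source := by
    intro ℓ ℓ' hℓ hℓ' φ φ' hφ hφ' x hx
    simp only [OpenPartialHomeomorph.trans_source, OpenPartialHomeomorph.symm_source,
      OpenPartialHomeomorph.trans_target, Set.mem_inter_iff, Set.mem_preimage,
      OpenPartialHomeomorph.coe_trans_symm, Function.comp_apply] at hx
    obtain ⟨⟨hx1, hx2⟩, hx3, hx4⟩ := hx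
    have hsec : ∀ m ∈ ℓ'.source, (ℓ' m : G ⧸ Γ) = m := fun m hm => by
      rw [← hℓ' _ (ℓ'.map_source hm), ℓ'.left_inv hm]
    rw [hℓ _ hx2] at hx3 hx4
    have h1 := eventually_section_eq_mul hΓ hsec hx3
    have hφc : ContinuousAt φ.symm x := φ.continuousAt_symm hx1
    have h2 : ∀ᶠ y in 𝓝 x, ((ℓ.trans φ).symm.trans (ℓ'.trans φ')) y =
        φ' (φ.symm y * ((φ.symm x)⁻¹ * ℓ' (φ.symm x : G ⧸ Γ))) := by
      filter_upwards [hφc.eventually h1, hφc.eventually (ℓ.open_target.mem_nhds hx2)] with y hy hy2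
      change φ' (ℓ' (ℓ.symm (φ.symm y))) = _
      rw [hℓ _ hy2, hy]
    have h3 : ContMDiffAt 𝓘(ℝ, E) 𝓘(ℝ, E) ∞ φ.symm x :=
      contMDiffAt_symm_of_mem_maximalAtlas hφ hx1
    have h4 : ContMDiff 𝓘(ℝ, E) 𝓘(ℝ, E) ∞
        (fun g : G => g * ((φ.symm x)⁻¹ * ℓ' (φ.symm x : G ⧸ Γ))) := contMDiff_mul_right
    have h5 : ContMDiffAt 𝓘(ℝ, E) 𝓘(ℝ, E) ∞ φ'
        (φ.symm x * ((φ.symm x)⁻¹ * ℓ' (φ.symm x : G ⧸ Γ))) := by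
      rw [mul_inv_cancel_left]
      exact contMDiffAt_of_mem_maximalAtlas hφ' hx4
    have h6 := ContMDiffAt.comp x h5 ((h4.contMDiffAt (x := φ.symm x)).comp x h3)
    exact ((contMDiffAt_iff_contDiffAt.1 h6).congr_of_eventuallyEq h2).contDiffWithinAt
  rw [contDiffGroupoid, mem_groupoid_of_pregroupoid]
  have h1 := key hℓ hℓ' hφ hφ'
  have h2 := key hℓ' hℓ hφ' hφ
  constructor
  · change ContDiffOn ℝ ∞ _ (_ ∩ Set.range id)
    rw [Set.range_id, Set.inter_univ]
    exact h1
  · change ContDiffOn ℝ ∞ _ (_ ∩ Set.range id)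
    rw [Set.range_id, Set.inter_univ]
    have h3 : ((ℓ.trans φ).symm.trans (ℓ'.trans φ')).symm =
        (ℓ'.trans φ').symm.trans (ℓ.trans φ) := by
      rw [OpenPartialHomeomorph.trans_symm_eq_symm_trans_symm, OpenPartialHomeomorph.symm_symm]
    rw [← h3] at h2
    exact h2

variable [LieGroup 𝓘(ℝ, E) ∞ G]

theorem isManifold_quotient (hΓ : IsDiscrete (Γ : Set G)) :
    letI : ChartedSpace E (G ⧸ Γ) := quotientChartedSpace E Γ hΓ
    IsManifold 𝓘(ℝ, E) ∞ (G ⧸ Γ) := by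
  let _ : ChartedSpace E (G ⧸ Γ) := quotientChartedSpace E Γ hΓ
  have : HasGroupoid (G ⧸ Γ) (contDiffGroupoid ∞ 𝓘(ℝ, E)) := by
    refine ⟨?_⟩
    rintro _ _ ⟨q, rfl⟩ ⟨q', rfl⟩
    refine mem_contDiffGroupoid_of_sections hΓ (fun g _ => ?_) (fun g _ => ?_)
      (IsManifold.chart_mem_maximalAtlas _) (IsManifold.chart_mem_maximalAtlas _)
    · rw [IsLocalHomeomorph.localInverseAt_symm]
    · rw [IsLocalHomeomorph.localInverseAt_symm]
  exact IsManifold.mk' _ _ _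

theorem section_trans_mem_maximalAtlas (hΓ : IsDiscrete (Γ : Set G))
    {ℓ : OpenPartialHomeomorph (G ⧸ Γ) G} (hℓ : ∀ g ∈ ℓ.target, ℓ.symm g = (g : G ⧸ Γ))
    {φ : OpenPartialHomeomorph G E} (hφ : φ ∈ IsManifold.maximalAtlas 𝓘(ℝ, E) ∞ G) :
    letI : ChartedSpace E (G ⧸ Γ) := quotientChartedSpace E Γ hΓ
    ℓ.trans φ ∈ IsManifold.maximalAtlas 𝓘(ℝ, E) ∞ (G ⧸ Γ) := by
  let _ : ChartedSpace E (G ⧸ Γ) := quotientChartedSpace E Γ hΓ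
  rw [IsManifold.mem_maximalAtlas_iff, mem_maximalAtlas_iff]
  rintro _ ⟨q, rfl⟩
  constructor
  · refine mem_contDiffGroupoid_of_sections hΓ hℓ (fun g _ => ?_) hφ
      (IsManifold.chart_mem_maximalAtlas _)
    rw [IsLocalHomeomorph.localInverseAt_symm]
  · refine mem_contDiffGroupoid_of_sections hΓ (fun g _ => ?_) hℓ
      (IsManifold.chart_mem_maximalAtlas _) hφ
    rw [IsLocalHomeomorph.localInverseAt_symm]

end QuotientCharts

/-! ### The set of blockable pairs -/

section BlockableSet

section Topological

variable {d : ℕ} {G : Type*} [Group G] [TopologicalSpace G] {σ : G ≃ₜ SymSpace d}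
  {Γ : Subgroup G} {k : ℕ}

/-- The pairs for which the differences of the `x` and of the `y` coordinates are congruent to
`a` and `b` modulo the integers. -/
def congruentPairs (σ : G ≃ₜ SymSpace d) (Γ : Subgroup G) (a b : ℝ) :
    Set ((G ⧸ Γ) × (G ⧸ Γ)) :=
  {p | ∃ g₁ g₂ : G, (g₁ : G ⧸ Γ) = p.1 ∧ (g₂ : G ⧸ Γ) = p.2 ∧ ∃ m n : ℤ,
    (σ g₂).1 - (σ g₁).1 = a + m ∧ (σ g₂).2.1 - (σ g₁).2.1 = b + n}

/-- Other representatives change `x` and `y` by integers, so the condition can be tested on any of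
them. -/
theorem IsAdapted.mk_mem_congruentPairs (hσ : IsAdapted σ Γ k) {a b : ℝ} {g₁ g₂ : G} :
    ((g₁ : G ⧸ Γ), (g₂ : G ⧸ Γ)) ∈ congruentPairs σ Γ a b ↔ ∃ m n : ℤ,
      (σ g₂).1 - (σ g₁).1 = a + m ∧ (σ g₂).2.1 - (σ g₁).2.1 = b + n := by
  have hshift : ∀ g g' : G, (g : G ⧸ Γ) = g' → ∃ m n : ℤ, (σ g').1 = (σ g).1 + m ∧
      (σ g').2.1 = (σ g).2.1 + n := by
    intro g g' h
    rw [← σ.symm_apply_apply g, ← σ.symm_apply_apply g', hσ.mk_symm_eq_iff] at h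
    obtain ⟨m, n, c, w, h⟩ := h
    refine ⟨m, n, ?_, ?_⟩ <;> rw [h] <;> simp [symMul, latticePoint]
  constructor
  · rintro ⟨h₁, h₂, e₁, e₂, m, n, hm, hn⟩
    obtain ⟨m₁, n₁, hm₁, hn₁⟩ := hshift _ _ e₁
    obtain ⟨m₂, n₂, hm₂, hn₂⟩ := hshift _ _ e₂
    refine ⟨m + m₂ - m₁, n + n₂ - n₁, ?_, ?_⟩
    · rw [hm₁, hm₂]
      push_cast
      linarith
    · rw [hn₁, hn₂]
      push_cast
      linarith
  · rintro ⟨m, n, hm, hn⟩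
    exact ⟨g₁, g₂, rfl, rfl, m, n, hm, hn⟩

theorem IsAdapted.isClosed_congruentPairs [IsTopologicalGroup G] (hσ : IsAdapted σ Γ k)
    (a b : ℝ) : IsClosed (congruentPairs σ Γ a b) := by
  have hq : IsOpenQuotientMap
      (Prod.map (QuotientGroup.mk : G → G ⧸ Γ) (QuotientGroup.mk : G → G ⧸ Γ)) :=
    QuotientGroup.isOpenQuotientMap_mk.prodMap QuotientGroup.isOpenQuotientMap_mk
  rw [← hq.isQuotientMap.isClosed_preimage]
  have h1 : IsClosed (Set.range ((↑) : ℤ → ℝ)) := Int.isClosedEmbedding_coe_real.isClosed_range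
  have hc1 : Continuous fun p : G × G => (σ p.2).1 - (σ p.1).1 - a := by fun_prop
  have hc2 : Continuous fun p : G × G => (σ p.2).2.1 - (σ p.1).2.1 - b := by fun_prop
  convert! (h1.preimage hc1).inter (h1.preimage hc2) using 1
  ext ⟨g₁, g₂⟩
  change ((g₁ : G ⧸ Γ), (g₂ : G ⧸ Γ)) ∈ congruentPairs σ Γ a b ↔ _
  rw [hσ.mk_mem_congruentPairs]
  simp only [Set.mem_inter_iff, Set.mem_preimage, Set.mem_range]
  constructor
  · rintro ⟨m, n, hm, hn⟩
    exact ⟨⟨m, by linarith⟩, n, by linarith⟩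
  · rintro ⟨⟨m, hm⟩, n, hn⟩
    exact ⟨m, n, by linarith, by linarith⟩

theorem IsAdapted.setOf_blockable [IsTopologicalGroup G] [T1Space (G ⧸ Γ)]
    (hσ : IsAdapted σ Γ k) {f : ℕ → ℚ × ℚ} (hf : Function.Surjective f) :
    {p : (G ⧸ Γ) × (G ⧸ Γ) | Blockable p.1 p.2} =
      ⋃ i, congruentPairs σ Γ (f i).1 (f i).2 := by
  ext ⟨n₁, n₂⟩
  obtain ⟨g₁, rfl⟩ := QuotientGroup.mk_surjective n₁
  obtain ⟨g₂, rfl⟩ := QuotientGroup.mk_surjective n₂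
  rw [Set.mem_iUnion]
  change Blockable (g₁ : G ⧸ Γ) (g₂ : G ⧸ Γ) ↔ _
  simp only [hσ.blockable_iff, hσ.mk_mem_congruentPairs]
  constructor
  · rintro ⟨a, b, ha, hb⟩
    obtain ⟨i, hi⟩ := hf (a, b)
    exact ⟨i, 0, 0, by simp [hi, ha], by simp [hi, hb]⟩
  · rintro ⟨i, m, n, hm, hn⟩
    exact ⟨(f i).1 + m, (f i).2 + n, by push_cast; exact hm, by push_cast; exact hn⟩

theorem IsAdapted.dense_blockable [IsTopologicalGroup G] [T1Space (G ⧸ Γ)]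
    (hσ : IsAdapted σ Γ k) : Dense {p : (G ⧸ Γ) × (G ⧸ Γ) | Blockable p.1 p.2} := by
  rintro ⟨n₁, n₂⟩
  obtain ⟨g₁, rfl⟩ := QuotientGroup.mk_surjective n₁
  obtain ⟨g₂, rfl⟩ := QuotientGroup.mk_surjective n₂
  -- The first point is fixed, and the `x`, `y` of the second are placed at displacement `v` from
  -- it: rational `v` give blockable pairs, and a suitable real `v` gives the original pair.
  let f : ℝ × ℝ → (G ⧸ Γ) × (G ⧸ Γ) := fun v => ((g₁ : G ⧸ Γ),
    ((σ.symm ((σ g₁).1 + v.1, (σ g₁).2.1 + v.2, (σ g₂).2.2) : G) : G ⧸ Γ))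
  have hmk : Continuous (QuotientGroup.mk : G → G ⧸ Γ) := continuous_quotient_mk'
  have hf : Continuous f :=
    continuous_const.prodMk (hmk.comp (σ.symm.continuous.comp (by fun_prop)))
  have hfv : f ((σ g₂).1 - (σ g₁).1, (σ g₂).2.1 - (σ g₁).2.1) =
      ((g₁ : G ⧸ Γ), (g₂ : G ⧸ Γ)) := by
    simp [f]
  have hdense : DenseRange (Prod.map ((↑) : ℚ → ℝ) ((↑) : ℚ → ℝ)) :=
    Rat.denseRange_cast.prodMap Rat.denseRange_cast
  rw [← hfv]
  refine map_mem_closure hf (hdense _) ?_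
  rintro _ ⟨⟨a, b⟩, rfl⟩
  change Blockable (g₁ : G ⧸ Γ) ((σ.symm _ : G) : G ⧸ Γ)
  rw [hσ.blockable_iff, σ.apply_symm_apply]
  exact ⟨a, b, by simp, by simp⟩

end Topological

variable {E : Type*} [NormedAddCommGroup E] [NormedSpace ℝ E]
  {G : Type*} [TopologicalSpace G] [ChartedSpace E G] [Group G] [LieGroup 𝓘(ℝ, E) ∞ G]
  {Γ : Subgroup G} {d k : ℕ}

/-- A global chart of `G` centered at `g`. -/
noncomputable def centeredChart
    (σ : Diffeomorph 𝓘(ℝ, E) 𝓘(ℝ, SymSpace d) G (SymSpace d) ∞)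
    (L : SymSpace d ≃L[ℝ] E) (g : G) : Diffeomorph 𝓘(ℝ, E) 𝓘(ℝ, E) G E ∞ where
  toFun h := L (σ h - σ g)
  invFun v := σ.symm (L.symm v + σ g)
  left_inv h := by simp
  right_inv v := by simp
  contMDiff_toFun := by
    have h : ContDiff ℝ ∞ fun u : SymSpace d => L (u - σ g) :=
      L.contDiff.comp (contDiff_id.sub contDiff_const)
    exact h.contMDiff.comp σ.contMDiff
  contMDiff_invFun := by
    have h : ContDiff ℝ ∞ fun v : E => L.symm v + σ g := L.symm.contDiff.add contDiff_const
    exact σ.symm.contMDiff.comp h.contMDiff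

theorem centeredChart_mem_maximalAtlas
    (σ : Diffeomorph 𝓘(ℝ, E) 𝓘(ℝ, SymSpace d) G (SymSpace d) ∞)
    (L : SymSpace d ≃L[ℝ] E) (g : G) :
    (centeredChart σ L g).toHomeomorph.toOpenPartialHomeomorph ∈
      IsManifold.maximalAtlas 𝓘(ℝ, E) ∞ G := by
  rw [IsManifold.mem_maximalAtlas_iff_contMDiffOn]
  exact ⟨(centeredChart σ L g).contMDiff.contMDiffOn,
    (centeredChart σ L g).symm.contMDiff.contMDiffOn⟩

/-- The linear map that computes the differences of the `x` and of the `y` coordinates. -/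
def differenceMap (L : SymSpace d ≃L[ℝ] E) : E × E →ₗ[ℝ] ℝ × ℝ where
  toFun v := ((L.symm v.2).1 - (L.symm v.1).1, (L.symm v.2).2.1 - (L.symm v.1).2.1)
  map_add' v w := by
    simp only [Prod.fst_add, Prod.snd_add, map_add, Prod.mk_add_mk]
    congr 1 <;> ring
  map_smul' a v := by
    simp only [Prod.smul_fst, Prod.smul_snd, map_smul, smul_eq_mul, RingHom.id_apply,
      Prod.smul_mk]
    congr 1 <;> ring

theorem differenceMap_apply (L : SymSpace d ≃L[ℝ] E) (v : E × E) : differenceMap L v =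
    ((L.symm v.2).1 - (L.symm v.1).1, (L.symm v.2).2.1 - (L.symm v.1).2.1) := rfl

theorem finrank_ker_differenceMap [FiniteDimensional ℝ E] (L : SymSpace d ≃L[ℝ] E) :
    Module.finrank ℝ (LinearMap.ker (differenceMap L)) + 2 = Module.finrank ℝ (E × E) := by
  have hsurj : LinearMap.range (differenceMap L) = ⊤ := by
    rw [LinearMap.range_eq_top]
    rintro ⟨a, b⟩
    exact ⟨(0, L (a, b, 0, 0)), by simp [differenceMap_apply]⟩
  have h := LinearMap.finrank_range_add_finrank_ker (differenceMap L)
  rw [hsurj, finrank_top, Module.finrank_prod (M := ℝ), Module.finrank_self] at h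
  omega

theorem IsAdapted.isClosedSubmanifold_congruentPairs [FiniteDimensional ℝ E]
    {σ : Diffeomorph 𝓘(ℝ, E) 𝓘(ℝ, SymSpace d) G (SymSpace d) ∞}
    (hσ : IsAdapted σ.toHomeomorph Γ k) (L : SymSpace d ≃L[ℝ] E) (hΓ : IsDiscrete (Γ : Set G))
    (a b : ℝ) :
    letI : ChartedSpace E (G ⧸ Γ) := quotientChartedSpace E Γ hΓ
    IsClosedSubmanifold (𝓘(ℝ, E).prod 𝓘(ℝ, E)) 2 (congruentPairs σ.toHomeomorph Γ a b) := by
  let _ : ChartedSpace E (G ⧸ Γ) := quotientChartedSpace E Γ hΓ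
  have : IsManifold 𝓘(ℝ, E) ∞ (G ⧸ Γ) := isManifold_quotient hΓ
  have : IsTopologicalGroup G := topologicalGroup_of_lieGroup 𝓘(ℝ, E) ∞
  refine ⟨hσ.isClosed_congruentPairs a b, ?_⟩
  rintro ⟨n₁, n₂⟩ hn
  obtain ⟨g₁, rfl⟩ := QuotientGroup.mk_surjective n₁
  obtain ⟨g₂, rfl⟩ := QuotientGroup.mk_surjective n₂
  obtain ⟨m, n, hm, hn⟩ := hσ.mk_mem_congruentPairs.1 hn
  have hloc := isLocalHomeomorph_quotientMk Γ hΓ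
  let ℓ : G → OpenPartialHomeomorph (G ⧸ Γ) G := fun g => hloc.localInverseAt (x := g)
  have hℓ : ∀ g, ∀ h ∈ (ℓ g).target, (ℓ g).symm h = (h : G ⧸ Γ) := fun g h _ => by
    rw [hloc.localInverseAt_symm]
  let c : G → OpenPartialHomeomorph (G ⧸ Γ) E := fun g =>
    (ℓ g).trans (centeredChart σ L g).toHomeomorph.toOpenPartialHomeomorph
  have hc : ∀ g, c g ∈ IsManifold.maximalAtlas 𝓘(ℝ, E) ∞ (G ⧸ Γ) := fun g =>
    section_trans_mem_maximalAtlas hΓ (hℓ g) (centeredChart_mem_maximalAtlas σ L g)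
  let e₀ := (c g₁).prod (c g₂)
  have he₀ : e₀ ∈ IsManifold.maximalAtlas (𝓘(ℝ, E).prod 𝓘(ℝ, E)) ∞ ((G ⧸ Γ) × (G ⧸ Γ)) :=
    IsManifold.mem_maximalAtlas_prod (hc g₁) (hc g₂)
  -- On `W` the differences move by less than `1`, so the integers `m`, `n` cannot jump and only one
  -- sheet of the set appears in the chart; there it is the kernel of `differenceMap L`.
  let W : Set (E × E) := {v | |(differenceMap L v).1| < 1 ∧ |(differenceMap L v).2| < 1}
  have hW : IsOpen W := by
    have hD : Continuous (differenceMap L) := LinearMap.continuous_of_finiteDimensional _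
    exact (isOpen_lt hD.fst.abs continuous_const).inter (isOpen_lt hD.snd.abs continuous_const)
  have hs : IsOpen (e₀.source ∩ e₀ ⁻¹' W) := e₀.isOpen_inter_preimage hW
  have hsource : ∀ g : G, (g : G ⧸ Γ) ∈ (c g).source := fun g => by
    simp [c, ℓ]
  have happ : ∀ g h : G, c g (h : G ⧸ Γ) = L (σ (ℓ g (h : G ⧸ Γ)) - σ g) := fun g h => rfl
  have hself : ∀ g : G, c g (g : G ⧸ Γ) = 0 := fun g => by
    rw [happ]
    simp [ℓ]
  refine ⟨e₀.restr (e₀.source ∩ e₀ ⁻¹' W), restr_mem_maximalAtlas _ he₀ hs, ?_,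
    LinearMap.ker (differenceMap L), finrank_ker_differenceMap L, ?_⟩
  · rw [OpenPartialHomeomorph.restr_source, hs.interior_eq]
    have h1 : ((g₁ : G ⧸ Γ), (g₂ : G ⧸ Γ)) ∈ e₀.source := ⟨hsource g₁, hsource g₂⟩
    refine ⟨h1, h1, ?_⟩
    have h2 : e₀ ((g₁ : G ⧸ Γ), (g₂ : G ⧸ Γ)) = ((0, 0) : E × E) :=
      Prod.ext (hself g₁) (hself g₂)
    rw [Set.mem_preimage, h2]
    simp [W, differenceMap_apply]
  · rintro ⟨q₁, q₂⟩ hq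
    rw [OpenPartialHomeomorph.restr_source, hs.interior_eq] at hq
    obtain ⟨⟨hq₁, hq₂⟩, -, hqW⟩ := hq
    have hsec : ∀ g, ∀ q ∈ (c g).source, ((ℓ g q : G) : G ⧸ Γ) = q := by
      intro g q hq
      have h1 : q ∈ (ℓ g).source := by simpa [c] using hq
      rw [← hℓ g _ ((ℓ g).map_source h1), (ℓ g).left_inv h1]
    have hD : differenceMap L ((c g₁ q₁, c g₂ q₂) : E × E) =
        ((σ (ℓ g₂ q₂)).1 - (σ (ℓ g₁ q₁)).1 - (a + m),
          (σ (ℓ g₂ q₂)).2.1 - (σ (ℓ g₁ q₁)).2.1 - (b + n)) := by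
      rw [← hm, ← hn, differenceMap_apply]
      change ((L.symm (L (σ (ℓ g₂ q₂) - σ g₂))).1 - (L.symm (L (σ (ℓ g₁ q₁) - σ g₁))).1,
        (L.symm (L (σ (ℓ g₂ q₂) - σ g₂))).2.1 - (L.symm (L (σ (ℓ g₁ q₁) - σ g₁))).2.1) =
        ((σ (ℓ g₂ q₂)).1 - (σ (ℓ g₁ q₁)).1 - ((σ g₂).1 - (σ g₁).1),
          (σ (ℓ g₂ q₂)).2.1 - (σ (ℓ g₁ q₁)).2.1 - ((σ g₂).2.1 - (σ g₁).2.1))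
      simp only [ContinuousLinearEquiv.symm_apply_apply, Prod.fst_sub, Prod.snd_sub]
      congr 1 <;> ring
    have hmem : (q₁, q₂) ∈ congruentPairs σ.toHomeomorph Γ a b ↔ ∃ m n : ℤ,
        (σ (ℓ g₂ q₂)).1 - (σ (ℓ g₁ q₁)).1 = a + m ∧
          (σ (ℓ g₂ q₂)).2.1 - (σ (ℓ g₁ q₁)).2.1 = b + n := by
      have h1 := hσ.mk_mem_congruentPairs (a := a) (b := b) (g₁ := ℓ g₁ q₁) (g₂ := ℓ g₂ q₂)
      rwa [hsec g₁ q₁ hq₁, hsec g₂ q₂ hq₂] at h1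
    have hqW : |(differenceMap L ((c g₁ q₁, c g₂ q₂) : E × E)).1| < 1 ∧
        |(differenceMap L ((c g₁ q₁, c g₂ q₂) : E × E)).2| < 1 := hqW
    change _ ↔ ((c g₁ q₁, c g₂ q₂) : E × E) ∈ LinearMap.ker (differenceMap L)
    rw [hmem, LinearMap.mem_ker]
    rw [hD] at hqW ⊢
    constructor
    · rintro ⟨m', n', hm', hn'⟩
      rw [hm', hn'] at hqW ⊢
      have h1 : |a + m' - (a + m)| < 1 := hqW.1
      have h2 : |b + n' - (b + n)| < 1 := hqW.2
      have h3 : m' - m = 0 := Int.abs_lt_one_iff.1 (by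
        have : (a + m' - (a + m) : ℝ) = ((m' - m : ℤ) : ℝ) := by push_cast; ring
        rw [this] at h1
        exact_mod_cast h1)
      have h4 : n' - n = 0 := Int.abs_lt_one_iff.1 (by
        have : (b + n' - (b + n) : ℝ) = ((n' - n : ℤ) : ℝ) := by push_cast; ring
        rw [this] at h2
        exact_mod_cast h2)
      rw [sub_eq_zero.1 h3, sub_eq_zero.1 h4, sub_self, sub_self]
      rfl
    · intro h
      rw [Prod.mk_eq_zero, sub_eq_zero, sub_eq_zero] at h
      exact ⟨m, n, h⟩

end BlockableSet

theorem mainTheorem8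
    {E : Type*} [NormedAddCommGroup E] [NormedSpace ℝ E] [FiniteDimensional ℝ E] [CompleteSpace E]
    {G : Type*} [TopologicalSpace G] [T2Space G] [SimplyConnectedSpace G]
    [ChartedSpace E G] [Group G] [LieGroup 𝓘(ℝ, E) ∞ G]
    -- the Lie algebra of `G` is two-step nilpotent
    (h_two_step : LieModule.nilpotencyLength
      (GroupLieAlgebra 𝓘(ℝ, E) G) (GroupLieAlgebra 𝓘(ℝ, E) G) = 2)
    -- its quotient by the center has dimension two
    (h_dim : Module.finrank ℝ (GroupLieAlgebra 𝓘(ℝ, E) G ⧸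
      LieAlgebra.center ℝ (GroupLieAlgebra 𝓘(ℝ, E) G)) = 2)
    (Γ : Subgroup G) (hΓ : IsLattice Γ) :
    -- the decomposition of `G ⧸ Γ`, where `d + 1` is the dimension of the center
    (∃ d : ℕ,
      Module.finrank ℝ (LieAlgebra.center ℝ (GroupLieAlgebra 𝓘(ℝ, E) G)) = d + 1 ∧
      ∃ Λ : Subgroup Heisenberg, IsLattice Λ ∧
      -- a Lie group isomorphism of `G` with the product of the Heisenberg group and `ℝᵈ`
      ∃ Ψ : Diffeomorph 𝓘(ℝ, E) (𝓘(ℝ, ℝ × ℝ × ℝ).prod 𝓘(ℝ, Fin d → ℝ))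
          G (Heisenberg × (Fin d → ℝ)) ∞,
        (∀ g g' : G, (Ψ (g * g')).1 = (Ψ g).1 * (Ψ g').1 ∧
          (Ψ (g * g')).2 = (Ψ g).2 + (Ψ g').2) ∧
      -- that descends to an identification of `G ⧸ Γ` with `(Heisenberg ⧸ Λ) × Tᵈ`
      ∃ F : G ⧸ Γ ≃ₜ (Heisenberg ⧸ Λ) × (Fin d → UnitAddCircle),
        (∀ g : G, F (QuotientGroup.mk g) =
          (QuotientGroup.mk (Ψ g).1, fun i => (((Ψ g).2 i : ℝ) : UnitAddCircle))) ∧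
        ∀ n₁ n₂ : G ⧸ Γ, Blockable n₁ n₂ ↔ Blockable (F n₁).1 (F n₂).1) ∧
    -- a pair is blockable if and only if it is midpoint blockable
    (∀ n₁ n₂ : G ⧸ Γ, Blockable n₁ n₂ ↔ MidpointBlockable n₁ n₂) ∧
    -- every point is blockable away from itself
    (∀ n : G ⧸ Γ, Blockable n n) ∧
    -- the set of blockable pairs is a dense countable union of closed submanifolds of positive
    -- codimension
    (letI : ChartedSpace E (G ⧸ Γ) := quotientChartedSpace E Γ hΓ.discrete;
      Dense {p : (G ⧸ Γ) × (G ⧸ Γ) | Blockable p.1 p.2} ∧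
      ∃ S : ℕ → Set ((G ⧸ Γ) × (G ⧸ Γ)),
        (∀ i, ∃ k : ℕ, 0 < k ∧
          IsClosedSubmanifold (𝓘(ℝ, E).prod 𝓘(ℝ, E)) k (S i)) ∧
        {p : (G ⧸ Γ) × (G ⧸ Γ) | Blockable p.1 p.2} = ⋃ i, S i) := by
  have : IsTopologicalGroup G := topologicalGroup_of_lieGroup 𝓘(ℝ, E) ∞
  have := hΓ.discrete.to_subtype
  have : T1Space (G ⧸ Γ) := QuotientGroup.t1Space_of_isClosed Subgroup.isClosed_of_discrete
  obtain ⟨d, hd, L, hL⟩ := exists_isHeisenbergFrame h_two_step h_dim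
  obtain ⟨Ψ₀, hΨ₀⟩ := hL.exists_diffeomorph
  obtain ⟨k, Ψ, hΨ, hσ⟩ := hΓ.exists_adapted_diffeomorph Ψ₀ hΨ₀
  obtain ⟨F, hF⟩ := hσ.exists_homeomorph hΨ
  refine ⟨⟨d, hd, Heisenberg.stdLattice k hσ.pos, hΓ.isLattice_stdLattice hΨ hσ, Ψ, hΨ, F, hF,
    fun n₁ n₂ => ?_⟩, hσ.blockable_iff_midpointBlockable, hσ.blockable_self,
    hσ.dense_blockable, ?_⟩
  · obtain ⟨g₁, rfl⟩ := QuotientGroup.mk_surjective n₁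
    obtain ⟨g₂, rfl⟩ := QuotientGroup.mk_surjective n₂
    rw [hF, hF]
    exact hσ.blockable_iff_blockable_heisenberg g₁ g₂
  · obtain ⟨f, hf⟩ := exists_surjective_nat (ℚ × ℚ)
    -- The codimension `2` counts the two conditions on `x` and `y`. Here `L` serves only as a
    -- linear identification of `SymSpace d` with the model space.
    exact ⟨fun i => congruentPairs _ Γ (f i).1 (f i).2, fun i => ⟨2, two_pos,
      hσ.isClosedSubmanifold_congruentPairs L.toContinuousLinearEquiv hΓ.discrete _ _⟩,
      hσ.setOf_blockable hf⟩
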